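/- Let $\Gamma$ be a finitely generated non-elementary Fuchsian group acting on the hyperbolic disc $\mathbb D$, and let $\mathcal R\subset\mathbb D$ be a fundamental domain for $\Gamma$ which is a finite-sided convex polygon, closed in $\mathbb D$, with vertices in $\mathbb D\cup\partial\mathbb D$ and all interior angles strictly less than $\pi$ (adjacent vertices on $\partial\mathbb D$ may be joined by an arc of $\partial\mathbb D$, which is not counted as a side), whose images under $\Gamma$ form a locally finite tessellation of $\mathbb D$. Assume that the sides are paired: for each side $s$ there is $e\in\Gamma$ such that $e(s)$ is a side and $\mathcal R\cap e(\mathcal R)=e(s)$; then $e^{-1}$ is called the exterior label of $s$ (it is the element with $e^{-1}(\mathcal R)$ adjacent to $\mathcal R$ along $s$). Let $\Gamma_0$ be the set of all exterior labels and $s(e)$ the side with exterior label $e\in\Gamma_0$. Let $\partial\mathcal R$ be the union of the sides, $|\partial\mathcal R|$ their number, and $\mathcal T=\bigcup_{g\in\Gamma}g(\partial\mathcal R)$. Assume that $\mathcal R$ has even corners: for each side of $\mathcal R$, the complete geodesic extending it is contained in $\mathcal T$. Let $\mathcal P\subset\partial\mathbb D$ be the set of endpoints of the complete geodesics contained in $\mathcal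 T$ that meet $\partial\mathcal R$ (possibly only in a vertex of $\mathcal R$ in $\mathbb D$). For $e\in\Gamma_0$ let $L(e)\subset\partial\mathbb D$ be the open arc bounding the half plane that contains $e(\mathcal R)$ and is cut off by the complete geodesic extending $s(e)$. Let $\mathcal I$ be the set of connected components of $\partial\mathbb D\setminus\mathcal P$ that are contained in $L(e)$ for some $e\in\Gamma_0$ (these are all components, except for the arcs of $\partial\mathbb D$ that bound $\mathcal R$ at infinity when $\mathcal R$ has infinite area). For each $I\in\mathcal I$ choose $e(I)\in\Gamma_0$ with $I\subset L(e(I))$, and let $f(x)=e(I)^{-1}(x)$ for $x\in I$. Let $P=(p_{I,J})_{I,J\in\mathcal I}$ be the matrix with $p_{I,J}=1$ if $f(I)\supset J$ and $p_{I,J}=0$ otherwise. Call a square matrix $A$ with non-negative entries irreducible if for some $n>0$ all entries of $A+A^2+\dots+A^n$ are positive, and strictly irreducible if both $A$ and $AA^T$ are irreducible. If $|\partial\mathcal R|\ge5$, then $\mathcal I$ is finite and, for every choice of $I\mapsto e(I)$, the matrix $P$ is strictly irreducible. -/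

import Mathlib

namespace BowenSeries

/-- The closed unit disc, that is, the hyperbolic disc together with its circle at infinity. -/
abbrev ClosedDisc : Type := ↥(Metric.closedBall (0 : ℂ) 1)

/-- The hyperbolic (Poincaré) disc. -/
def disc : Set ClosedDisc := {z | ‖(z : ℂ)‖ < 1}

/-- The circle at infinity. -/
def circleAtInfinity : Set ClosedDisc := {z | ‖(z : ℂ)‖ = 1}

/-- An oriented complete geodesic of the Poincaré disc, given by the equation
`α (1 + |z|²) + 2 Re (conj β · z) = 0` with `|α| < |β|`. For `α = 0` this is a diameter, and for
`α ≠ 0` it is the circle with centre `-β / α` that is orthogonal to the unit circle. -/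
structure Geodesic where
  α : ℝ
  β : ℂ
  abs_lt : |α| < ‖β‖

namespace Geodesic

/-- The left hand side of the equation of the geodesic, on the closed disc. Its sign
distinguishes the two open half planes, and the two open arcs which bound them at infinity. -/
noncomputable def side (h : Geodesic) (z : ClosedDisc) : ℝ :=
  h.α * (1 + ‖(z : ℂ)‖ ^ 2) + 2 * ((starRingEnd ℂ) h.β * (z : ℂ)).re

/-- The points of the complete geodesic in the open disc. -/
def line (h : Geodesic) : Set ClosedDisc := {z | z ∈ disc ∧ h.side z = 0}

/-- The two endpoints of the geodesic at infinity. -/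
def endpoints (h : Geodesic) : Set ClosedDisc := {z | z ∈ circleAtInfinity ∧ h.side z = 0}

end Geodesic

/-- The orientation preserving isometries of the disc, extended to the closed disc: the maps
`z ↦ (a z + b) / (conj b z + conj a)` with `|a|² - |b|² = 1`. -/
def IsDiscMobius (g : Equiv.Perm ClosedDisc) : Prop :=
  ∃ a b : ℂ, ‖a‖ ^ 2 - ‖b‖ ^ 2 = 1 ∧
    ∀ z : ClosedDisc, ((g z : ClosedDisc) : ℂ) =
      (a * (z : ℂ) + b) / ((starRingEnd ℂ) b * (z : ℂ) + (starRingEnd ℂ) a)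

/-- A Fuchsian group: a group of orientation preserving isometries of the disc which acts
properly discontinuously on the disc (equivalently, a discrete one). -/
structure IsFuchsian (Γ : Subgroup (Equiv.Perm ClosedDisc)) : Prop where
  mobius : ∀ g ∈ Γ, IsDiscMobius g
  properlyDiscontinuous : ∀ K : Set ClosedDisc, IsCompact K → K ⊆ disc →
    {g : Equiv.Perm ClosedDisc | g ∈ Γ ∧ ((g '' K) ∩ K).Nonempty}.Finite

/-- A group acting on the closed disc is non-elementary if it has no finite orbit there. -/
def IsNonElementary (Γ : Subgroup (Equiv.Perm ClosedDisc)) : Prop :=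
  ∀ z : ClosedDisc, {w : ClosedDisc | ∃ g ∈ Γ, g z = w}.Infinite

/-- A finite sided convex polygon: a finite intersection of closed half planes of the disc,
with non-empty interior. Vertices at infinity are allowed, as are arcs at infinity. -/
def IsPolygon (R : Set ClosedDisc) : Prop :=
  (∃ F : Set Geodesic, F.Finite ∧ R = {z | z ∈ disc ∧ ∀ h ∈ F, 0 ≤ h.side z}) ∧
    (interior R).Nonempty

/-- A side of `R` is a nondegenerate intersection of `R` with a supporting geodesic. Thus sides
are closed in the disc, distinct sides lie on distinct geodesics, and interior angles are less
than `π`. -/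
def IsSide (R s : Set ClosedDisc) : Prop :=
  ∃ h : Geodesic, (∀ z ∈ R, 0 ≤ h.side z) ∧ s = R ∩ h.line ∧ s.Nontrivial

/-- The set of sides of `R`. -/
def sides (R : Set ClosedDisc) : Set (Set ClosedDisc) := {s | IsSide R s}

/-- The union of the sides of `R`. -/
def boundary (R : Set ClosedDisc) : Set ClosedDisc := ⋃₀ sides R

/-- The label of the side `s` interior to `R` is the element `e` of `Γ` which carries `s` to a
side `e(s)` of `R` such that `R` and `e(R)` are adjacent along `e(s)`. -/
def IsInteriorLabel (Γ : Subgroup (Equiv.Perm ClosedDisc)) (R s : Set ClosedDisc)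
    (e : Equiv.Perm ClosedDisc) : Prop :=
  e ∈ Γ ∧ IsSide R (e '' s) ∧ R ∩ (e '' R) = e '' s

/-- The label of a side exterior to `R` is the inverse of its label interior to `R`. -/
def IsExteriorLabel (Γ : Subgroup (Equiv.Perm ClosedDisc)) (R s : Set ClosedDisc)
    (e : Equiv.Perm ClosedDisc) : Prop :=
  IsInteriorLabel Γ R s e⁻¹

/-- `R` is a finite sided convex fundamental polygon for `Γ` with paired sides. -/
structure IsFundamentalPolygon (Γ : Subgroup (Equiv.Perm ClosedDisc)) (R : Set ClosedDisc) :
    Prop where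
  polygon : IsPolygon R
  covers : ∀ z ∈ disc, ∃ g ∈ Γ, z ∈ g '' R
  disjoint : ∀ g ∈ Γ, g ≠ 1 → Disjoint (g '' interior R) (interior R)
  locallyFinite : ∀ K : Set ClosedDisc, IsCompact K → K ⊆ disc →
    {g : Equiv.Perm ClosedDisc | g ∈ Γ ∧ ((g '' R) ∩ K).Nonempty}.Finite
  paired : ∀ s, IsSide R s → ∃ e, IsInteriorLabel Γ R s e

/-- The union of the sides of the tessellation by the images of `R`. -/
def tessellation (Γ : Subgroup (Equiv.Perm ClosedDisc)) (R : Set ClosedDisc) :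
    Set ClosedDisc :=
  {z | ∃ g ∈ Γ, z ∈ g '' boundary R}

/-- Even corners: the complete geodesic through each side of `R` lies in the tessellation. -/
def HasEvenCorners (Γ : Subgroup (Equiv.Perm ClosedDisc)) (R : Set ClosedDisc) : Prop :=
  ∀ s, IsSide R s → ∀ h : Geodesic, s ⊆ h.line → h.line ⊆ tessellation Γ R

/-- The generators: the labels of the sides of `R`. -/
def generators (Γ : Subgroup (Equiv.Perm ClosedDisc)) (R : Set ClosedDisc) :
    Set (Equiv.Perm ClosedDisc) :=
  {e | ∃ s, IsSide R s ∧ IsExteriorLabel Γ R s e}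

/-- The open arc `L(e)` at infinity: the geodesic extending the side with exterior label `e`
bounds a half plane that contains `e(R)`, and `L(e)` is the arc at infinity of that half
plane. -/
def arc (Γ : Subgroup (Equiv.Perm ClosedDisc)) (R : Set ClosedDisc)
    (e : Equiv.Perm ClosedDisc) : Set ClosedDisc :=
  {ξ | ξ ∈ circleAtInfinity ∧ ∃ s, IsSide R s ∧ IsExteriorLabel Γ R s e ∧
    ∃ h : Geodesic, s ⊆ h.line ∧ (∀ z ∈ e '' R, 0 ≤ h.side z) ∧ 0 < h.side ξ}

/-- The endpoints at infinity of those complete geodesics in the tessellation which meet the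
boundary of `R`, if only in a vertex of `R` in the disc. -/
def partitionPoints (Γ : Subgroup (Equiv.Perm ClosedDisc)) (R : Set ClosedDisc) :
    Set ClosedDisc :=
  {ξ | ∃ h : Geodesic, h.line ⊆ tessellation Γ R ∧ (h.line ∩ boundary R).Nonempty ∧
    ξ ∈ h.endpoints}

/-- The connected components of the complement of the partition points in the circle at
infinity. -/
def intervals (Γ : Subgroup (Equiv.Perm ClosedDisc)) (R : Set ClosedDisc) :
    Set (Set ClosedDisc) :=
  {I | ∃ ξ ∈ circleAtInfinity \ partitionPoints Γ R,
    I = connectedComponentIn (circleAtInfinity \ partitionPoints Γ R) ξ}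

/-- The alphabet: the intervals on which the Markov map is defined, that is, those contained in
some arc `L(e)`. The only other intervals are the arcs in which `R` itself meets the circle at
infinity, which exist only if `R` has infinite area. -/
def Alphabet (Γ : Subgroup (Equiv.Perm ClosedDisc)) (R : Set ClosedDisc) : Type :=
  {I : Set ClosedDisc // I ∈ intervals Γ R ∧ ∃ e ∈ generators Γ R, I ⊆ arc Γ R e}

/-- `c` chooses for each interval `I` of the alphabet a generator `c I` with `I ⊆ L(c I)`. -/
def IsChoice (Γ : Subgroup (Equiv.Perm ClosedDisc)) (R : Set ClosedDisc)
    (c : Alphabet Γ R → Equiv.Perm ClosedDisc) : Prop :=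
  ∀ I : Alphabet Γ R, c I ∈ generators Γ R ∧ I.1 ⊆ arc Γ R (c I)

open Classical in
/-- The Markov map `f` defined by the choice `c`: it is `(c I)⁻¹` on each interval `I` of the
alphabet. Its values off the union of these (pairwise disjoint) intervals are irrelevant. -/
noncomputable def markovMap (Γ : Subgroup (Equiv.Perm ClosedDisc)) (R : Set ClosedDisc)
    (c : Alphabet Γ R → Equiv.Perm ClosedDisc) (x : ClosedDisc) : ClosedDisc :=
  if hx : ∃ I : Alphabet Γ R, x ∈ I.1 then (c hx.choose)⁻¹ x else x

open Classical in
/-- The transition matrix: the `(I, J)` entry is `1` if `f(I) ⊇ J`, and `0` otherwise. -/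
noncomputable def transitionMatrix (Γ : Subgroup (Equiv.Perm ClosedDisc))
    (R : Set ClosedDisc) (c : Alphabet Γ R → Equiv.Perm ClosedDisc) :
    Matrix (Alphabet Γ R) (Alphabet Γ R) ℝ :=
  Matrix.of fun I J => if J.1 ⊆ markovMap Γ R c '' I.1 then 1 else 0

open Classical in
/-- A matrix `A` with non-negative entries is irreducible if for some `n > 0` all entries of
`A + A² + ⋯ + Aⁿ` are positive. -/
def IrreducibleMatrix {ι : Type*} [Fintype ι] (A : Matrix ι ι ℝ) : Prop :=
  (∀ i j, 0 ≤ A i j) ∧ ∃ n : ℕ, 0 < n ∧ ∀ i j, 0 < (∑ k ∈ Finset.Icc 1 n, A ^ k) i j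

/-- A matrix `A` is strictly irreducible if both `A` and `A Aᵀ` are irreducible. -/
def StrictlyIrreducibleMatrix {ι : Type*} [Fintype ι] (A : Matrix ι ι ℝ) : Prop :=
  IrreducibleMatrix A ∧ IrreducibleMatrix (A * A.transpose)

end BowenSeries

namespace BowenSeries

open Set Filter Topology

set_option linter.unusedSectionVars false

/-! ### The Klein model -/

/-! In the Klein model every geodesic is the zero set of an affine functional `Geodesic.ev`, so
positions relative to geodesics become sign computations along segments. A wall is a complete
geodesic contained in the tessellation. By even corners the sides of all tiles lie on walls, and no
wall cuts the interior of a tile.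

The geometric input is that three walls never form a triangle when the polygon has at least four
sides (`not_isTriangle`). A triangle meets the interiors of finitely many tiles. A tile inside it
has more than three sides, so one of these extends to a wall cutting off a triangle that meets fewer
tiles, and descent ends in a contradiction. Hence two distinct walls which meet R and cross must
cross in R (`mem_of_cross`), and sides with overlapping exterior half planes share a vertex
(`adj_of_neg`). The adjacency graph of the sides therefore has degree at most two and no triangle;
this and the bound of five vertices is all the combinatorics uses (`IsPolygonGraph`).

A label carries the walls through one side of R to the walls through the paired side, which is the
Markov property (`exists_push`, `lab_mem`). Behind each side i there is a large interval, which no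
wall meeting R separates from R except the side itself (`exists_isLarge`). The Markov map sends it
over the whole core of the paired side, that is, over everything outside the half planes of that
side and of its neighbours. So the large interval of i covers that of k as soon as k is neither
equal nor adjacent to the side paired with i, and every interval is covered by some large interval
(`exists_subset_core`).

Conversely, every interval leads to a large one. For an interval that is not large, either its
Markov image contains a large interval, or that image contains an interval separated from R by fewer
walls (`large_or_exists_lt`); induct on that number. This works for every side behind which the
interval lies, hence for every choice of generators. It remains to count in the graph: two nonempty
sets of sides, each side of one being equal or adjacent to each side of the other, have at most four
elements in total (`card_add_card_le`). With five sides this connects the large intervals under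
transitions and under common successors, which gives the irreducibility of P and of its product with
its transpose. -/

/-- The Klein coordinate of a point of the closed disc. -/
noncomputable def kleinFun (z : ClosedDisc) : ClosedDisc :=
  ⟨(2 / (1 + ‖(z : ℂ)‖ ^ 2) : ℝ) • (z : ℂ), by
    have h1 : (0 : ℝ) < 1 + ‖(z : ℂ)‖ ^ 2 := by positivity
    rw [mem_closedBall_zero_iff, norm_smul, Real.norm_of_nonneg (by positivity), div_mul_eq_mul_div,
      div_le_one h1]
    nlinarith [sq_nonneg (1 - ‖(z : ℂ)‖)]⟩

/-- The inverse of the Klein coordinate. -/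
noncomputable def kleinInv (k : ClosedDisc) : ClosedDisc :=
  ⟨(1 / (1 + √(1 - ‖(k : ℂ)‖ ^ 2)) : ℝ) • (k : ℂ), by
    have h0 := Real.sqrt_nonneg (1 - ‖(k : ℂ)‖ ^ 2)
    have h1 : (0 : ℝ) < 1 + √(1 - ‖(k : ℂ)‖ ^ 2) := by positivity
    have h2 : ‖(k : ℂ)‖ ≤ 1 := mem_closedBall_zero_iff.1 k.2
    rw [mem_closedBall_zero_iff, norm_smul, Real.norm_of_nonneg (by positivity), div_mul_eq_mul_div,
      div_le_one h1]
    linarith⟩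

theorem norm_le_one (z : ClosedDisc) : ‖(z : ℂ)‖ ≤ 1 := mem_closedBall_zero_iff.1 z.2

theorem kleinInv_kleinFun (z : ClosedDisc) : kleinInv (kleinFun z) = z := by
  apply Subtype.ext
  have hz := norm_le_one z
  have h1 : (0 : ℝ) < 1 + ‖(z : ℂ)‖ ^ 2 := by positivity
  have hn : ‖(kleinFun z : ℂ)‖ = 2 / (1 + ‖(z : ℂ)‖ ^ 2) * ‖(z : ℂ)‖ := by
    simp only [kleinFun]
    rw [norm_smul, Real.norm_of_nonneg (by positivity)]
  have hs : √(1 - ‖(kleinFun z : ℂ)‖ ^ 2) = (1 - ‖(z : ℂ)‖ ^ 2) / (1 + ‖(z : ℂ)‖ ^ 2) := by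
    have e : 1 - ‖(kleinFun z : ℂ)‖ ^ 2 = ((1 - ‖(z : ℂ)‖ ^ 2) / (1 + ‖(z : ℂ)‖ ^ 2)) ^ 2 := by
      rw [hn]; field_simp; ring
    rw [e, Real.sqrt_sq (div_nonneg (by nlinarith [norm_nonneg (z : ℂ)]) h1.le)]
  show (1 / (1 + √(1 - ‖(kleinFun z : ℂ)‖ ^ 2)) : ℝ) • (kleinFun z : ℂ) = z
  rw [hs]
  simp only [kleinFun]
  rw [smul_smul]
  have : 1 / (1 + (1 - ‖(z : ℂ)‖ ^ 2) / (1 + ‖(z : ℂ)‖ ^ 2)) * (2 / (1 + ‖(z : ℂ)‖ ^ 2)) = (1 : ℝ) := by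
    field_simp
    ring
  rw [this, one_smul]

theorem kleinFun_kleinInv (k : ClosedDisc) : kleinFun (kleinInv k) = k := by
  apply Subtype.ext
  have hk := norm_le_one k
  have h0 := Real.sqrt_nonneg (1 - ‖(k : ℂ)‖ ^ 2)
  have hsq := Real.sq_sqrt (show 0 ≤ 1 - ‖(k : ℂ)‖ ^ 2 by nlinarith [norm_nonneg (k : ℂ)])
  have hn : ‖(kleinInv k : ℂ)‖ = 1 / (1 + √(1 - ‖(k : ℂ)‖ ^ 2)) * ‖(k : ℂ)‖ := by
    simp only [kleinInv]
    rw [norm_smul, Real.norm_of_nonneg (by positivity)]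
  show (2 / (1 + ‖(kleinInv k : ℂ)‖ ^ 2) : ℝ) • (kleinInv k : ℂ) = k
  rw [hn]
  simp only [kleinInv]
  rw [smul_smul]
  set s := √(1 - ‖(k : ℂ)‖ ^ 2)
  have hk2 : ‖(k : ℂ)‖ ^ 2 = 1 - s ^ 2 := by linarith
  have : 2 / (1 + (1 / (1 + s) * ‖(k : ℂ)‖) ^ 2) * (1 / (1 + s)) = (1 : ℝ) := by
    rw [mul_pow, hk2]
    have : (1 + s) ≠ 0 := by positivity
    have h3 : 1 + (1 / (1 + s)) ^ 2 * (1 - s ^ 2) = 2 / (1 + s) := by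
      field_simp; ring
    rw [h3]; field_simp
  rw [this, one_smul]

/-- The passage from the Poincaré model to the Klein model, in which the geodesics are
euclidean segments. -/
noncomputable def klein : ClosedDisc ≃ₜ ClosedDisc where
  toFun := kleinFun
  invFun := kleinInv
  left_inv := kleinInv_kleinFun
  right_inv := kleinFun_kleinInv
  continuous_toFun := by
    have h (z : ClosedDisc) : 1 + ‖(z : ℂ)‖ ^ 2 ≠ 0 := by positivity
    unfold kleinFun
    fun_prop (disch := exact h)
  continuous_invFun := by
    have h (z : ClosedDisc) : 1 + √(1 - ‖(z : ℂ)‖ ^ 2) ≠ 0 := by positivity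
    unfold kleinInv
    fun_prop (disch := exact h)

theorem klein_coe (z : ClosedDisc) :
    (klein z : ℂ) = (2 / (1 + ‖(z : ℂ)‖ ^ 2) : ℝ) • (z : ℂ) := rfl

theorem one_sub_norm_klein_sq (z : ClosedDisc) :
    1 - ‖(klein z : ℂ)‖ ^ 2 = ((1 - ‖(z : ℂ)‖ ^ 2) / (1 + ‖(z : ℂ)‖ ^ 2)) ^ 2 := by
  rw [klein_coe, norm_smul, Real.norm_of_nonneg (by positivity)]
  field_simp
  ring

theorem mem_disc_iff {z : ClosedDisc} : z ∈ disc ↔ ‖(klein z : ℂ)‖ < 1 := by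
  have h := one_sub_norm_klein_sq z
  have hz := norm_le_one z
  have hk := norm_le_one (klein z)
  have h1 : (0 : ℝ) < 1 + ‖(z : ℂ)‖ ^ 2 := by positivity
  show ‖(z : ℂ)‖ < 1 ↔ _
  constructor
  · intro h2
    have : 0 < (1 - ‖(z : ℂ)‖ ^ 2) / (1 + ‖(z : ℂ)‖ ^ 2) :=
      div_pos (by nlinarith [norm_nonneg (z : ℂ)]) h1
    have : 0 < 1 - ‖(klein z : ℂ)‖ ^ 2 := by rw [h]; positivity
    nlinarith [norm_nonneg (klein z : ℂ)]
  · intro h2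
    refine lt_of_le_of_ne hz fun h3 => ?_
    rw [h3] at h
    norm_num at h
    nlinarith [norm_nonneg (klein z : ℂ)]

theorem klein_of_mem_circle {z : ClosedDisc} (hz : z ∈ circleAtInfinity) : klein z = z := by
  apply Subtype.ext
  rw [klein_coe, show ‖(z : ℂ)‖ = 1 from hz]
  norm_num

theorem mem_circle_iff {z : ClosedDisc} : z ∈ circleAtInfinity ↔ ‖(klein z : ℂ)‖ = 1 := by
  constructor
  · intro h
    rw [klein_of_mem_circle h]; exact h
  · intro h
    have h1 : ¬ z ∈ disc := fun h' => by linarith [mem_disc_iff.1 h']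
    exact le_antisymm (norm_le_one z) (not_lt.1 h1)

theorem not_mem_disc_of_mem_circle {z : ClosedDisc} (hz : z ∈ circleAtInfinity) : z ∉ disc :=
  fun h => (show ‖(z : ℂ)‖ < 1 from h).ne hz

/-- The affine functional with coefficients `α`, `β` in Klein coordinates. -/
noncomputable def aff (α : ℝ) (β : ℂ) (z : ClosedDisc) : ℝ :=
  α + ((starRingEnd ℂ) β * (klein z : ℂ)).re

/-- The affine functional which defines a geodesic in Klein coordinates. -/
noncomputable def Geodesic.ev (h : Geodesic) (z : ClosedDisc) : ℝ := aff h.α h.β z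

theorem continuous_aff (α : ℝ) (β : ℂ) : Continuous (aff α β) := by
  have : Continuous fun z => (klein z : ℂ) := continuous_subtype_val.comp klein.continuous
  unfold aff
  exact continuous_const.add (Complex.continuous_re.comp (continuous_const.mul this))

theorem Geodesic.continuous_ev (h : Geodesic) : Continuous h.ev := continuous_aff _ _

theorem aff_add (α α' : ℝ) (β β' : ℂ) (z : ClosedDisc) :
    aff (α + α') (β + β') z = aff α β z + aff α' β' z := by
  simp [aff]; ring

theorem aff_smul (c α : ℝ) (β : ℂ) (z : ClosedDisc) :
    aff (c * α) (c * β) z = c * aff α β z := by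
  simp [aff]; ring

namespace Geodesic

theorem side_eq (h : Geodesic) (z : ClosedDisc) :
    h.side z = (1 + ‖(z : ℂ)‖ ^ 2) * h.ev z := by
  have h1 : (0 : ℝ) < 1 + ‖(z : ℂ)‖ ^ 2 := by positivity
  simp only [side, ev, aff, klein_coe, Complex.real_smul]
  rw [mul_left_comm, Complex.re_ofReal_mul]
  field_simp

theorem side_eq_zero_iff {h : Geodesic} {z : ClosedDisc} : h.side z = 0 ↔ h.ev z = 0 := by
  have h1 : (0 : ℝ) < 1 + ‖(z : ℂ)‖ ^ 2 := by positivity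
  rw [side_eq, mul_eq_zero, or_iff_right h1.ne']

theorem side_pos_iff {h : Geodesic} {z : ClosedDisc} : 0 < h.side z ↔ 0 < h.ev z := by
  have h1 : (0 : ℝ) < 1 + ‖(z : ℂ)‖ ^ 2 := by positivity
  rw [side_eq, mul_pos_iff_of_pos_left h1]

theorem side_nonneg_iff {h : Geodesic} {z : ClosedDisc} : 0 ≤ h.side z ↔ 0 ≤ h.ev z := by
  have h1 : (0 : ℝ) < 1 + ‖(z : ℂ)‖ ^ 2 := by positivity
  rw [side_eq, mul_nonneg_iff_of_pos_left h1]

theorem mem_line {h : Geodesic} {z : ClosedDisc} : z ∈ h.line ↔ z ∈ disc ∧ h.ev z = 0 := by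
  exact and_congr_right fun _ => side_eq_zero_iff

theorem mem_endpoints {h : Geodesic} {z : ClosedDisc} :
    z ∈ h.endpoints ↔ z ∈ circleAtInfinity ∧ h.ev z = 0 := by
  exact and_congr_right fun _ => side_eq_zero_iff

/-- The geodesic with the opposite orientation. -/
def neg (h : Geodesic) : Geodesic := ⟨-h.α, -h.β, by simpa using h.abs_lt⟩

@[simp] theorem ev_neg (h : Geodesic) (z : ClosedDisc) : h.neg.ev z = - h.ev z := by
  simp [ev, neg, aff]; ring

@[simp] theorem line_neg (h : Geodesic) : h.neg.line = h.line := by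
  ext z; simp [mem_line]

theorem β_ne_zero (h : Geodesic) : h.β ≠ 0 := fun h0 => by
  have := h.abs_lt
  rw [h0, norm_zero] at this
  exact absurd this (not_lt.2 (abs_nonneg _))

end Geodesic

/-! ### Segments -/

theorem exists_of_norm_le {k : ℂ} (hk : ‖k‖ ≤ 1) :
    ∃ z : ClosedDisc, (klein z : ℂ) = k :=
  ⟨klein.symm ⟨k, mem_closedBall_zero_iff.2 hk⟩, by simp⟩

theorem aff_comb {a b z : ClosedDisc} {t : ℝ}
    (h : (klein z : ℂ) = (klein a : ℂ) + (t : ℂ) * ((klein b : ℂ) - (klein a : ℂ))) (α : ℝ) (β : ℂ) :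
    aff α β z = (1 - t) * aff α β a + t * aff α β b := by
  simp only [aff, h]
  simp
  ring

/-- Points of the segment between two points of the closed disc. -/
theorem exists_mix (a b : ClosedDisc) {t : ℝ} (h0 : 0 ≤ t) (h1 : t ≤ 1) :
    ∃ z : ClosedDisc, (∀ α β, aff α β z = (1 - t) * aff α β a + t * aff α β b) ∧
      (t < 1 → a ∈ disc → z ∈ disc) ∧ (0 < t → b ∈ disc → z ∈ disc) := by
  have ha := norm_le_one (klein a)
  have hb := norm_le_one (klein b)
  have e : (klein a : ℂ) + (t : ℂ) * ((klein b : ℂ) - (klein a : ℂ)) =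
    ((1 - t : ℝ) : ℂ) * (klein a : ℂ) + (t : ℂ) * (klein b : ℂ) := by push_cast; ring
  have hn : ‖(klein a : ℂ) + (t : ℂ) * ((klein b : ℂ) - (klein a : ℂ))‖ ≤
      (1 - t) * ‖(klein a : ℂ)‖ + t * ‖(klein b : ℂ)‖ := by
    rw [e]
    refine (norm_add_le _ _).trans ?_
    rw [norm_mul, norm_mul, Complex.norm_of_nonneg (by linarith), Complex.norm_of_nonneg h0]
  obtain ⟨z, hz⟩ := exists_of_norm_le
    (k := (klein a : ℂ) + (t : ℂ) * ((klein b : ℂ) - (klein a : ℂ))) (by nlinarith)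
  refine ⟨z, aff_comb hz, fun ht h => ?_, fun ht h => ?_⟩
  · rw [mem_disc_iff] at h ⊢
    rw [hz]; nlinarith
  · rw [mem_disc_iff] at h ⊢
    rw [hz]; nlinarith

/-- A point of the disc can be moved a little in every direction. -/
theorem eventually_move {a : ClosedDisc} (ha : a ∈ disc) (d : ℂ) {V : Set ClosedDisc}
    (hV : V ∈ 𝓝 a) :
    ∀ᶠ t : ℝ in 𝓝 (0 : ℝ), ∃ z ∈ V, z ∈ disc ∧ (klein z : ℂ) = (klein a : ℂ) + (t : ℂ) * d := by
  have hV' : klein.symm ⁻¹' V ∈ 𝓝 (klein a) := by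
    apply klein.symm.continuous.continuousAt
    simpa using hV
  obtain ⟨W, hW, hWV⟩ := mem_nhds_subtype _ _ _ |>.1 hV'
  have hc : Continuous fun t : ℝ => (klein a : ℂ) + (t : ℂ) * d := by fun_prop
  have e0 : (klein a : ℂ) + ((0 : ℝ) : ℂ) * d = klein a := by simp
  have h0 : ‖(klein a : ℂ) + ((0 : ℝ) : ℂ) * d‖ < 1 := by
    rw [e0]; exact mem_disc_iff.1 ha
  have h1 : ∀ᶠ t : ℝ in 𝓝 (0 : ℝ), (klein a : ℂ) + (t : ℂ) * d ∈ W :=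
    hc.continuousAt.eventually_mem (by rw [e0]; exact hW)
  filter_upwards [hc.norm.continuousAt.eventually_lt continuousAt_const h0, h1] with t ht htW
  have hm : (klein a : ℂ) + (t : ℂ) * d ∈ Metric.closedBall (0 : ℂ) 1 :=
    mem_closedBall_zero_iff.2 ht.le
  have hz : (klein (klein.symm ⟨_, hm⟩) : ℂ) = (klein a : ℂ) + (t : ℂ) * d := by simp
  exact ⟨klein.symm ⟨_, hm⟩, hWV htW, mem_disc_iff.2 (by rw [hz]; exact ht), hz⟩

/-- A segment which starts in the disc can be extended a little. -/
theorem eventually_extend {a : ClosedDisc} (ha : a ∈ disc) (b : ClosedDisc) {V : Set ClosedDisc}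
    (hV : V ∈ 𝓝 a) :
    ∀ᶠ t : ℝ in 𝓝 (0 : ℝ), ∃ z ∈ V, z ∈ disc ∧
      ∀ α β, aff α β z = (1 - t) * aff α β a + t * aff α β b := by
  filter_upwards [eventually_move ha ((klein b : ℂ) - klein a) hV] with t ⟨z, hzV, hz, h⟩
  exact ⟨z, hzV, hz, aff_comb h⟩

/-- The points of a geodesic are midpoints of short segments of the geodesic. -/
theorem Geodesic.exists_near (h : Geodesic) {a : ClosedDisc} (ha : a ∈ disc) (h0 : h.ev a = 0)
    {V : Set ClosedDisc} (hV : V ∈ 𝓝 a) :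
    ∃ b ∈ V, ∃ b' ∈ V, b ∈ disc ∧ b' ∈ disc ∧ b ≠ a ∧ h.ev b = 0 ∧ h.ev b' = 0 ∧
      ∀ α β, aff α β b + aff α β b' = 2 * aff α β a := by
  have h1 := eventually_move ha (Complex.I * h.β) hV
  have h2 := (continuous_neg (G := ℝ)).tendsto' 0 0 neg_zero |>.eventually h1
  obtain ⟨t, ⟨⟨b, hbV, hb, hb'⟩, c, hcV, hc, hc'⟩, ht⟩ := (((h1.and h2).filter_mono
    (nhdsWithin_le_nhds (s := Ioi 0))).and (self_mem_nhdsWithin (s := Ioi (0 : ℝ)))).exists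
  have e (s : ℝ) (z : ClosedDisc) (hz : (klein z : ℂ) = (klein a : ℂ) + (s : ℂ) * (Complex.I * h.β)) :
      h.ev z = 0 := by
    rw [← h0]
    simp only [Geodesic.ev, aff, hz]
    simp
    ring
  refine ⟨b, hbV, c, hcV, hb, hc, ?_, e _ _ hb', e _ _ hc', fun α β => ?_⟩
  · rintro rfl
    have : (t : ℂ) * (Complex.I * h.β) = 0 := by simpa using hb'
    simp [h.β_ne_zero, (show t ≠ 0 from (ne_of_gt ht))] at this
  · simp only [aff, hb', hc']; simp; ring

theorem klein_ne {a b : ClosedDisc} (hab : a ≠ b) : (klein a : ℂ) ≠ klein b := fun h =>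
  hab (klein.injective (Subtype.ext h))

/-- A ray from a point of the disc reaches the circle. -/
theorem exists_exit {a b c : ClosedDisc} (ha : a ∈ disc) (hbc : b ≠ c) :
    ∃ t : ℝ, 0 < t ∧ ∃ ξ ∈ circleAtInfinity, ∀ α β,
      aff α β ξ = aff α β a + t * (aff α β b - aff α β c) := by
  set d : ℂ := (klein b : ℂ) - klein c
  have hd : 0 < ‖d‖ := norm_pos_iff.2 (sub_ne_zero.2 (klein_ne hbc))
  have hc : ContinuousOn (fun t : ℝ => ‖(klein a : ℂ) + (t : ℂ) * d‖) (Icc 0 (2 / ‖d‖)) := by fun_prop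
  have h0 : ‖(klein a : ℂ) + ((0 : ℝ) : ℂ) * d‖ < 1 := by simpa using mem_disc_iff.1 ha
  have h1 : 1 ≤ ‖(klein a : ℂ) + ((2 / ‖d‖ : ℝ) : ℂ) * d‖ := by
    have e1 : ‖((2 / ‖d‖ : ℝ) : ℂ) * d‖ = 2 := by
      rw [norm_mul, Complex.norm_of_nonneg (by positivity)]; field_simp
    have := norm_sub_norm_le (((2 / ‖d‖ : ℝ) : ℂ) * d) (-(klein a : ℂ))
    rw [norm_neg, sub_neg_eq_add, e1, add_comm (((2 / ‖d‖ : ℝ) : ℂ) * d)] at this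
    linarith [norm_le_one (klein a)]
  obtain ⟨t, ht, ht1⟩ := intermediate_value_Icc (by positivity) hc ⟨h0.le, h1⟩
  simp only at ht1
  obtain ⟨ξ, hξ⟩ := exists_of_norm_le ht1.le
  refine ⟨t, lt_of_le_of_ne ht.1 fun h => ?_, ξ, mem_circle_iff.2 (by rw [hξ, ht1]), fun α β => ?_⟩
  · rw [← h] at ht1; linarith
  · simp only [aff, hξ, d]; simp; ring

/-- A functional which vanishes at two points of a geodesic is a multiple of its functional. -/
theorem Geodesic.exists_smul (h : Geodesic) {a b : ClosedDisc} (hab : a ≠ b) (ha : h.ev a = 0)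
    (hb : h.ev b = 0) {α : ℝ} {β : ℂ} (ha' : aff α β a = 0) (hb' : aff α β b = 0) :
    ∃ c : ℝ, ∀ z, aff α β z = c * h.ev z := by
  have hk := klein_ne hab
  simp only [Geodesic.ev, aff, Complex.mul_re, Complex.conj_re, Complex.conj_im] at *
  set p := (klein a : ℂ)
  set q := (klein b : ℂ)
  have hβ : 0 < h.β.re ^ 2 + h.β.im ^ 2 := by
    have := Complex.normSq_pos.2 h.β_ne_zero
    rw [Complex.normSq_apply] at this; nlinarith
  have hd : 0 < (p.re - q.re) ^ 2 + (p.im - q.im) ^ 2 := by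
    have := Complex.normSq_pos.2 (sub_ne_zero.2 hk)
    rw [Complex.normSq_apply] at this; simp at this; nlinarith
  have key : h.β.re * β.im - h.β.im * β.re = 0 := by
    have e1 : h.β.re * (p.re - q.re) + h.β.im * (p.im - q.im) = 0 := by linarith
    have e2 : β.re * (p.re - q.re) + β.im * (p.im - q.im) = 0 := by linarith
    have : (h.β.re * β.im - h.β.im * β.re) * ((p.re - q.re) ^ 2 + (p.im - q.im) ^ 2) = 0 := by
      linear_combination (β.im * (p.re - q.re) - β.re * (p.im - q.im)) * e1 +
        (h.β.im * (p.re - q.re) * (-1) + h.β.re * (p.im - q.im)) * e2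
    exact (mul_eq_zero.1 this).resolve_right hd.ne'
  refine ⟨(h.β.re * β.re + h.β.im * β.im) / (h.β.re ^ 2 + h.β.im ^ 2), fun z => ?_⟩
  set c := (h.β.re * β.re + h.β.im * β.im) / (h.β.re ^ 2 + h.β.im ^ 2) with hc
  have hc' : c * (h.β.re ^ 2 + h.β.im ^ 2) = h.β.re * β.re + h.β.im * β.im := by
    rw [hc]; field_simp
  have hre : β.re = c * h.β.re := by
    have : (β.re - c * h.β.re) * (h.β.re ^ 2 + h.β.im ^ 2) = 0 := by
      linear_combination (-h.β.im) * key - h.β.re * hc'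
    linarith [(mul_eq_zero.1 this).resolve_right hβ.ne']
  have him : β.im = c * h.β.im := by
    have : (β.im - c * h.β.im) * (h.β.re ^ 2 + h.β.im ^ 2) = 0 := by
      linear_combination (h.β.re) * key - h.β.im * hc'
    linarith [(mul_eq_zero.1 this).resolve_right hβ.ne']
  rw [hre, him] at ha' ⊢
  linear_combination ha' - c * ha

/-- Vanishing at the centre would force `α = 0`; at the Klein point halfway to the circle in the
direction of `β` the functional would then be positive. -/
theorem Geodesic.exists_ev_ne_zero (h : Geodesic) : ∃ z ∈ disc, h.ev z ≠ 0 := by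
  by_contra! hcon
  have e0 : ∃ z : ClosedDisc, (klein z : ℂ) = 0 := exists_of_norm_le (by simp)
  have hβ := norm_pos_iff.2 h.β_ne_zero
  have e1 : ∃ z : ClosedDisc, (klein z : ℂ) = ((1 / (2 * ‖h.β‖) : ℝ) : ℂ) * h.β := by
    apply exists_of_norm_le
    rw [norm_mul, Complex.norm_of_nonneg (by positivity)]
    field_simp; norm_num
  obtain ⟨z, hz⟩ := e0
  obtain ⟨w, hw⟩ := e1
  have hzd := hcon z (mem_disc_iff.2 (by rw [hz]; simp))
  have hwd := hcon w (mem_disc_iff.2 (by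
    rw [hw, norm_mul, Complex.norm_of_nonneg (by positivity)]; field_simp; norm_num))
  simp only [Geodesic.ev, aff, hz, hw] at hzd hwd
  simp only [mul_zero, Complex.zero_re, add_zero] at hzd
  rw [hzd, mul_left_comm, Complex.re_ofReal_mul, ← Complex.normSq_eq_conj_mul_self,
    Complex.ofReal_re, Complex.normSq_eq_norm_sq] at hwd
  have : 0 < 1 / (2 * ‖h.β‖) * ‖h.β‖ ^ 2 := by positivity
  linarith

/-- Two geodesics with two common points are proportional. -/
theorem Geodesic.proportional {h u : Geodesic} {a b : ClosedDisc} (hab : a ≠ b) (ha : h.ev a = 0)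
    (hb : h.ev b = 0) (ha' : u.ev a = 0) (hb' : u.ev b = 0) :
    ∃ c : ℝ, c ≠ 0 ∧ ∀ z, u.ev z = c * h.ev z := by
  obtain ⟨c, hc⟩ := h.exists_smul hab ha hb ha' hb'
  refine ⟨c, ?_, hc⟩
  rintro rfl
  obtain ⟨z, -, hz⟩ := u.exists_ev_ne_zero
  exact hz (by rw [Geodesic.ev, hc]; simp)

/-- The pencil of geodesics through a point. -/
theorem Geodesic.pencil {h k u : Geodesic} {v y : ClosedDisc} (hv : h.ev v = 0) (kv : k.ev v = 0)
    (uv : u.ev v = 0) (hy : h.ev y = 0) (ky : k.ev y ≠ 0) :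
    ∃ a b : ℝ, ∀ z, u.ev z = a * h.ev z + b * k.ev z := by
  have hvy : v ≠ y := by rintro rfl; exact ky kv
  set b := u.ev y / k.ev y with hb
  have e (z) : aff (u.α + (-b) * k.α) (u.β + ((-b : ℝ) : ℂ) * k.β) z = u.ev z - b * k.ev z := by
    rw [aff_add, aff_smul]; simp only [Geodesic.ev]; ring
  obtain ⟨a, ha⟩ := h.exists_smul hvy hv hy (α := u.α + (-b) * k.α)
    (β := u.β + ((-b : ℝ) : ℂ) * k.β) (by rw [e, uv, kv]; ring) (by rw [e, hb]; field_simp; ring)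
  exact ⟨a, b, fun z => by linarith [e z, ha z]⟩

/-- A geodesic segment which changes sides of a geodesic crosses it. -/
theorem Geodesic.exists_cross (t : Geodesic) {a b : ClosedDisc} (hta : t.ev a < 0)
    (htb : 0 ≤ t.ev b) :
    ∃ y, (b ∈ disc → y ∈ disc) ∧ t.ev y = 0 ∧ ∃ s : ℝ, 0 < s ∧ s ≤ 1 ∧
      ∀ α β, aff α β y = (1 - s) * aff α β a + s * aff α β b := by
  set s := -t.ev a / (t.ev b - t.ev a) with hs
  have hden : 0 < t.ev b - t.ev a := by linarith
  have hs0 : 0 < s := div_pos (by linarith) hden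
  have hs1 : s ≤ 1 := by rw [hs, div_le_one hden]; linarith
  obtain ⟨z, hz, -, hz'⟩ := exists_mix a b hs0.le hs1
  refine ⟨z, hz' hs0, ?_, s, hs0, hs1, hz⟩
  have h := hz t.α t.β
  change t.ev z = (1 - s) * t.ev a + s * t.ev b at h
  have hh : s * (t.ev b - t.ev a) = -t.ev a := by rw [hs]; field_simp
  rw [h]; linarith

/-! ### Arcs of the circle at infinity -/

/-- The point of the circle at infinity with a given argument. -/
noncomputable def circlePt (θ : ℝ) : ClosedDisc :=
  ⟨Complex.exp (θ * Complex.I), by rw [mem_closedBall_zero_iff, Complex.norm_exp_ofReal_mul_I]⟩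

theorem circlePt_mem (θ : ℝ) : circlePt θ ∈ circleAtInfinity := Complex.norm_exp_ofReal_mul_I θ

theorem continuous_circlePt : Continuous circlePt := by
  unfold circlePt; fun_prop

theorem circlePt_arg {ξ : ClosedDisc} (hξ : ξ ∈ circleAtInfinity) :
    circlePt (Complex.arg ξ) = ξ := by
  apply Subtype.ext
  have := Complex.norm_mul_exp_arg_mul_I (ξ : ℂ)
  rwa [show ‖(ξ : ℂ)‖ = 1 from hξ, Complex.ofReal_one, one_mul] at this

theorem arg_circlePt {θ : ℝ} (hθ : θ ∈ Ioc (-Real.pi) Real.pi) :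
    Complex.arg (circlePt θ) = θ := by
  have := Complex.arg_cos_add_sin_mul_I hθ
  rwa [← Complex.exp_mul_I] at this

theorem ev_circlePt (h : Geodesic) (θ : ℝ) :
    h.ev (circlePt θ) = h.α + ‖h.β‖ * Real.cos (θ - Complex.arg h.β) := by
  rw [Geodesic.ev, aff, klein_of_mem_circle (circlePt_mem θ)]
  have e : (starRingEnd ℂ) h.β * (circlePt θ : ℂ) =
      ((‖h.β‖ : ℝ) : ℂ) * Complex.exp (((θ - Complex.arg h.β : ℝ) : ℂ) * Complex.I) := by
    conv_lhs => rw [← Complex.norm_mul_exp_arg_mul_I h.β]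
    rw [map_mul, Complex.conj_ofReal, ← Complex.exp_conj, map_mul, Complex.conj_ofReal,
      Complex.conj_I, mul_assoc]
    simp only [circlePt]
    rw [← Complex.exp_add]
    congr 2; push_cast; ring
  rw [e, Complex.re_ofReal_mul, Complex.exp_ofReal_mul_I_re]

/-- The closed arc cut off by a geodesic is connected. -/
theorem Geodesic.isPreconnected_arc (h : Geodesic) :
    IsPreconnected {η | η ∈ circleAtInfinity ∧ h.ev η ≤ 0} := by
  -- Measured from the direction of `β`, the functional is `α + ‖β‖ cos τ`, and cosine decreases on
  -- `[0, π]`. So the arc is the union of two mirror images of one interval of angles ending at `π`,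
  -- and they share the point opposite to `β`.
  set φ := Complex.arg h.β
  set A : Set ℝ := {τ | τ ∈ Icc 0 Real.pi ∧ h.α + ‖h.β‖ * Real.cos τ ≤ 0}
  have hA : IsPreconnected A := by
    refine OrdConnected.isPreconnected ⟨fun x hx y hy z hz => ⟨⟨hx.1.1.trans hz.1, hz.2.trans hy.1.2⟩, ?_⟩⟩
    have := Real.cos_le_cos_of_nonneg_of_le_pi hx.1.1 (hz.2.trans hy.1.2) hz.1
    have h2 := hx.2
    nlinarith [norm_nonneg h.β]
  have hπ : Real.pi ∈ A := ⟨⟨Real.pi_pos.le, le_rfl⟩, by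
    rw [Real.cos_pi]; linarith [h.abs_lt, le_abs_self h.α]⟩
  have e : {η | η ∈ circleAtInfinity ∧ h.ev η ≤ 0} =
      (fun τ => circlePt (φ + τ)) '' A ∪ (fun τ => circlePt (φ - τ)) '' A := by
    ext η
    constructor
    · rintro ⟨hη, hle⟩
      set ζ : ClosedDisc := ⟨(η : ℂ) * Complex.exp ((-φ : ℝ) * Complex.I), by
        rw [mem_closedBall_zero_iff, norm_mul, Complex.norm_exp_ofReal_mul_I, mul_one]
        exact norm_le_one η⟩ with hζ
      have hζc : ζ ∈ circleAtInfinity := by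
        show ‖(η : ℂ) * Complex.exp ((-φ : ℝ) * Complex.I)‖ = 1
        rw [norm_mul, Complex.norm_exp_ofReal_mul_I, mul_one]; exact hη
      set τ := Complex.arg ζ
      have hητ : circlePt (φ + τ) = η := by
        apply Subtype.ext
        have h1 : Complex.exp (τ * Complex.I) = (η : ℂ) * Complex.exp ((-φ : ℝ) * Complex.I) :=
          congrArg Subtype.val (circlePt_arg hζc)
        show Complex.exp ((φ + τ : ℝ) * Complex.I) = η
        rw [Complex.ofReal_add, add_mul, Complex.exp_add, h1, mul_left_comm, ← Complex.exp_add]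
        push_cast; simp
      have hcos : h.α + ‖h.β‖ * Real.cos τ ≤ 0 := by
        rw [← hητ, ev_circlePt] at hle
        rwa [add_sub_cancel_left] at hle
      rcases le_total 0 τ with h0 | h0
      · exact Or.inl ⟨τ, ⟨⟨h0, Complex.arg_le_pi _⟩, hcos⟩, hητ⟩
      · refine Or.inr ⟨-τ, ⟨⟨by linarith, by linarith [Complex.neg_pi_lt_arg (ζ : ℂ)]⟩, ?_⟩, ?_⟩
        · rwa [Real.cos_neg]
        · simpa using hητ
    · rintro (⟨τ, hτ, rfl⟩ | ⟨τ, hτ, rfl⟩)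
      · refine ⟨circlePt_mem _, ?_⟩
        rw [ev_circlePt, add_sub_cancel_left]; exact hτ.2
      · refine ⟨circlePt_mem _, ?_⟩
        rw [ev_circlePt, sub_sub_cancel_left, Real.cos_neg]; exact hτ.2
  rw [e]
  refine IsPreconnected.union (circlePt (φ + Real.pi)) ⟨_, hπ, rfl⟩ ⟨_, hπ, ?_⟩
    (hA.image _ (by have := continuous_circlePt; fun_prop))
    (hA.image _ (by have := continuous_circlePt; fun_prop))
  apply Subtype.ext
  show Complex.exp ((φ - Real.pi : ℝ) * Complex.I) = Complex.exp ((φ + Real.pi : ℝ) * Complex.I)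
  rw [Complex.exp_eq_exp_iff_exists_int]
  exact ⟨-1, by push_cast; ring⟩

/-- Two points of the circle at infinity are the endpoints of a geodesic. -/
theorem exists_chord {ξ η : ClosedDisc} (hξ : ξ ∈ circleAtInfinity) (hη : η ∈ circleAtInfinity)
    (hne : ξ ≠ η) :
    ∃ l : Geodesic, l.ev ξ = 0 ∧ l.ev η = 0 ∧ ∀ z, l.ev z = 0 →
      (z ∈ circleAtInfinity → z = ξ ∨ z = η) ∧ ∃ t : ℝ, 0 ≤ t ∧ t ≤ 1 ∧
      ∀ α β, aff α β z = (1 - t) * aff α β ξ + t * aff α β η := by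
  have hk := klein_ne hne
  have h1 := mem_circle_iff.1 hξ
  have h2 := mem_circle_iff.1 hη
  rw [← sq_eq_sq₀ (norm_nonneg _) zero_le_one, Complex.sq_norm, Complex.normSq_apply] at h1 h2
  set p := (klein ξ : ℂ)
  set q := (klein η : ℂ)
  have hd : 0 < (p.re - q.re) ^ 2 + (p.im - q.im) ^ 2 := by
    have := Complex.normSq_pos.2 (sub_ne_zero.2 hk)
    rw [Complex.normSq_apply] at this; simp at this; nlinarith
  set D := (p.re - q.re) ^ 2 + (p.im - q.im) ^ 2 with hD
  -- The normal vector `β` is `p - q` turned by a quarter turn, and `α` makes the functional vanish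
  -- at `p`.
  refine ⟨⟨-(-(p.im - q.im) * p.re + (p.re - q.re) * p.im), ⟨-(p.im - q.im), p.re - q.re⟩, ?_⟩,
    ?_, ?_, ?_⟩
  · apply abs_lt_of_sq_lt_sq _ (norm_nonneg _)
    rw [Complex.sq_norm, Complex.normSq_apply]
    nlinarith [mul_pos hd hd]
  · simp [Geodesic.ev, aff]; ring
  · simp [Geodesic.ev, aff]; ring
  · intro z hz
    simp only [Geodesic.ev, aff, Complex.mul_re, Complex.conj_re, Complex.conj_im] at hz
    have h3 := norm_le_one (klein z)
    rw [← sq_le_one_iff₀ (norm_nonneg _), Complex.sq_norm, Complex.normSq_apply] at h3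
    set w := (klein z : ℂ)
    set t := ((w.re - p.re) * (q.re - p.re) + (w.im - p.im) * (q.im - p.im)) / D with ht
    have htD : t * D = (w.re - p.re) * (q.re - p.re) + (w.im - p.im) * (q.im - p.im) := by
      rw [ht]; field_simp
    have ere : w.re = p.re + t * (q.re - p.re) := by
      have : (w.re - p.re - t * (q.re - p.re)) * D = 0 := by
        rw [hD] at htD ⊢
        linear_combination (-(q.re - p.re)) * htD + (q.im - p.im) * hz
      linarith [(mul_eq_zero.1 this).resolve_right hd.ne']
    have eim : w.im = p.im + t * (q.im - p.im) := by
      have : (w.im - p.im - t * (q.im - p.im)) * D = 0 := by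
        rw [hD] at htD ⊢
        linear_combination (-(q.im - p.im)) * htD - (q.re - p.re) * hz
      linarith [(mul_eq_zero.1 this).resolve_right hd.ne']
    -- Since `p` and `q` are unit vectors, `t (1 - t) D` is the amount by which `|w|²` falls short
    -- of 1. Thus the disc forces `0 ≤ t ≤ 1`, and the circle forces `t = 0` or `t = 1`.
    have hw : w.re * w.re + w.im * w.im = 1 - t * (1 - t) * D := by
      rw [ere, eim, hD]
      linear_combination (1 - t) * h1 + t * h2
    have key : 0 ≤ t * (1 - t) * D := by linarith
    have key' : 0 ≤ t * (1 - t) := nonneg_of_mul_nonneg_left key hd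
    refine ⟨fun hzc => ?_, t, by nlinarith, by nlinarith, fun α β => aff_comb ?_ α β⟩
    · have hwc := mem_circle_iff.1 hzc
      rw [← sq_eq_sq₀ (norm_nonneg _) zero_le_one, Complex.sq_norm, Complex.normSq_apply] at hwc
      have h0 : t * (1 - t) * D = 0 := by linarith
      rcases mul_eq_zero.1 ((mul_eq_zero.1 h0).resolve_right hd.ne') with h0 | h0
      · refine Or.inl (klein.injective (Subtype.ext (Complex.ext ?_ ?_)))
        · rw [h0] at ere; simpa using ere
        · rw [h0] at eim; simpa using eim
      · have ht1 : t = 1 := by linarith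
        refine Or.inr (klein.injective (Subtype.ext (Complex.ext ?_ ?_)))
        · rw [ht1] at ere; simpa using ere
        · rw [ht1] at eim; simpa using eim
    apply Complex.ext
    · simpa using ere
    · simpa using eim

theorem comb_pos {a b t : ℝ} (h0 : 0 ≤ t) (h1 : t ≤ 1) (ha : 0 < a) (hb : 0 < b) :
    0 < (1 - t) * a + t * b := by
  rcases h0.eq_or_lt with rfl | h
  · simpa using ha
  · exact add_pos_of_nonneg_of_pos (mul_nonneg (by linarith) ha.le) (mul_pos h hb)

theorem comb_neg {a b t : ℝ} (h0 : 0 ≤ t) (h1 : t ≤ 1) (ha : a < 0) (hb : b < 0) :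
    (1 - t) * a + t * b < 0 := by
  have := comb_pos h0 h1 (neg_pos.2 ha) (neg_pos.2 hb)
  linarith

/-- The part of an arc at infinity which is cut out by geodesics that cross the geodesic
of the arc is connected. -/
theorem isPreconnected_cell {ι : Type*} (h : Geodesic) (U : ι → Geodesic)
    (hU : ∀ m, ∃ y, h.ev y = 0 ∧ (U m).ev y = 0) :
    IsPreconnected {η | η ∈ circleAtInfinity ∧ h.ev η < 0 ∧ ∀ m, 0 < (U m).ev η} := by
  refine isPreconnected_of_forall_pair fun ξ hξ ξ' hξ' => ?_
  by_cases hne : ξ = ξ'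
  · subst hne
    exact ⟨{ξ}, singleton_subset_iff.2 hξ, rfl, rfl, isPreconnected_singleton⟩
  obtain ⟨l, hl, hl', hseg⟩ := exists_chord hξ.1 hξ'.1 hne
  have hneg (z) (hz : l.ev z = 0) : h.ev z < 0 := by
    obtain ⟨-, t, h0, h1, ht⟩ := hseg z hz
    have := ht h.α h.β
    change h.ev z = (1 - t) * h.ev ξ + t * h.ev ξ' at this
    rw [this]; exact comb_neg h0 h1 hξ.2.1 hξ'.2.1
  have hUpos (m z) (hz : l.ev z = 0) : 0 < (U m).ev z := by
    obtain ⟨-, t, h0, h1, ht⟩ := hseg z hz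
    have := ht (U m).α (U m).β
    change (U m).ev z = (1 - t) * (U m).ev ξ + t * (U m).ev ξ' at this
    rw [this]; exact comb_pos h0 h1 (hξ.2.2 m) (hξ'.2.2 m)
  -- The chord `l` lies where `h` is negative and every `U m` is positive. Oriented so that `h` is
  -- on its positive side, it cuts off an arc that joins the two points within the cell.
  have main : ∀ k : Geodesic, (∀ z, k.ev z = 0 ↔ l.ev z = 0) → (∀ y, h.ev y = 0 → 0 < k.ev y) →
      ∃ t ⊆ {η | η ∈ circleAtInfinity ∧ h.ev η < 0 ∧ ∀ m, 0 < (U m).ev η}, ξ ∈ t ∧ ξ' ∈ t ∧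
        IsPreconnected t := by
    intro k hk hpos
    refine ⟨{η | η ∈ circleAtInfinity ∧ k.ev η ≤ 0}, ?_, ⟨hξ.1, ((hk ξ).2 hl).le⟩,
      ⟨hξ'.1, ((hk ξ').2 hl').le⟩, k.isPreconnected_arc⟩
    rintro η ⟨hη, hkη⟩
    refine ⟨hη, ?_, fun m => ?_⟩
    · by_contra! hcon
      obtain ⟨z, -, hz, s, hs0, hs1, hs⟩ := h.exists_cross hξ.2.1 hcon
      have := hs k.α k.β
      change k.ev z = (1 - s) * k.ev ξ + s * k.ev η at this
      rw [(hk ξ).2 hl] at this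
      nlinarith [hpos z hz]
    · by_contra! hcon
      -- If `η` were not on the positive side of `U m`, neither would be the segment to `η` from the
      -- crossing point of `U m` and `h`; but that segment meets the chord.
      obtain ⟨y, hy, hUy⟩ := hU m
      obtain ⟨z, -, hz, s, hs0, hs1, hs⟩ := k.neg.exists_cross (a := y) (b := η)
        (by simpa using hpos y hy) (by simpa using hkη)
      have := hs (U m).α (U m).β
      change (U m).ev z = (1 - s) * (U m).ev y + s * (U m).ev η at this
      rw [Geodesic.ev_neg, neg_eq_zero] at hz
      nlinarith [hUpos m z ((hk z).1 hz)]
  by_cases hc : ∀ y, h.ev y = 0 → 0 < l.ev y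
  · exact main l (fun _ => Iff.rfl) hc
  · push Not at hc
    obtain ⟨y, hy, hly⟩ := hc
    refine main l.neg (fun z => by simp) fun y' hy' => ?_
    by_contra! hcon
    rw [Geodesic.ev_neg] at hcon
    have hly' : l.ev y < 0 := lt_of_le_of_ne hly fun h0 => (hneg y h0).ne hy
    obtain ⟨z, -, hz, s, hs0, hs1, hs⟩ := l.exists_cross hly' (b := y') (by linarith)
    have := hs h.α h.β
    change h.ev z = (1 - s) * h.ev y + s * h.ev y' at this
    rw [hy, hy'] at this
    have := hneg z hz
    linarith

/-! ### Components of the circle minus a finite set -/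

theorem exists_finite_cover_compl {F : Set ℝ} (hF : F.Finite) :
    ∃ C : Set (Set ℝ), C.Finite ∧ (∀ c ∈ C, c.OrdConnected) ∧ ⋃₀ C = Fᶜ := by
  induction F, hF using Set.Finite.induction_on with
  | empty => exact ⟨{univ}, finite_singleton _, by simp [ordConnected_univ], by simp⟩
  | @insert x F _ _ ih =>
    obtain ⟨C, hC, hord, hcov⟩ := ih
    refine ⟨(fun c => c ∩ Iio x) '' C ∪ (fun c => c ∩ Ioi x) '' C,
      (hC.image _).union (hC.image _), ?_, ?_⟩
    · rintro _ (⟨c, hc, rfl⟩ | ⟨c, hc, rfl⟩)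
      · exact (hord c hc).inter ordConnected_Iio
      · exact (hord c hc).inter ordConnected_Ioi
    · ext y
      have : y ∈ ⋃₀ C ↔ y ∉ F := by rw [hcov]; rfl
      simp only [mem_sUnion, mem_union, mem_image, mem_compl_iff, mem_insert_iff] at this ⊢
      rw [not_or, ← this]
      constructor
      · rintro ⟨_, ⟨c, hc, rfl⟩ | ⟨c, hc, rfl⟩, hy⟩
        · exact ⟨ne_of_lt hy.2, c, hc, hy.1⟩
        · exact ⟨ne_of_gt hy.2, c, hc, hy.1⟩
      · rintro ⟨hne, c, hc, hy⟩
        rcases lt_or_gt_of_ne hne with h | h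
        · exact ⟨_, Or.inl ⟨c, hc, rfl⟩, hy, h⟩
        · exact ⟨_, Or.inr ⟨c, hc, rfl⟩, hy, h⟩

/-- Two distinct endpoints determine the geodesic as their chord, and a chord meets the circle
nowhere else. -/
theorem Geodesic.finite_endpoints (u : Geodesic) : u.endpoints.Finite := by
  by_cases hs : u.endpoints.Subsingleton
  · exact hs.finite
  · rw [Set.not_subsingleton_iff] at hs
    obtain ⟨ξ, hξ, η, hη, hne⟩ := hs
    rw [Geodesic.mem_endpoints] at hξ hη
    obtain ⟨l, hl, hl', H⟩ := exists_chord hξ.1 hη.1 hne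
    obtain ⟨c, -, e⟩ := Geodesic.proportional hne hξ.2 hη.2 hl hl'
    refine (Set.toFinite {ξ, η}).subset fun z hz => ?_
    rw [Geodesic.mem_endpoints] at hz
    exact (H z (by rw [e, hz.2, mul_zero])).1 hz.1

/-- Finitely many points cut the circle at infinity into finitely many arcs. -/
theorem finite_components {P : Set ClosedDisc} (hP : P.Finite) (hPc : P ⊆ circleAtInfinity) :
    {I | ∃ ξ ∈ circleAtInfinity \ P, I = connectedComponentIn (circleAtInfinity \ P) ξ}.Finite := by
  obtain ⟨C, hC, hord, hcov⟩ := exists_finite_cover_compl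
    (hP.image fun z : ClosedDisc => Complex.arg z)
  classical
  -- A component is determined by any piece `c` containing the argument of one of its points,
  -- because the image of a piece in the circle is connected and avoids `P`. Hence there are at most
  -- as many components as pieces.
  refine (hC.image fun c => if hc : ∃ ξ ∈ circleAtInfinity \ P, Complex.arg (ξ : ClosedDisc) ∈ c then
    connectedComponentIn (circleAtInfinity \ P) hc.choose else ∅).subset ?_
  rintro I ⟨ξ, hξ, rfl⟩
  have hξF : Complex.arg ξ ∈ ⋃₀ C := by
    rw [hcov]
    rintro ⟨p, hp, hpξ⟩
    apply hξ.2
    rw [← circlePt_arg hξ.1, ← hpξ, circlePt_arg (hPc hp)]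
    exact hp
  obtain ⟨c, hcC, hξc⟩ := hξF
  refine ⟨c, hcC, ?_⟩
  have hc : ∃ ξ ∈ circleAtInfinity \ P, Complex.arg (ξ : ClosedDisc) ∈ c := ⟨ξ, hξ, hξc⟩
  simp only [dif_pos hc]
  obtain ⟨h1, h2⟩ := hc.choose_spec
  set ζ := hc.choose
  apply connectedComponentIn_eq
  have hpre : IsPreconnected (circlePt '' (c ∩ Ioc (-Real.pi) Real.pi)) :=
    ((hord c hcC).inter ordConnected_Ioc).isPreconnected.image _ continuous_circlePt.continuousOn
  refine hpre.subset_connectedComponentIn ⟨_, ⟨h2, Complex.arg_mem_Ioc _⟩, circlePt_arg h1.1⟩ ?_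
    ⟨_, ⟨hξc, Complex.arg_mem_Ioc _⟩, circlePt_arg hξ.1⟩
  rintro _ ⟨θ, ⟨hθ, hθ'⟩, rfl⟩
  refine ⟨circlePt_mem _, fun hp => ?_⟩
  have : θ ∈ ⋃₀ C := ⟨c, hcC, hθ⟩
  rw [hcov] at this
  exact this ⟨_, hp, arg_circlePt hθ'⟩

/-- The arcs into which finitely many points cut the circle at infinity are infinite. -/
theorem infinite_component {P : Set ClosedDisc} (hP : P.Finite) {ξ : ClosedDisc}
    (hξ : ξ ∈ circleAtInfinity \ P) :
    (connectedComponentIn (circleAtInfinity \ P) ξ).Infinite := by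
  set θ := Complex.arg ξ
  have hopen : IsOpen (circlePt ⁻¹' Pᶜ) := hP.isClosed.isOpen_compl.preimage continuous_circlePt
  have hmem : θ ∈ circlePt ⁻¹' Pᶜ := by
    rw [mem_preimage, circlePt_arg hξ.1]; exact hξ.2
  -- The radius is capped at 1, which is less than `π`, so that `circlePt` is injective on the arc
  -- around `θ`.
  obtain ⟨ε, hε, hball⟩ := Metric.isOpen_iff.1 hopen θ hmem
  set δ := min ε 1
  have hδ : 0 < δ := lt_min hε one_pos
  have hsub : circlePt '' (Ioo (θ - δ) (θ + δ)) ⊆ connectedComponentIn (circleAtInfinity \ P) ξ := by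
    refine (isPreconnected_Ioo.image _ continuous_circlePt.continuousOn).subset_connectedComponentIn
      ⟨θ, ⟨by linarith, by linarith⟩, circlePt_arg hξ.1⟩ ?_
    rintro _ ⟨τ, hτ, rfl⟩
    refine ⟨circlePt_mem _, hball ?_⟩
    rw [Real.ball_eq_Ioo]
    exact ⟨by linarith [hτ.1, min_le_left ε 1], by linarith [hτ.2, min_le_left ε 1]⟩
  refine Infinite.mono hsub (Infinite.image ?_ (Ioo_infinite (by linarith)))
  intro x hx y hy hxy
  have hxy' := congrArg Subtype.val hxy
  simp only [circlePt] at hxy'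
  have h1 := min_le_right ε 1
  have h3 := Real.pi_gt_three
  have e : Complex.exp (((x - θ : ℝ) : ℂ) * Complex.I) = Complex.exp (((y - θ : ℝ) : ℂ) * Complex.I) := by
    push_cast
    rw [sub_mul, sub_mul, Complex.exp_sub, Complex.exp_sub, hxy']
  have := Complex.exp_inj_of_neg_pi_lt_of_le_pi (by simp; linarith [hx.1]) (by simp; linarith [hx.2])
    (by simp; linarith [hy.1]) (by simp; linarith [hy.2]) e
  have := congrArg Complex.im this
  simpa using this

/-! ### Isometries -/

namespace IsDiscMobius

variable {g : Equiv.Perm ClosedDisc}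

theorem den_ne_zero {a b : ℂ} (hab : ‖a‖ ^ 2 - ‖b‖ ^ 2 = 1) (z : ClosedDisc) :
    (starRingEnd ℂ) b * (z : ℂ) + (starRingEnd ℂ) a ≠ 0 := by
  intro h
  have h1 : ‖(starRingEnd ℂ) a‖ = ‖(starRingEnd ℂ) b * (z : ℂ)‖ := by
    rw [eq_neg_of_add_eq_zero_right h, norm_neg]
  rw [norm_mul, Complex.norm_conj, Complex.norm_conj] at h1
  have h2 : ‖b‖ * ‖(z : ℂ)‖ ≤ ‖b‖ := mul_le_of_le_one_right (norm_nonneg _) (norm_le_one z)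
  nlinarith [norm_nonneg a, norm_nonneg b]

theorem continuous (hg : IsDiscMobius g) : Continuous g := by
  obtain ⟨a, b, hab, h⟩ := hg
  have h' : Continuous fun z : ClosedDisc => (a * (z : ℂ) + b) /
      ((starRingEnd ℂ) b * (z : ℂ) + (starRingEnd ℂ) a) :=
    Continuous.div (by fun_prop) (by fun_prop) (den_ne_zero hab)
  exact continuous_induced_rng.2 (h'.congr fun z => (h z).symm)

/-- The factor is the squared modulus of the denominator. Its positivity shows that an isometry
preserves both the open disc and the circle. -/
theorem exists_one_sub_normSq (hg : IsDiscMobius g) (z : ClosedDisc) :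
    ∃ c : ℝ, 0 < c ∧ c * (1 - ‖((g z : ClosedDisc) : ℂ)‖ ^ 2) = 1 - ‖(z : ℂ)‖ ^ 2 := by
  obtain ⟨a, b, hab, h⟩ := hg
  have hd := den_ne_zero hab z
  refine ⟨Complex.normSq ((starRingEnd ℂ) b * (z : ℂ) + (starRingEnd ℂ) a),
    Complex.normSq_pos.2 hd, ?_⟩
  have hd' := (Complex.normSq_pos.2 hd).ne'
  rw [h z, Complex.sq_norm, Complex.normSq_div, mul_sub, mul_div_cancel₀ _ hd']
  rw [Complex.sq_norm, Complex.sq_norm, Complex.normSq_apply, Complex.normSq_apply] at hab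
  rw [Complex.sq_norm]
  simp only [Complex.normSq_apply, Complex.add_re, Complex.add_im, Complex.mul_re, Complex.mul_im,
    Complex.conj_re, Complex.conj_im]
  linear_combination (1 - ((z : ℂ).re * (z : ℂ).re + (z : ℂ).im * (z : ℂ).im)) * hab

theorem mem_disc_iff (hg : IsDiscMobius g) {z : ClosedDisc} : g z ∈ disc ↔ z ∈ disc := by
  obtain ⟨c, hc, h⟩ := hg.exists_one_sub_normSq z
  have e (w : ClosedDisc) : w ∈ disc ↔ 0 < 1 - ‖(w : ℂ)‖ ^ 2 := by
    rw [sub_pos, sq_lt_one_iff₀ (norm_nonneg _)]; rfl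
  rw [e, e, ← h, mul_pos_iff_of_pos_left hc]

theorem mem_circle_iff_not_mem_disc {z : ClosedDisc} : z ∈ circleAtInfinity ↔ z ∉ disc := by
  constructor
  · exact not_mem_disc_of_mem_circle
  · intro h
    exact le_antisymm (norm_le_one z) (not_lt.1 h)

theorem mem_circle_iff (hg : IsDiscMobius g) {z : ClosedDisc} :
    g z ∈ circleAtInfinity ↔ z ∈ circleAtInfinity := by
  rw [mem_circle_iff_not_mem_disc, mem_circle_iff_not_mem_disc, hg.mem_disc_iff]

/-- Isometries act on geodesics. -/
theorem exists_pullback (hg : IsDiscMobius g) (h : Geodesic) :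
    ∃ k : Geodesic, ∀ z, ∃ c : ℝ, 0 < c ∧ k.ev z = c * h.ev (g z) := by
  obtain ⟨a, b, hab, hgz⟩ := hg
  set A : ℝ := ‖a‖ ^ 2 + ‖b‖ ^ 2 with hA
  set α : ℝ := h.α * A + 2 * ((starRingEnd ℂ) h.β * (a * b)).re with hα
  set β : ℂ := 2 * h.α * ((starRingEnd ℂ) a * b) + h.β * (starRingEnd ℂ) a ^ 2 +
    (starRingEnd ℂ) h.β * b ^ 2 with hβ
  have hab' := hab
  rw [Complex.sq_norm, Complex.sq_norm, Complex.normSq_apply, Complex.normSq_apply] at hab'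
  have hlt : |α| < ‖β‖ := by
    apply abs_lt_of_sq_lt_sq _ (norm_nonneg _)
    have h1 : h.α ^ 2 < ‖h.β‖ ^ 2 := sq_lt_sq.2 (by rw [abs_norm]; exact h.abs_lt)
    -- The discriminant of the equation is an invariant of the action, so the pulled back equation
    -- is again that of a geodesic.
    have h2 : ‖β‖ ^ 2 - α ^ 2 = (‖a‖ ^ 2 - ‖b‖ ^ 2) ^ 2 * (‖h.β‖ ^ 2 - h.α ^ 2) := by
      rw [hα, hβ, hA]
      simp only [Complex.sq_norm]
      simp only [Complex.normSq_apply, Complex.add_re, Complex.add_im,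
        Complex.mul_re, Complex.mul_im, Complex.conj_re, Complex.conj_im, pow_two,
        Complex.ofReal_re, Complex.ofReal_im, Complex.re_ofNat, Complex.im_ofNat]
      ring
    rw [hab] at h2
    linarith
  refine ⟨⟨α, β, hlt⟩, fun z => ?_⟩
  have hd := den_ne_zero hab z
  have hd' := Complex.normSq_pos.2 hd
  set d := (starRingEnd ℂ) b * (z : ℂ) + (starRingEnd ℂ) a with hdd
  have key : (⟨α, β, hlt⟩ : Geodesic).side z = Complex.normSq d * h.side (g z) := by
    have e : Complex.normSq d * h.side (g z) = h.α * (Complex.normSq d +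
        Complex.normSq (a * (z : ℂ) + b)) +
        2 * ((starRingEnd ℂ) h.β * ((a * (z : ℂ) + b) * (starRingEnd ℂ) d)).re := by
      rw [Geodesic.side, hgz z, Complex.sq_norm, Complex.normSq_div, ← hdd]
      have e2 : (a * (z : ℂ) + b) / d = ((1 / Complex.normSq d : ℝ) : ℂ) *
          ((a * (z : ℂ) + b) * (starRingEnd ℂ) d) := by
        rw [Complex.ofReal_div, Complex.ofReal_one, Complex.normSq_eq_conj_mul_self]
        have : (starRingEnd ℂ) d ≠ 0 := (map_ne_zero _).2 hd
        field_simp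
      rw [e2, mul_left_comm, Complex.re_ofReal_mul]
      field_simp
    rw [e, Geodesic.side, hdd]
    simp only [hα, hβ, hA, Complex.sq_norm]
    simp only [Complex.normSq_apply, Complex.add_re, Complex.add_im,
      Complex.mul_re, Complex.mul_im, Complex.conj_re, Complex.conj_im, pow_two,
      Complex.ofReal_re, Complex.ofReal_im, Complex.re_ofNat, Complex.im_ofNat, map_add, map_mul,
      Complex.conj_conj]
    ring
  have p1 : (0 : ℝ) < 1 + ‖(z : ℂ)‖ ^ 2 := by positivity
  have p2 : (0 : ℝ) < 1 + ‖((g z : ClosedDisc) : ℂ)‖ ^ 2 := by positivity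
  refine ⟨Complex.normSq d * (1 + ‖((g z : ClosedDisc) : ℂ)‖ ^ 2) / (1 + ‖(z : ℂ)‖ ^ 2),
    by positivity, ?_⟩
  rw [Geodesic.side_eq, Geodesic.side_eq] at key
  field_simp
  linarith

end IsDiscMobius

/-! ### Sides of a polygon -/

/-- The geodesics `h i` carry the sides of the polygon `R`. -/
structure SideSystem (R : Set ClosedDisc) {ι : Type} (h : ι → Geodesic) : Prop where
  mem_iff : ∀ z, z ∈ R ↔ z ∈ disc ∧ ∀ i, 0 ≤ (h i).ev z
  exists_interior : ∃ o ∈ disc, ∀ i, 0 < (h i).ev o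
  exists_mid : ∀ i, ∃ y ∈ disc, (h i).ev y = 0 ∧ ∀ j, j ≠ i → 0 < (h j).ev y

theorem isOpen_disc : IsOpen disc :=
  isOpen_lt (continuous_norm.comp continuous_subtype_val) continuous_const

/-- Both sides of a geodesic come close to each of its points. -/
theorem Geodesic.exists_pos_near (u : Geodesic) {a : ClosedDisc} (ha : a ∈ disc) (h0 : u.ev a = 0)
    {V : Set ClosedDisc} (hV : V ∈ 𝓝 a) : ∃ z ∈ V, z ∈ disc ∧ 0 < u.ev z := by
  obtain ⟨w, -, hw⟩ := u.exists_ev_ne_zero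
  have h1 := eventually_extend ha w hV
  have h2 := (continuous_neg (G := ℝ)).tendsto' 0 0 neg_zero |>.eventually h1
  obtain ⟨t, ⟨⟨x, hxV, hx, hx'⟩, y, hyV, hy, hy'⟩, ht⟩ := (((h1.and h2).filter_mono
    (nhdsWithin_le_nhds (s := Ioi 0))).and (self_mem_nhdsWithin (s := Ioi (0 : ℝ)))).exists
  have ht : 0 < t := ht
  have ex : u.ev x = (1 - t) * u.ev a + t * u.ev w := hx' _ _
  have ey : u.ev y = (1 - -t) * u.ev a + -t * u.ev w := hy' _ _
  rw [h0, mul_zero, zero_add] at ex ey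
  rcases lt_or_gt_of_ne hw with hw | hw
  · exact ⟨y, hyV, hy, by rw [ey]; exact mul_pos_of_neg_of_neg (neg_lt_zero.2 ht) hw⟩
  · exact ⟨x, hxV, hx, by rw [ex]; exact mul_pos ht hw⟩

/-- If the functional vanished at an interior point, nearby points of R would lie on its negative
side. -/
theorem ev_pos_of_mem_interior {R : Set ClosedDisc} (hR : R ⊆ disc) {u : Geodesic}
    (hu : ∀ z ∈ R, 0 ≤ u.ev z) {o : ClosedDisc} (ho : o ∈ interior R) : 0 < u.ev o := by
  refine lt_of_le_of_ne (hu o (interior_subset ho)) fun h0 => ?_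
  obtain ⟨z, hz, -, hz0⟩ := u.neg.exists_pos_near (hR (interior_subset ho)) (by simp [← h0])
    (mem_interior_iff_mem_nhds.1 ho)
  rw [Geodesic.ev_neg] at hz0
  linarith [hu z hz]

/-- A family of half planes of least cardinality cutting out R is irredundant: for each of its
members some point of the disc violates that member alone. The segment from such a point to an
interior point of R crosses the geodesic strictly inside all the other half planes. -/
theorem exists_sideSystem {R : Set ClosedDisc} (hR : IsPolygon R) :
    ∃ F : Finset Geodesic, SideSystem R (fun i : F => i.1) := by
  classical
  obtain ⟨⟨F₀, hF₀, hRF⟩, o, ho⟩ := hR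
  have hRd : R ⊆ disc := by rw [hRF]; exact fun z hz => hz.1
  set S : Set (Finset Geodesic) := {F | ∀ z, z ∈ R ↔ z ∈ disc ∧ ∀ i ∈ F, 0 ≤ i.ev z}
  have hS : S.Nonempty := ⟨hF₀.toFinset, fun z => by
    rw [hRF]
    simp only [mem_ofPred_eq, Finite.mem_toFinset, Geodesic.side_nonneg_iff]⟩
  obtain ⟨F, hF, hmin⟩ := (measure Finset.card).wf.has_min S hS
  have hpos : ∀ i ∈ F, 0 < i.ev o := fun i hi =>
    ev_pos_of_mem_interior hRd (fun z hz => ((hF z).1 hz).2 i hi) ho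
  have hod := hRd (interior_subset ho)
  refine ⟨F, fun z => by rw [hF z]; simp, ⟨o, hod, fun i => hpos i i.2⟩, ?_⟩
  rintro ⟨i, hi⟩
  have hi' : F.erase i ∉ S := fun h => hmin _ h (Finset.card_erase_lt_of_mem hi)
  have : ∃ x ∈ disc, i.ev x < 0 ∧ ∀ j ∈ F, j ≠ i → 0 ≤ j.ev x := by
    by_contra! hcon
    refine hi' fun z => ⟨fun hz => ?_, fun ⟨hz, hz'⟩ => ?_⟩
    · exact ⟨hRd hz, fun j hj => ((hF z).1 hz).2 j (Finset.mem_of_mem_erase hj)⟩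
    · rw [hF z]
      by_contra hc
      have hiz : i.ev z < 0 := by
        by_contra! h0
        refine hc ⟨hz, fun j hj => ?_⟩
        by_cases hji : j = i
        · rw [hji]; exact h0
        · exact hz' j (Finset.mem_erase.2 ⟨hji, hj⟩)
      obtain ⟨j, hj, hji, hj'⟩ := hcon z hz hiz
      exact absurd (hz' j (Finset.mem_erase.2 ⟨hji, hj⟩)) (not_le.2 hj')
  obtain ⟨x, hx, hix, hjx⟩ := this
  obtain ⟨y, hyd, hy, s, hs0, hs1, hs⟩ := i.exists_cross hix (hpos i hi).le
  refine ⟨y, hyd hod, hy, ?_⟩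
  rintro ⟨j, hj⟩ hji
  have hji' : j ≠ i := fun h => hji (Subtype.ext h)
  have e : j.ev y = (1 - s) * j.ev x + s * j.ev o := hs _ _
  show 0 < j.ev y
  rw [e]
  exact add_pos_of_nonneg_of_pos (mul_nonneg (by linarith) (hjx j hj hji')) (mul_pos hs0 (hpos j hj))

namespace SideSystem

variable {R : Set ClosedDisc} {ι : Type} {h : ι → Geodesic}

theorem subset_disc (S : SideSystem R h) : R ⊆ disc := fun z hz => ((S.mem_iff z).1 hz).1

theorem ev_nonneg (S : SideSystem R h) {z : ClosedDisc} (hz : z ∈ R) (i : ι) : 0 ≤ (h i).ev z :=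
  ((S.mem_iff z).1 hz).2 i

theorem mem_of_pos (S : SideSystem R h) {z : ClosedDisc} (hz : z ∈ disc)
    (hz' : ∀ i, 0 < (h i).ev z) : z ∈ R := (S.mem_iff z).2 ⟨hz, fun i => (hz' i).le⟩

theorem pos_mem_nhds [Finite ι] {z : ClosedDisc} (hz : z ∈ disc) {p : ι → Prop}
    (hz' : ∀ i, p i → 0 < (h i).ev z) :
    {w | w ∈ disc ∧ ∀ i, p i → 0 < (h i).ev w} ∈ 𝓝 z := by
  refine inter_mem (isOpen_disc.mem_nhds hz) ?_
  have : ∀ᶠ w in 𝓝 z, ∀ i, p i → 0 < (h i).ev w := by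
    rw [eventually_all]
    intro i
    by_cases hp : p i
    · filter_upwards [continuousAt_const.eventually_lt (h i).continuous_ev.continuousAt (hz' i hp)]
        with w hw _ using hw
    · filter_upwards with w hw using absurd hw hp
  exact this

theorem mem_interior [Finite ι] (S : SideSystem R h) {z : ClosedDisc} (hz : z ∈ disc)
    (hz' : ∀ i, 0 < (h i).ev z) : z ∈ interior R := by
  rw [mem_interior_iff_mem_nhds]
  filter_upwards [pos_mem_nhds (h := h) (p := fun _ => True) hz fun i _ => hz' i] with w hw
  exact S.mem_of_pos hw.1 fun i => hw.2 i trivial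

theorem mem_interior_iff [Finite ι] (S : SideSystem R h) {z : ClosedDisc} :
    z ∈ interior R ↔ z ∈ disc ∧ ∀ i, 0 < (h i).ev z :=
  ⟨fun hz => ⟨S.subset_disc (interior_subset hz), fun i =>
    ev_pos_of_mem_interior S.subset_disc (fun _ hw => S.ev_nonneg hw i) hz⟩,
    fun hz => S.mem_interior hz.1 hz.2⟩

/-- A point in the middle of a side is the midpoint of a segment of the side. -/
theorem exists_segment [Finite ι] (S : SideSystem R h) {i : ι} {y : ClosedDisc} (hy : y ∈ disc)
    (h0 : (h i).ev y = 0) (hj : ∀ j, j ≠ i → 0 < (h j).ev y) :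
    ∃ b ∈ R, ∃ b' ∈ R, b ≠ y ∧ (h i).ev b = 0 ∧ (h i).ev b' = 0 ∧
      ∀ α β, aff α β b + aff α β b' = 2 * aff α β y := by
  obtain ⟨b, hbV, b', hbV', -, -, hne, hb, hb', e⟩ := (h i).exists_near hy h0
    (pos_mem_nhds (h := h) (p := fun j => j ≠ i) hy hj)
  have key (z : ClosedDisc) (hz : (h i).ev z = 0)
      (hzV : z ∈ {w | w ∈ disc ∧ ∀ j, j ≠ i → 0 < (h j).ev w}) : z ∈ R := by
    refine (S.mem_iff z).2 ⟨hzV.1, fun j => ?_⟩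
    by_cases hji : j = i
    · rw [hji, hz]
    · exact (hzV.2 j hji).le
  exact ⟨b, key b hb hbV, b', key b' hb' hbV', hne, hb, hb', e⟩

/-- The side of `R` with index `i`. -/
theorem mem_of_mid (S : SideSystem R h) {i : ι} {y : ClosedDisc} (hy : y ∈ disc)
    (h0 : (h i).ev y = 0) (hj : ∀ j, j ≠ i → 0 < (h j).ev y) : y ∈ R := by
  refine (S.mem_iff y).2 ⟨hy, fun j => ?_⟩
  by_cases hji : j = i
  · rw [hji, h0]
  · exact (hj j hji).le

theorem isSide [Finite ι] (S : SideSystem R h) (i : ι) : IsSide R (R ∩ (h i).line) := by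
  obtain ⟨y, hy, h0, hj⟩ := S.exists_mid i
  obtain ⟨b, hb, b', -, hne, hb0, -⟩ := S.exists_segment hy h0 hj
  have hyR := S.mem_of_mid hy h0 hj
  exact ⟨h i, fun z hz => Geodesic.side_nonneg_iff.2 (S.ev_nonneg hz i), rfl,
    b, ⟨hb, Geodesic.mem_line.2 ⟨S.subset_disc hb, hb0⟩⟩, y,
    ⟨hyR, Geodesic.mem_line.2 ⟨hy, h0⟩⟩, hne⟩

/-- A supporting geodesic which touches `R` in two points carries a side. -/
theorem exists_proportional [Finite ι] (S : SideSystem R h) {u : Geodesic} (hu : ∀ z ∈ R, 0 ≤ u.ev z)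
    {x x' : ClosedDisc} (hx : x ∈ R) (hx' : x' ∈ R) (hne : x ≠ x') (h0 : u.ev x = 0)
    (h0' : u.ev x' = 0) : ∃ i, (h i).ev x = 0 ∧ (h i).ev x' = 0 ∧
      ∃ c : ℝ, c ≠ 0 ∧ ∀ z, u.ev z = c * (h i).ev z := by
  obtain ⟨m, hm, hmd, -⟩ := exists_mix x x' (t := 1 / 2) (by norm_num) (by norm_num)
  have hmd := hmd (by norm_num) (S.subset_disc hx)
  have e (k : Geodesic) : k.ev m = (1 - 1 / 2) * k.ev x + 1 / 2 * k.ev x' := hm _ _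
  -- The midpoint lies on `u`, hence not in the interior of R. A side functional that is not
  -- positive there, but nonnegative at both ends, vanishes at both ends.
  have : ∃ i, (h i).ev m ≤ 0 := by
    by_contra! hcon
    have := ev_pos_of_mem_interior S.subset_disc hu (S.mem_interior hmd hcon)
    rw [e, h0, h0'] at this
    norm_num at this
  obtain ⟨i, hi⟩ := this
  have p1 := S.ev_nonneg hx i
  have p2 := S.ev_nonneg hx' i
  rw [e] at hi
  have z1 : (h i).ev x = 0 := by linarith
  have z2 : (h i).ev x' = 0 := by linarith
  exact ⟨i, z1, z2, Geodesic.proportional hne z1 z2 h0 h0'⟩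

theorem isSide_iff [Finite ι] (S : SideSystem R h) {s : Set ClosedDisc} :
    IsSide R s ↔ ∃ i, s = R ∩ (h i).line := by
  constructor
  · rintro ⟨u, hu, rfl, x, hx, x', hx', hne⟩
    obtain ⟨i, -, -, c, hc, e⟩ := S.exists_proportional
      (fun z hz => Geodesic.side_nonneg_iff.1 (hu z hz)) hx.1 hx'.1 hne
      (Geodesic.mem_line.1 hx.2).2 (Geodesic.mem_line.1 hx'.2).2
    refine ⟨i, ?_⟩
    ext z
    simp [Geodesic.mem_line, e, hc]
  · rintro ⟨i, rfl⟩
    exact S.isSide i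

/-- The side `i` has a point at which all the other side functionals are strictly positive. This
serves as the test for equality of indices. -/
theorem eq_of_zero_imp (S : SideSystem R h) {i j : ι}
    (H : ∀ z ∈ disc, (h i).ev z = 0 → (h j).ev z ≤ 0) : i = j := by
  by_contra hne
  obtain ⟨y, hy, h0, hj⟩ := S.exists_mid i
  exact absurd (H y hy h0) (not_le.2 (hj j (Ne.symm hne)))

theorem eq_of_two_points (S : SideSystem R h) {i j : ι} {a b : ClosedDisc} (hab : a ≠ b)
    (h1 : (h i).ev a = 0) (h2 : (h i).ev b = 0) (h3 : (h j).ev a = 0) (h4 : (h j).ev b = 0) :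
    i = j := by
  obtain ⟨c, -, e⟩ := Geodesic.proportional hab h1 h2 h3 h4
  exact S.eq_of_zero_imp fun z _ hz => by rw [e, hz, mul_zero]

theorem ncard_sides [Finite ι] (S : SideSystem R h) : (sides R).ncard = Nat.card ι := by
  have e : sides R = range fun i => R ∩ (h i).line := by
    ext s
    exact S.isSide_iff.trans (exists_congr fun i => eq_comm)
  rw [e, ← Set.image_univ, Set.ncard_image_of_injective, Set.ncard_univ]
  intro i j hij
  obtain ⟨y, hy, h0, hj⟩ := S.exists_mid i
  by_contra hne
  have : y ∈ R ∩ (h j).line := (show R ∩ (h i).line = R ∩ (h j).line from hij) ▸ ⟨S.mem_of_mid hy h0 hj, Geodesic.mem_line.2 ⟨hy, h0⟩⟩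
  exact absurd (Geodesic.mem_line.1 this.2).2 (hj j (Ne.symm hne)).ne'

theorem mem_boundary_iff [Finite ι] (S : SideSystem R h) {z : ClosedDisc} :
    z ∈ boundary R ↔ z ∈ R ∧ ∃ i, (h i).ev z = 0 := by
  constructor
  · rintro ⟨s, hs, hz⟩
    obtain ⟨i, rfl⟩ := S.isSide_iff.1 hs
    exact ⟨hz.1, i, (Geodesic.mem_line.1 hz.2).2⟩
  · rintro ⟨hz, i, hi⟩
    exact ⟨_, S.isSide i, hz, Geodesic.mem_line.2 ⟨S.subset_disc hz, hi⟩⟩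

end SideSystem

/-! ### Even tilings -/

theorem perm_apply_inv {α : Type*} (g : Equiv.Perm α) (z : α) : g (g⁻¹ z) = z :=
  g.apply_symm_apply z

theorem perm_inv_apply {α : Type*} (g : Equiv.Perm α) (z : α) : g⁻¹ (g z) = z :=
  g.symm_apply_apply z

/-- The image of a geodesic under an isometry. -/
def IsImage (g : Equiv.Perm ClosedDisc) (h k : Geodesic) : Prop :=
  ∀ z, ∃ c : ℝ, 0 < c ∧ k.ev (g z) = c * h.ev z

namespace IsImage

variable {g : Equiv.Perm ClosedDisc} {h k : Geodesic}

theorem zero_iff (H : IsImage g h k) {z : ClosedDisc} : k.ev (g z) = 0 ↔ h.ev z = 0 := by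
  obtain ⟨c, hc, e⟩ := H z
  rw [e, mul_eq_zero, or_iff_right hc.ne']

theorem pos_iff (H : IsImage g h k) {z : ClosedDisc} : 0 < k.ev (g z) ↔ 0 < h.ev z := by
  obtain ⟨c, hc, e⟩ := H z
  rw [e, mul_pos_iff_of_pos_left hc]

theorem nonneg_iff (H : IsImage g h k) {z : ClosedDisc} : 0 ≤ k.ev (g z) ↔ 0 ≤ h.ev z := by
  obtain ⟨c, hc, e⟩ := H z
  rw [e, mul_nonneg_iff_of_pos_left hc]

theorem neg_iff (H : IsImage g h k) {z : ClosedDisc} : k.ev (g z) < 0 ↔ h.ev z < 0 := by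
  rw [← not_le, ← not_le, H.nonneg_iff]

theorem symm (H : IsImage g h k) : IsImage g⁻¹ k h := fun z => by
  obtain ⟨c, hc, e⟩ := H (g⁻¹ z)
  refine ⟨c⁻¹, inv_pos.2 hc, ?_⟩
  rw [perm_apply_inv] at e
  rw [e]; field_simp

theorem neg (H : IsImage g h k) : IsImage g h.neg k.neg := fun z => by
  obtain ⟨c, hc, e⟩ := H z
  exact ⟨c, hc, by simp [e]⟩

end IsImage

/-- The tessellation by the images under `Γ` of a polygon `R` with even corners. -/
structure EvenTiling (Γ : Subgroup (Equiv.Perm ClosedDisc)) (R : Set ClosedDisc) {ι : Type}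
    (h : ι → Geodesic) : Prop extends SideSystem R h where
  mobius : ∀ g ∈ Γ, IsDiscMobius g
  covers : ∀ z ∈ disc, ∃ g ∈ Γ, z ∈ g '' R
  disjoint : ∀ g ∈ Γ, g ≠ 1 → Disjoint (g '' interior R) (interior R)
  locallyFinite : ∀ K : Set ClosedDisc, IsCompact K → K ⊆ disc →
    {g : Equiv.Perm ClosedDisc | g ∈ Γ ∧ ((g '' R) ∩ K).Nonempty}.Finite
  paired : ∀ s, IsSide R s → ∃ e, IsInteriorLabel Γ R s e
  side_subset : ∀ i, (h i).line ⊆ tessellation Γ R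

namespace EvenTiling

variable {Γ : Subgroup (Equiv.Perm ClosedDisc)} {R : Set ClosedDisc} {ι : Type} [Finite ι]
  {h : ι → Geodesic}

theorem exists_image (E : EvenTiling Γ R h) {g : Equiv.Perm ClosedDisc} (hg : g ∈ Γ)
    (u : Geodesic) : ∃ k, IsImage g u k := by
  obtain ⟨k, hk⟩ := (E.mobius _ (Γ.inv_mem hg)).exists_pullback u
  refine ⟨k, fun z => ?_⟩
  obtain ⟨c, hc, e⟩ := hk (g z)
  exact ⟨c, hc, by rw [e, perm_inv_apply]⟩

theorem mem_disc_iff (E : EvenTiling Γ R h) {g : Equiv.Perm ClosedDisc} (hg : g ∈ Γ)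
    {z : ClosedDisc} : g z ∈ disc ↔ z ∈ disc := (E.mobius g hg).mem_disc_iff

/-- The complete geodesics in the tessellation. -/
def IsWall (Γ : Subgroup (Equiv.Perm ClosedDisc)) (R : Set ClosedDisc) (u : Geodesic) : Prop :=
  u.line ⊆ tessellation Γ R

theorem isWall_neg {u : Geodesic} (hu : IsWall Γ R u) : IsWall Γ R u.neg := by
  rw [IsWall, Geodesic.line_neg]; exact hu

theorem isWall_image (E : EvenTiling Γ R h) {g : Equiv.Perm ClosedDisc} (hg : g ∈ Γ)
    {u k : Geodesic} (H : IsImage g u k) (hu : IsWall Γ R u) : IsWall Γ R k := by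
  intro z hz
  rw [Geodesic.mem_line, ← perm_apply_inv g z, H.zero_iff, E.mem_disc_iff hg] at hz
  obtain ⟨g', hg', w, hw, e⟩ := hu (Geodesic.mem_line.2 hz)
  exact ⟨g * g', Γ.mul_mem hg hg', w, hw, by rw [Equiv.Perm.mul_apply, e, perm_apply_inv]⟩

theorem eq_one (E : EvenTiling Γ R h) {g : Equiv.Perm ClosedDisc} (hg : g ∈ Γ) {z : ClosedDisc}
    (hz : z ∈ interior R) (hgz : g z ∈ interior R) : g = 1 := by
  by_contra hne
  exact Set.disjoint_left.1 (E.disjoint g hg hne) ⟨z, hz, rfl⟩ hgz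

/-- A point of `R` can be moved a little into the interior of `R`. -/
theorem exists_interior_near (E : EvenTiling Γ R h) {w : ClosedDisc} (hw : w ∈ R)
    {V : Set ClosedDisc} (hV : V ∈ 𝓝 w) : ∃ z ∈ V, z ∈ interior R := by
  obtain ⟨o, ho, hpos⟩ := E.exists_interior
  have h1 := eventually_extend (E.subset_disc hw) o hV
  obtain ⟨t, ⟨⟨z, hzV, hzd, hz⟩, ht1⟩, ht⟩ := (((h1.and (gt_mem_nhds one_pos)).filter_mono
    (nhdsWithin_le_nhds (s := Ioi 0))).and (self_mem_nhdsWithin (s := Ioi (0 : ℝ)))).exists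
  refine ⟨z, hzV, E.mem_interior hzd fun i => ?_⟩
  have e : (h i).ev z = (1 - t) * (h i).ev w + t * (h i).ev o := hz _ _
  rw [e]
  exact add_pos_of_nonneg_of_pos (mul_nonneg (by linarith) (E.ev_nonneg hw i)) (mul_pos ht (hpos i))

/-- Walls do not meet the interior of `R`. -/
theorem wall_ne_zero (E : EvenTiling Γ R h) {u : Geodesic} (hu : IsWall Γ R u) {z : ClosedDisc}
    (hz : z ∈ interior R) : u.ev z ≠ 0 := by
  intro h0
  obtain ⟨g, hg, w, hw, e⟩ := hu (Geodesic.mem_line.2 ⟨E.subset_disc (interior_subset hz), h0⟩)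
  obtain ⟨hwR, i, hi⟩ := E.mem_boundary_iff.1 hw
  -- A boundary point of the tile `g '' R` is a limit of its interior points. Near an interior point
  -- of R these lie in R as well, so `g = 1`, and an interior point of R would lie on a side.
  have hV : g ⁻¹' interior R ∈ 𝓝 w :=
    (isOpen_interior.preimage (E.mobius g hg).continuous).mem_nhds (by rw [mem_preimage, e]; exact hz)
  obtain ⟨x, hxV, hx⟩ := E.exists_interior_near hwR hV
  have := E.eq_one hg hx hxV
  rw [this, Equiv.Perm.one_apply] at e
  rw [e] at hi
  exact absurd hi ((E.mem_interior_iff.1 hz).2 i).ne'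

/-- A wall with points of R strictly on both sides would meet the segment from such a point to a
fixed interior point, and it would do so in the interior of R. -/
theorem wall_sign (E : EvenTiling Γ R h) {u : Geodesic} (hu : IsWall Γ R u) :
    (∀ z ∈ R, 0 ≤ u.ev z) ∨ ∀ z ∈ R, u.ev z ≤ 0 := by
  obtain ⟨o, ho, hpos⟩ := E.exists_interior
  have key : ∀ k : Geodesic, IsWall Γ R k → 0 < k.ev o → ∀ z ∈ R, 0 ≤ k.ev z := by
    intro k hk hko z hz
    by_contra! hcon
    obtain ⟨y, hyd, hy, s, hs0, hs1, hs⟩ := k.exists_cross hcon hko.le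
    refine E.wall_ne_zero hk (E.mem_interior (hyd ho) fun i => ?_) hy
    have e : (h i).ev y = (1 - s) * (h i).ev z + s * (h i).ev o := hs _ _
    rw [e]
    exact add_pos_of_nonneg_of_pos (mul_nonneg (by linarith) (E.ev_nonneg hz i))
      (mul_pos hs0 (hpos i))
  rcases lt_or_gt_of_ne (E.wall_ne_zero hu (E.mem_interior ho hpos)) with h0 | h0
  · right
    intro z hz
    have := key u.neg (isWall_neg hu) (by simpa using h0) z hz
    simpa using this
  · exact Or.inl (key u hu h0)

theorem wall_nonneg (E : EvenTiling Γ R h) {u : Geodesic} (hu : IsWall Γ R u) {y : ClosedDisc}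
    (hy : y ∈ R) (h0 : 0 < u.ev y) {z : ClosedDisc} (hz : z ∈ R) : 0 ≤ u.ev z := by
  rcases E.wall_sign hu with H | H
  · exact H z hz
  · exact absurd (H y hy) (not_le.2 h0)

theorem isWall_side (E : EvenTiling Γ R h) (i : ι) : IsWall Γ R (h i) := E.side_subset i

end EvenTiling

/-- A fundamental polygon with even corners gives an even tiling. -/
theorem exists_evenTiling {Γ : Subgroup (Equiv.Perm ClosedDisc)} {R : Set ClosedDisc}
    (hΓ : IsFuchsian Γ) (hR : IsFundamentalPolygon Γ R) (heven : HasEvenCorners Γ R) :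
    ∃ F : Finset Geodesic, EvenTiling Γ R (fun i : F => i.1) := by
  obtain ⟨F, hF⟩ := exists_sideSystem hR.polygon
  exact ⟨F, hF, hΓ.mobius, hR.covers, hR.disjoint, hR.locallyFinite, hR.paired, fun i =>
    heven _ (hF.isSide i) i.1 inter_subset_right⟩

/-! ### Triangles of walls -/

/-- Three geodesics which form a triangle, oriented towards its interior. -/
structure IsTriangle (u v w : Geodesic) (p q r : ClosedDisc) : Prop where
  up : 0 < u.ev p
  vp : v.ev p = 0
  wp : w.ev p = 0
  uq : u.ev q = 0
  vq : 0 < v.ev q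
  wq : w.ev q = 0
  ur : u.ev r = 0
  vr : v.ev r = 0
  wr : 0 < w.ev r

namespace IsTriangle

variable {u v w : Geodesic} {p q r : ClosedDisc}

theorem rotate (T : IsTriangle u v w p q r) : IsTriangle v w u q r p :=
  ⟨T.vq, T.wq, T.uq, T.vr, T.wr, T.ur, T.vp, T.wp, T.up⟩

/-- Barycentric coordinates. -/
theorem bary (T : IsTriangle u v w p q r) (z : ClosedDisc) (α : ℝ) (β : ℂ) :
    aff α β z = u.ev z / u.ev p * aff α β p + v.ev z / v.ev q * aff α β q +
      w.ev z / w.ev r * aff α β r := by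
  have hqr : q ≠ r := by rintro rfl; exact T.vq.ne' T.vr
  have e1 := T.up.ne'
  have e2 := T.vq.ne'
  have e3 := T.wr.ne'
  set A := aff α β p / u.ev p with hA
  set B := aff α β q / v.ev q with hB
  set C := aff α β r / w.ev r with hC
  -- Subtracting this combination makes the functional vanish at `q` and `r`, so that it is a
  -- multiple of `u`; it also vanishes at `p`, so the multiple is zero.
  have e (x) : aff (α + -A * u.α + -B * v.α + -C * w.α) (β + ((-A : ℝ) : ℂ) * u.β +
      ((-B : ℝ) : ℂ) * v.β + ((-C : ℝ) : ℂ) * w.β) x =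
      aff α β x - A * u.ev x - B * v.ev x - C * w.ev x := by
    rw [aff_add, aff_add, aff_add, aff_smul, aff_smul, aff_smul]
    simp only [Geodesic.ev]; ring
  have eq := e q
  have er := e r
  have ep := e p
  rw [T.uq, T.wq, hB, div_mul_cancel₀ _ e2] at eq
  rw [T.ur, T.vr, hC, div_mul_cancel₀ _ e3] at er
  rw [T.vp, T.wp, hA, div_mul_cancel₀ _ e1] at ep
  obtain ⟨c, hc⟩ := u.exists_smul hqr T.uq T.ur (eq.trans (by ring)) (er.trans (by ring))
  have hcp : c * u.ev p = 0 := by rw [← hc, ep]; ring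
  have hc0 := (mul_eq_zero.1 hcp).resolve_right e1
  have hz := (e z).symm.trans (hc z)
  rw [hc0, zero_mul] at hz
  have : aff α β z = A * u.ev z + B * v.ev z + C * w.ev z := by linarith
  rw [this, hA, hB, hC]
  field_simp

theorem bary_ev (T : IsTriangle u v w p q r) (z : ClosedDisc) (k : Geodesic) :
    k.ev z = u.ev z / u.ev p * k.ev p + v.ev z / v.ev q * k.ev q + w.ev z / w.ev r * k.ev r :=
  T.bary z _ _

theorem bary_klein (T : IsTriangle u v w p q r) (z : ClosedDisc) :
    (klein z : ℂ) = ((u.ev z / u.ev p : ℝ) : ℂ) * klein p + ((v.ev z / v.ev q : ℝ) : ℂ) * klein q +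
      ((w.ev z / w.ev r : ℝ) : ℂ) * klein r := by
  apply Complex.ext
  · simpa [aff] using T.bary z 0 1
  · simpa [aff] using T.bary z 0 Complex.I

/-- Euclidean balls are convex, so a triangle with vertices in the disc lies in a compact part of
it. This makes local finiteness applicable. -/
theorem norm_klein_le (T : IsTriangle u v w p q r) {z : ClosedDisc} (hu : 0 ≤ u.ev z)
    (hv : 0 ≤ v.ev z) (hw : 0 ≤ w.ev z) {ρ : ℝ} (hp : ‖(klein p : ℂ)‖ ≤ ρ)
    (hq : ‖(klein q : ℂ)‖ ≤ ρ) (hr : ‖(klein r : ℂ)‖ ≤ ρ) : ‖(klein z : ℂ)‖ ≤ ρ := by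
  have a1 : 0 ≤ u.ev z / u.ev p := div_nonneg hu T.up.le
  have a2 : 0 ≤ v.ev z / v.ev q := div_nonneg hv T.vq.le
  have a3 : 0 ≤ w.ev z / w.ev r := div_nonneg hw T.wr.le
  have hsum : u.ev z / u.ev p + v.ev z / v.ev q + w.ev z / w.ev r = 1 := by
    have := T.bary z 1 0
    simp [aff] at this
    exact this.symm
  rw [T.bary_klein z]
  refine (norm_add₃_le).trans ?_
  rw [norm_mul, norm_mul, norm_mul, Complex.norm_of_nonneg a1, Complex.norm_of_nonneg a2,
    Complex.norm_of_nonneg a3]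
  calc _ ≤ (u.ev z / u.ev p) * ρ + (v.ev z / v.ev q) * ρ + (w.ev z / w.ev r) * ρ := by gcongr
    _ = ρ := by rw [← add_mul, ← add_mul, hsum, one_mul]

/-- The interior of a triangle contains points close to every vertex. -/
theorem exists_inside (T : IsTriangle u v w p q r) (hp : p ∈ disc) {V : Set ClosedDisc}
    (hV : V ∈ 𝓝 p) : ∃ x ∈ V, x ∈ disc ∧ 0 < u.ev x ∧ 0 < v.ev x ∧ 0 < w.ev x := by
  obtain ⟨m, hm, -⟩ := exists_mix q r (t := 1 / 2) (by norm_num) (by norm_num)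
  obtain ⟨t, ⟨⟨x, hxV, hxd, hx⟩, ht1⟩, ht⟩ := (((eventually_extend hp m hV).and
    (gt_mem_nhds one_pos)).filter_mono (nhdsWithin_le_nhds (s := Ioi 0))).and
    (self_mem_nhdsWithin (s := Ioi (0 : ℝ))) |>.exists
  have ht : 0 < t := ht
  have e (k : Geodesic) : k.ev x = (1 - t) * k.ev p + t * ((1 - 1 / 2) * k.ev q + 1 / 2 * k.ev r) := by
    have h1 : k.ev x = (1 - t) * k.ev p + t * k.ev m := hx _ _
    have h2 : k.ev m = (1 - 1 / 2) * k.ev q + 1 / 2 * k.ev r := hm _ _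
    rw [h1, h2]
  refine ⟨x, hxV, hxd, ?_, ?_, ?_⟩
  · rw [e, T.uq, T.ur]
    have := mul_pos (sub_pos.2 ht1) T.up
    linarith
  · rw [e, T.vp, T.vr]
    have := mul_pos ht T.vq
    linarith
  · rw [e, T.wp, T.wq]
    have := mul_pos ht T.wr
    linarith

end IsTriangle

/-! ### Descent on the number of tiles in a triangle -/

namespace EvenTiling

variable {Γ : Subgroup (Equiv.Perm ClosedDisc)} {R : Set ClosedDisc} {ι : Type} [Finite ι]
  {h : ι → Geodesic}

/-- The tiles which meet the interior of a triangle. -/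
def tiles (Γ : Subgroup (Equiv.Perm ClosedDisc)) (R : Set ClosedDisc) (u v w : Geodesic) :
    Set (Equiv.Perm ClosedDisc) :=
  {g | g ∈ Γ ∧ ∃ y ∈ interior R, 0 < u.ev (g y) ∧ 0 < v.ev (g y) ∧ 0 < w.ev (g y)}

theorem tiles_rotate (u v w : Geodesic) : tiles Γ R v w u = tiles Γ R u v w := by
  ext g
  simp only [tiles, mem_ofPred_eq]
  refine and_congr_right fun _ => exists_congr fun y => ?_
  tauto

/-- The part of the disc of Klein radius at most `ρ`. -/
def smallDisc (ρ : ℝ) : Set ClosedDisc := {z | ‖(klein z : ℂ)‖ ≤ ρ}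

theorem isCompact_smallDisc (ρ : ℝ) : IsCompact (smallDisc ρ) := by
  have hc : Continuous fun z => ‖(klein z : ℂ)‖ :=
    continuous_norm.comp (continuous_subtype_val.comp klein.continuous)
  exact (isClosed_le hc continuous_const).isCompact

theorem smallDisc_subset {ρ : ℝ} (hρ : ρ < 1) : smallDisc ρ ⊆ disc := fun _ hz =>
  BowenSeries.mem_disc_iff.2 (lt_of_le_of_lt hz hρ)

theorem finite_tiles (E : EvenTiling Γ R h) {u v w : Geodesic} {p q r : ClosedDisc}
    (T : IsTriangle u v w p q r) (hp : p ∈ disc) (hq : q ∈ disc) (hr : r ∈ disc) :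
    (tiles Γ R u v w).Finite := by
  set ρ := max ‖(klein p : ℂ)‖ (max ‖(klein q : ℂ)‖ ‖(klein r : ℂ)‖)
  have hρ : ρ < 1 := max_lt (BowenSeries.mem_disc_iff.1 hp)
    (max_lt (BowenSeries.mem_disc_iff.1 hq) (BowenSeries.mem_disc_iff.1 hr))
  refine (E.locallyFinite _ (isCompact_smallDisc ρ) (smallDisc_subset hρ)).subset ?_
  rintro g ⟨hg, y, hy, h1, h2, h3⟩
  exact ⟨hg, g y, ⟨y, interior_subset hy, rfl⟩, T.norm_klein_le h1.le h2.le h3.le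
    (le_max_left _ _) ((le_max_left _ _).trans (le_max_right _ _))
    ((le_max_right _ _).trans (le_max_right _ _))⟩

/-- Every open condition which holds somewhere in the disc holds somewhere in the interior of
a tile. -/
theorem exists_tile (E : EvenTiling Γ R h) {x : ClosedDisc} (hx : x ∈ disc) {V : Set ClosedDisc}
    (hV : V ∈ 𝓝 x) : ∃ g ∈ Γ, ∃ y ∈ interior R, g y ∈ V := by
  obtain ⟨g, hg, w, hw, rfl⟩ := E.covers x hx
  obtain ⟨y, hyV, hy⟩ := E.exists_interior_near hw
    ((E.mobius g hg).continuous.continuousAt.preimage_mem_nhds hV)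
  exact ⟨g, hg, y, hy, hyV⟩

theorem wall_nonneg_tile (E : EvenTiling Γ R h) {u : Geodesic} (hu : IsWall Γ R u)
    {g : Equiv.Perm ClosedDisc} (hg : g ∈ Γ) {y : ClosedDisc} (hy : y ∈ R) (h0 : 0 < u.ev (g y))
    {z : ClosedDisc} (hz : z ∈ R) : 0 ≤ u.ev (g z) := by
  obtain ⟨k, hk⟩ := E.exists_image (Γ.inv_mem hg) u
  have hk' : IsImage g k u := by simpa using hk.symm
  rw [hk'.nonneg_iff]
  exact E.wall_nonneg (E.isWall_image (Γ.inv_mem hg) hk hu) hy (hk'.pos_iff.1 h0) hz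

theorem pos_mem_nhds_ev (u : Geodesic) {x : ClosedDisc} (hx : 0 < u.ev x) :
    {z | 0 < u.ev z} ∈ 𝓝 x :=
  (isOpen_lt continuous_const u.continuous_ev).mem_nhds hx

/-- A wall which separates the vertex `p` of a triangle from the opposite side cuts off a smaller
triangle. -/
theorem exists_smaller (E : EvenTiling Γ R h) {u v w t : Geodesic} {p q r : ClosedDisc}
    (T : IsTriangle u v w p q r) (hp : p ∈ disc) (hq : q ∈ disc) (hr : r ∈ disc)
    (ht : IsWall Γ R t) (htp : 0 < t.ev p) (htq : t.ev q ≤ 0) (htr : t.ev r ≤ 0)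
    (hlt : t.ev q < 0 ∨ t.ev r < 0) :
    ∃ q' ∈ disc, ∃ r' ∈ disc, IsTriangle t v w p q' r' ∧
      (tiles Γ R t v w).ncard < (tiles Γ R u v w).ncard := by
  obtain ⟨q', hqd, hq', s, hs0, hs1, hs⟩ := t.neg.exists_cross (a := p) (b := q) (by simpa using htp)
    (by simpa using htq)
  obtain ⟨r', hrd, hr', s', hs0', hs1', hs'⟩ := t.neg.exists_cross (a := p) (b := r)
    (by simpa using htp) (by simpa using htr)
  have e (k : Geodesic) : k.ev q' = (1 - s) * k.ev p + s * k.ev q := hs _ _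
  have e' (k : Geodesic) : k.ev r' = (1 - s') * k.ev p + s' * k.ev r := hs' _ _
  rw [Geodesic.ev_neg, neg_eq_zero] at hq' hr'
  have T' : IsTriangle t v w p q' r' := by
    refine ⟨htp, T.vp, T.wp, hq', ?_, ?_, hr', ?_, ?_⟩
    · rw [e, T.vp]; linarith [mul_pos hs0 T.vq]
    · rw [e, T.wp, T.wq]; ring
    · rw [e', T.vp, T.vr]; ring
    · rw [e', T.wp]; linarith [mul_pos hs0' T.wr]
  refine ⟨q', hqd hq, r', hrd hr, T', Set.ncard_lt_ncard ⟨?_, ?_⟩ (E.finite_tiles T hp hq hr)⟩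
  · rintro g ⟨hg, y, hy, h1, h2, h3⟩
    refine ⟨hg, y, hy, ?_, h2, h3⟩
    -- Each vertex of the smaller triangle has a nonnegative value of `u`, and `p` a positive one,
    -- so `u` is positive inside the smaller triangle.
    rw [T'.bary_ev (g y) u, e u, e' u, T.uq, T.ur]
    have a1 := mul_pos (div_pos h1 T'.up) T.up
    have a2 : 0 ≤ v.ev (g y) / v.ev q' * ((1 - s) * u.ev p + s * 0) :=
      mul_nonneg (div_pos h2 T'.vq).le
        (by rw [mul_zero, add_zero]; exact mul_nonneg (by linarith) T.up.le)
    have a3 : 0 ≤ w.ev (g y) / w.ev r' * ((1 - s') * u.ev p + s' * 0) :=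
      mul_nonneg (div_pos h3 T'.wr).le
        (by rw [mul_zero, add_zero]; exact mul_nonneg (by linarith) T.up.le)
    linarith
  · intro hsub
    -- The inclusion of tiles is strict: near a vertex on the negative side of `t` the large
    -- triangle contains interior points of some tile, and since `t` cuts no tile, that tile misses
    -- the small triangle.
    have key : ∃ x ∈ disc, 0 < u.ev x ∧ 0 < v.ev x ∧ 0 < w.ev x ∧ 0 < t.neg.ev x := by
      rcases hlt with hlt | hlt
      · obtain ⟨x, hxV, hx, h1, h2, h3⟩ := T.rotate.exists_inside hq
          (pos_mem_nhds_ev t.neg (by simpa using hlt))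
        exact ⟨x, hx, h3, h1, h2, hxV⟩
      · obtain ⟨x, hxV, hx, h1, h2, h3⟩ := T.rotate.rotate.exists_inside hr
          (pos_mem_nhds_ev t.neg (by simpa using hlt))
        exact ⟨x, hx, h2, h3, h1, hxV⟩
    obtain ⟨x, hx, h1, h2, h3, h4⟩ := key
    obtain ⟨g, hg, y, hy, ⟨⟨g1, g2⟩, g3⟩, g4⟩ := E.exists_tile hx
      (inter_mem (inter_mem (inter_mem (pos_mem_nhds_ev u h1) (pos_mem_nhds_ev v h2))
        (pos_mem_nhds_ev w h3)) (pos_mem_nhds_ev t.neg h4))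
    obtain ⟨-, y', hy', h1', -⟩ := hsub ⟨hg, y, hy, g1, g2, g3⟩
    have := E.wall_nonneg_tile ht hg (interior_subset hy') h1' (interior_subset hy)
    have g4 : 0 < t.neg.ev (g y) := g4
    rw [Geodesic.ev_neg] at g4
    linarith

/-- A tile in a triangle which no side of the tile cuts is itself a triangle. -/
theorem exists_neg_vertex (E : EvenTiling Γ R h) (hN : 4 ≤ Nat.card ι) {u v w : Geodesic}
    {p q r : ClosedDisc} (T : IsTriangle u v w p q r) (hu : IsWall Γ R u) (hv : IsWall Γ R v)
    (hw : IsWall Γ R w) {g : Equiv.Perm ClosedDisc} (hg : g ∈ tiles Γ R u v w) {k : ι → Geodesic}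
    (hk : ∀ i, IsImage g (h i) (k i)) : ∃ i, (k i).ev p < 0 ∨ (k i).ev q < 0 ∨ (k i).ev r < 0 := by
  by_contra! hcon
  obtain ⟨hgΓ, y, hy, h1, h2, h3⟩ := hg
  have hyR := interior_subset hy
  -- On the side `i` of the tile all three terms of the barycentric formula are nonnegative with sum
  -- zero. Hence the side lies on the edge opposite to any vertex where its functional does not
  -- vanish, and distinct sides use distinct edges, of which there are only three.
  have claim : ∀ i, ∃ f : Fin 3, ∃ c : ℝ, c ≠ 0 ∧ ∀ z, (k i).ev z = c * (![u, v, w] f).ev z := by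
    intro i
    obtain ⟨m, hm, hm0, hmj⟩ := E.exists_mid i
    obtain ⟨b, hb, -, -, hne, hb0, -⟩ := E.exists_segment hm hm0 hmj
    have hmR := E.mem_of_mid hm hm0 hmj
    have hne' : g b ≠ g m := fun e => hne (g.injective e)
    have kb := (hk i).zero_iff.2 hb0
    have km := (hk i).zero_iff.2 hm0
    obtain ⟨c1, c2, c3⟩ := hcon i
    have vanish (z : ClosedDisc) (hz : z ∈ R) (h0 : (k i).ev (g z) = 0) :
        ((k i).ev p ≠ 0 → u.ev (g z) = 0) ∧ ((k i).ev q ≠ 0 → v.ev (g z) = 0) ∧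
          ((k i).ev r ≠ 0 → w.ev (g z) = 0) := by
      have n1 := E.wall_nonneg_tile hu hgΓ hyR h1 hz
      have n2 := E.wall_nonneg_tile hv hgΓ hyR h2 hz
      have n3 := E.wall_nonneg_tile hw hgΓ hyR h3 hz
      have e := T.bary_ev (g z) (k i)
      rw [h0] at e
      have m1 := mul_nonneg (div_nonneg n1 T.up.le) c1
      have m2 := mul_nonneg (div_nonneg n2 T.vq.le) c2
      have m3 := mul_nonneg (div_nonneg n3 T.wr.le) c3
      have z1 : u.ev (g z) / u.ev p * (k i).ev p = 0 := by linarith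
      have z2 : v.ev (g z) / v.ev q * (k i).ev q = 0 := by linarith
      have z3 : w.ev (g z) / w.ev r * (k i).ev r = 0 := by linarith
      refine ⟨fun hne => ?_, fun hne => ?_, fun hne => ?_⟩
      · exact (div_eq_zero_iff.1 ((mul_eq_zero.1 z1).resolve_right hne)).resolve_right T.up.ne'
      · exact (div_eq_zero_iff.1 ((mul_eq_zero.1 z2).resolve_right hne)).resolve_right T.vq.ne'
      · exact (div_eq_zero_iff.1 ((mul_eq_zero.1 z3).resolve_right hne)).resolve_right T.wr.ne'
    have vb := vanish b hb kb
    have vm := vanish m hmR km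
    by_cases p1 : (k i).ev p = 0
    · by_cases p2 : (k i).ev q = 0
      · by_cases p3 : (k i).ev r = 0
        · obtain ⟨z, -, hz⟩ := (k i).exists_ev_ne_zero
          exact absurd (by rw [T.bary_ev z (k i), p1, p2, p3]; ring) hz
        · exact ⟨2, Geodesic.proportional hne' (vb.2.2 p3) (vm.2.2 p3) kb km⟩
      · exact ⟨1, Geodesic.proportional hne' (vb.2.1 p2) (vm.2.1 p2) kb km⟩
    · exact ⟨0, Geodesic.proportional hne' (vb.1 p1) (vm.1 p1) kb km⟩
  choose f c hc hf using claim
  have hinj : Function.Injective f := by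
    intro i j hij
    refine E.eq_of_zero_imp fun z _ hz => ?_
    have e1 := (hk i).zero_iff.2 hz
    rw [hf i, hij, mul_eq_zero, or_iff_right (hc i)] at e1
    refine ((hk j).zero_iff.1 ?_).le
    rw [hf j, e1, mul_zero]
  have := Nat.card_le_card_of_injective f hinj
  rw [Nat.card_fin] at this
  omega

/-- Strong induction on the number of tiles meeting the interior: a side of one of these tiles lies
on a wall that splits the vertices of the triangle and so cuts off a smaller one. -/
theorem not_isTriangle (E : EvenTiling Γ R h) (hN : 4 ≤ Nat.card ι) (n : ℕ) :
    ∀ {u v w : Geodesic} {p q r : ClosedDisc}, IsTriangle u v w p q r → p ∈ disc → q ∈ disc →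
      r ∈ disc → IsWall Γ R u → IsWall Γ R v → IsWall Γ R w → (tiles Γ R u v w).ncard ≠ n := by
  induction n using Nat.strong_induction_on with
  | _ n ih =>
  intro u v w p q r T hp hq hr hu hv hw hn
  subst hn
  have cut : ∀ {u' v' w' t : Geodesic} {p' q' r' : ClosedDisc}, IsTriangle u' v' w' p' q' r' →
      p' ∈ disc → q' ∈ disc → r' ∈ disc → IsWall Γ R v' → IsWall Γ R w' →
      tiles Γ R u' v' w' = tiles Γ R u v w → IsWall Γ R t → 0 < t.ev p' → t.ev q' ≤ 0 →
      t.ev r' ≤ 0 → (t.ev q' < 0 ∨ t.ev r' < 0) → False := by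
    intro u' v' w' t p' q' r' T' hp' hq' hr' hv' hw' he ht h1 h2 h3 h4
    obtain ⟨q'', hq'', r'', hr'', T'', hlt⟩ := E.exists_smaller T' hp' hq' hr' ht h1 h2 h3 h4
    rw [he] at hlt
    exact ih _ hlt T'' hp' hq'' hr'' ht hv' hw' rfl
  have cut3 : ∀ {t : Geodesic}, IsWall Γ R t → (0 < t.ev p ∧ t.ev q ≤ 0 ∧ t.ev r ≤ 0 ∧
      (t.ev q < 0 ∨ t.ev r < 0)) ∨ (0 < t.ev q ∧ t.ev r ≤ 0 ∧ t.ev p ≤ 0 ∧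
      (t.ev r < 0 ∨ t.ev p < 0)) ∨ (0 < t.ev r ∧ t.ev p ≤ 0 ∧ t.ev q ≤ 0 ∧
      (t.ev p < 0 ∨ t.ev q < 0)) → False := by
    rintro t ht (⟨h1, h2, h3, h4⟩ | ⟨h1, h2, h3, h4⟩ | ⟨h1, h2, h3, h4⟩)
    · exact cut T hp hq hr hv hw rfl ht h1 h2 h3 h4
    · exact cut T.rotate hq hr hp hw hu (tiles_rotate _ _ _) ht h1 h2 h3 h4
    · exact cut T.rotate.rotate hr hp hq hu hv ((tiles_rotate _ _ _).trans (tiles_rotate _ _ _))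
        ht h1 h2 h3 h4
  obtain ⟨x, -, hx, h1, h2, h3⟩ := T.exists_inside hp univ_mem
  obtain ⟨g, hg, y, hy, ⟨g1, g2⟩, g3⟩ := E.exists_tile hx
      (inter_mem (inter_mem (pos_mem_nhds_ev u h1) (pos_mem_nhds_ev v h2)) (pos_mem_nhds_ev w h3))
  choose k hk using fun i => E.exists_image hg (h i)
  obtain ⟨i, hi⟩ := E.exists_neg_vertex hN T hu hv hw ⟨hg, y, hy, g1, g2, g3⟩ hk
  have hki : IsWall Γ R (k i) := E.isWall_image hg (hk i) (E.isWall_side i)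
  have hpos : 0 < (k i).ev (g y) := (hk i).pos_iff.2 ((E.mem_interior_iff.1 hy).2 i)
  have hex : 0 < (k i).ev p ∨ 0 < (k i).ev q ∨ 0 < (k i).ev r := by
    by_contra! hcon
    rw [T.bary_ev (g y) (k i)] at hpos
    have m1 := mul_nonneg (div_pos g1 T.up).le (neg_nonneg.2 hcon.1)
    have m2 := mul_nonneg (div_pos g2 T.vq).le (neg_nonneg.2 hcon.2.1)
    have m3 := mul_nonneg (div_pos g3 T.wr).le (neg_nonneg.2 hcon.2.2)
    linarith
  have c1 := cut3 hki
  have c2 := cut3 (isWall_neg hki)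
  simp only [Geodesic.ev_neg] at c2
  generalize (k i).ev p = a at *
  generalize (k i).ev q = b at *
  generalize (k i).ev r = c at *
  clear hpos cut3 cut ih
  -- The wall is positive at one vertex and negative at another. For one of its two orientations it
  -- is therefore positive at exactly one vertex, nonpositive at the other two and negative at one
  -- of them.
  grind

/-- Three walls which cross pairwise are concurrent. -/
theorem no_triangle (E : EvenTiling Γ R h) (hN : 4 ≤ Nat.card ι) {u v w : Geodesic}
    (hu : IsWall Γ R u) (hv : IsWall Γ R v) (hw : IsWall Γ R w) {p q r : ClosedDisc}
    (hp : p ∈ disc) (hq : q ∈ disc) (hr : r ∈ disc) (up : u.ev p ≠ 0) (vp : v.ev p = 0)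
    (wp : w.ev p = 0) (uq : u.ev q = 0) (vq : v.ev q ≠ 0) (wq : w.ev q = 0) (ur : u.ev r = 0)
    (vr : v.ev r = 0) (wr : w.ev r ≠ 0) : False := by
  have orient (k : Geodesic) (hk : IsWall Γ R k) (x : ClosedDisc) (hx : k.ev x ≠ 0) :
      ∃ k', IsWall Γ R k' ∧ 0 < k'.ev x ∧ ∀ z, k.ev z = 0 → k'.ev z = 0 := by
    rcases lt_or_gt_of_ne hx with h0 | h0
    · exact ⟨k.neg, isWall_neg hk, by simpa using h0, fun z hz => by simp [hz]⟩
    · exact ⟨k, hk, h0, fun z hz => hz⟩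
  obtain ⟨u', hu', up', zu⟩ := orient u hu p up
  obtain ⟨v', hv', vq', zv⟩ := orient v hv q vq
  obtain ⟨w', hw', wr', zw⟩ := orient w hw r wr
  exact E.not_isTriangle hN _ ⟨up', zv _ vp, zw _ wp, zu _ uq, vq', zw _ wq, zu _ ur, zv _ vr, wr'⟩
    hp hq hr hu' hv' hw' rfl

/-- Two walls which meet `R` and cross do so in `R`. -/
theorem mem_of_cross (E : EvenTiling Γ R h) (hN : 4 ≤ Nat.card ι) {u v : Geodesic}
    (hu : IsWall Γ R u) (hv : IsWall Γ R v) {a b x : ClosedDisc} (ha : a ∈ R) (hua : u.ev a = 0)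
    (hb : b ∈ R) (hvb : v.ev b = 0) (hx : x ∈ disc) (hux : u.ev x = 0) (hvx : v.ev x = 0)
    (hne : ∃ z, u.ev z = 0 ∧ v.ev z ≠ 0) : x ∈ R := by
  by_contra hxR
  have : ∃ i, (h i).ev x < 0 := by
    by_contra! hcon
    exact hxR ((E.mem_iff x).2 ⟨hx, hcon⟩)
  obtain ⟨i, hi⟩ := this
  obtain ⟨y, hyd, hy, s, -, -, hs⟩ := (h i).exists_cross hi (E.ev_nonneg ha i)
  obtain ⟨y', hyd', hy', s', -, -, hs'⟩ := (h i).exists_cross hi (E.ev_nonneg hb i)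
  have huy : u.ev y = 0 := by
    have : u.ev y = (1 - s) * u.ev x + s * u.ev a := hs _ _
    rw [this, hux, hua]; ring
  have hvy' : v.ev y' = 0 := by
    have : v.ev y' = (1 - s') * v.ev x + s' * v.ev b := hs' _ _
    rw [this, hvx, hvb]; ring
  have hxy : x ≠ y := by rintro rfl; exact hi.ne hy
  have hxy' : x ≠ y' := by rintro rfl; exact hi.ne hy'
  obtain ⟨z, hz, hz'⟩ := hne
  -- The wall of a side with `x` behind it crosses `u` on the way from `x` to `a`, and `v` on the
  -- way from `x` to `b`, which completes a triangle.
  refine E.no_triangle hN (E.isWall_side i) hu hv hx (hyd' (E.subset_disc hb))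
    (hyd (E.subset_disc ha)) hi.ne hux hvx hy' ?_ hvy' hy huy ?_
  · intro h0
    obtain ⟨c, hc, e⟩ := Geodesic.proportional hxy' hux h0 hvx hvy'
    exact hz' (by rw [e, hz, mul_zero])
  · intro h0
    obtain ⟨c, hc, e⟩ := Geodesic.proportional hxy hux huy hvx h0
    exact hz' (by rw [e, hz, mul_zero])

/-! ### Adjacent sides -/

/-- Two sides are adjacent if they have a common vertex in the disc. -/
def Adj (R : Set ClosedDisc) (h : ι → Geodesic) (i j : ι) : Prop :=
  i ≠ j ∧ ∃ v ∈ R, (h i).ev v = 0 ∧ (h j).ev v = 0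

theorem Adj.symm {i j : ι} (H : Adj R h i j) : Adj R h j i :=
  ⟨H.1.symm, H.2.imp fun _ hv => ⟨hv.1, hv.2.2, hv.2.1⟩⟩

/-- No three sides have a common vertex. -/
theorem eq_or_eq_of_vertex (S : SideSystem R h) {i j k : ι} (hij : i ≠ j) {v : ClosedDisc}
    (hi : (h i).ev v = 0) (hj : (h j).ev v = 0) (hk : (h k).ev v = 0) : k = i ∨ k = j := by
  by_contra! hcon
  obtain ⟨hki, hkj⟩ := hcon
  obtain ⟨y, -, y0, yj⟩ := S.exists_mid i
  obtain ⟨x, -, x0, xj⟩ := S.exists_mid j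
  obtain ⟨z, -, z0, zj⟩ := S.exists_mid k
  obtain ⟨a, b, e⟩ := Geodesic.pencil hi hj hk y0 (yj j hij.symm).ne'
  have e1 := e y
  have e2 := e x
  have e3 := e z
  rw [y0, mul_zero, zero_add] at e1
  rw [x0, mul_zero, add_zero] at e2
  rw [z0] at e3
  -- In the pencil through `v`, the functional of `k` is a combination of those of `i` and `j`.
  -- Points of these two sides show that both coefficients are positive, so it cannot vanish at the
  -- chosen point of the side `k`.
  have hb : 0 < b := pos_of_mul_pos_left (e1 ▸ yj k hki) (yj j hij.symm).le
  have ha : 0 < a := pos_of_mul_pos_left (e2 ▸ xj k hkj) (xj i hij).le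
  linarith [mul_pos ha (zj i hki.symm), mul_pos hb (zj j hkj.symm)]

/-- A side has at most two adjacent sides. -/
theorem not_three_adj (S : SideSystem R h) {i a b c : ι} (ha : Adj R h i a) (hb : Adj R h i b)
    (hc : Adj R h i c) (hab : a ≠ b) (hbc : b ≠ c) (hac : a ≠ c) : False := by
  obtain ⟨hia, x, hx, xi, xa⟩ := ha
  obtain ⟨hib, y, hy, yi, yb⟩ := hb
  obtain ⟨hic, z, hz, zi, zc⟩ := hc
  have pos {v : ClosedDisc} (hv : v ∈ R) (vi : (h i).ev v = 0) {j k : ι} (hij : i ≠ j) (hik : i ≠ k)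
      (hjk : j ≠ k) (vj : (h j).ev v = 0) : 0 < (h k).ev v := by
    refine lt_of_le_of_ne (S.ev_nonneg hv k) fun h0 => ?_
    rcases eq_or_eq_of_vertex S hij vi vj h0.symm with h1 | h1
    · exact hik h1.symm
    · exact hjk h1.symm
  have xb := pos hx xi hia hib hab xa
  have xc := pos hx xi hia hic hac xa
  have ya := pos hy yi hib hia hab.symm yb
  have yc := pos hy yi hib hic hbc yb
  have za := pos hz zi hic hia hac.symm zc
  have zb := pos hz zi hic hib hbc.symm zc
  have hxy : x ≠ y := by rintro rfl; exact ya.ne' xa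
  -- These coefficients make `h c - A h a - B h b` vanish at the two points `x` and `y` of the side
  -- `i`, hence on its whole geodesic. At `z` it is negative.
  set A := (h c).ev y / (h a).ev y with hA
  set B := (h c).ev x / (h b).ev x with hB
  have e (w) : aff ((h c).α + -A * (h a).α + -B * (h b).α)
      ((h c).β + ((-A : ℝ) : ℂ) * (h a).β + ((-B : ℝ) : ℂ) * (h b).β) w =
      (h c).ev w - A * (h a).ev w - B * (h b).ev w := by
    rw [aff_add, aff_add, aff_smul, aff_smul]
    simp only [Geodesic.ev]; ring
  obtain ⟨d, hd⟩ := (h i).exists_smul hxy xi yi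
    (α := (h c).α + -A * (h a).α + -B * (h b).α)
    (β := (h c).β + ((-A : ℝ) : ℂ) * (h a).β + ((-B : ℝ) : ℂ) * (h b).β)
    (by rw [e, xa, hB, div_mul_cancel₀ _ xb.ne']; ring)
    (by rw [e, yb, hA, div_mul_cancel₀ _ ya.ne']; ring)
  have hdz := hd z
  rw [e, zi, zc] at hdz
  linarith [mul_pos (div_pos yc ya) za, mul_pos (div_pos xc xb) zb]

/-- No three sides are pairwise adjacent. -/
theorem not_triangle_adj (E : EvenTiling Γ R h) (hN : 4 ≤ Nat.card ι) {i j k : ι}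
    (hij : Adj R h i j) (hjk : Adj R h j k) (hik : Adj R h i k) : False := by
  obtain ⟨nij, x, hx, xi, xj⟩ := hij
  obtain ⟨njk, y, hy, yj, yk⟩ := hjk
  obtain ⟨nik, z, hz, zi, zk⟩ := hik
  refine E.no_triangle hN (E.isWall_side i) (E.isWall_side j) (E.isWall_side k)
    (E.subset_disc hy) (E.subset_disc hz) (E.subset_disc hx) ?_ yj yk zi ?_ zk xi xj ?_
  · intro h0
    rcases eq_or_eq_of_vertex E.toSideSystem njk yj yk h0 with h1 | h1
    exacts [nij h1, nik h1]
  · intro h0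
    rcases eq_or_eq_of_vertex E.toSideSystem nik zi zk h0 with h1 | h1
    exacts [nij h1.symm, njk h1]
  · intro h0
    rcases eq_or_eq_of_vertex E.toSideSystem nij xi xj h0 with h1 | h1
    exacts [nik h1.symm, njk h1.symm]

/-- Sides whose exterior half planes meet, if only at infinity, are adjacent. -/
theorem adj_of_neg (E : EvenTiling Γ R h) (hN : 4 ≤ Nat.card ι) {i j : ι} (hij : i ≠ j)
    {ξ : ClosedDisc} (hi : (h i).ev ξ < 0) (hj : (h j).ev ξ ≤ 0) : Adj R h i j := by
  obtain ⟨y, hy, y0, yj⟩ := E.exists_mid i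
  obtain ⟨x, hx, x0, xj⟩ := E.exists_mid j
  -- The segment from the side `i` to `ξ` meets the geodesic of `j` strictly behind `i`. From there,
  -- following that geodesic back to R crosses the geodesic of `i`, and by `mem_of_cross` this
  -- happens in R.
  obtain ⟨z, -, hz, s, hs0, hs1, hs⟩ := (h j).neg.exists_cross (a := y) (b := ξ)
    (by simpa using yj j hij.symm) (by simpa using hj)
  rw [Geodesic.ev_neg, neg_eq_zero] at hz
  have hz' : (h i).ev z < 0 := by
    have : (h i).ev z = (1 - s) * (h i).ev y + s * (h i).ev ξ := hs _ _
    rw [this, y0, mul_zero, zero_add]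
    exact mul_neg_of_pos_of_neg hs0 hi
  obtain ⟨w, hwd, hw, s', -, -, hs'⟩ := (h i).exists_cross hz' (xj i hij).le
  have hwj : (h j).ev w = 0 := by
    have : (h j).ev w = (1 - s') * (h j).ev z + s' * (h j).ev x := hs' _ _
    rw [this, hz, x0]; ring
  refine ⟨hij, w, ?_, hw, hwj⟩
  exact E.mem_of_cross hN (E.isWall_side i) (E.isWall_side j) (E.mem_of_mid hy y0 yj) y0
    (E.mem_of_mid hx x0 xj) x0 (hwd hx) hw hwj ⟨y, y0, (yj j hij.symm).ne'⟩

/-! ### Walls which meet the polygon -/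

theorem exists_side_of_wall (E : EvenTiling Γ R h) {u : Geodesic} (hu : IsWall Γ R u)
    {x : ClosedDisc} (hx : x ∈ R) (hux : u.ev x = 0) : ∃ i, (h i).ev x = 0 := by
  by_contra! hcon
  exact E.wall_ne_zero hu (E.mem_interior (E.subset_disc hx) fun i =>
    lt_of_le_of_ne (E.ev_nonneg hx i) (hcon i).symm) hux

/-- A wall which meets a side either carries the side or meets it in a vertex. -/
theorem proportional_or_vertex (E : EvenTiling Γ R h) {u : Geodesic} (hu : IsWall Γ R u)
    {x : ClosedDisc} (hx : x ∈ R) (hux : u.ev x = 0) {i : ι} (hi : (h i).ev x = 0) :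
    (∃ c : ℝ, c ≠ 0 ∧ ∀ z, u.ev z = c * (h i).ev z) ∨ ∃ k, Adj R h i k ∧ (h k).ev x = 0 := by
  by_cases hk : ∃ k, k ≠ i ∧ (h k).ev x = 0
  · obtain ⟨k, hki, hk⟩ := hk
    exact Or.inr ⟨k, ⟨hki.symm, x, hx, hi, hk⟩, hk⟩
  · push Not at hk
    obtain ⟨b, hb, b', hb', hne, hb0, -, e⟩ := E.exists_segment (E.subset_disc hx) hi fun j hj =>
      lt_of_le_of_ne (E.ev_nonneg hx j) (hk j hj).symm
    have e' : u.ev b + u.ev b' = 2 * u.ev x := e _ _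
    -- Away from the vertices `x` is the midpoint of a segment of the side. A functional of constant
    -- sign on R that vanishes at the midpoint vanishes at both ends.
    have hub : u.ev b = 0 := by
      rcases E.wall_sign hu with H | H
      · linarith [H b hb, H b' hb']
      · linarith [H b hb, H b' hb']
    exact Or.inl (Geodesic.proportional hne hb0 hi hub hux)

/-- A wall through a vertex is a positive combination of the two sides at the vertex. -/
theorem exists_comb (E : EvenTiling Γ R h) {u : Geodesic} (hu : ∀ z ∈ R, 0 ≤ u.ev z)
    {x : ClosedDisc} (hux : u.ev x = 0) {i k : ι} (hik : i ≠ k)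
    (hi : (h i).ev x = 0) (hk : (h k).ev x = 0) :
    ∃ a b : ℝ, 0 ≤ a ∧ 0 ≤ b ∧ ∀ z, u.ev z = a * (h i).ev z + b * (h k).ev z := by
  obtain ⟨y, hy, y0, yj⟩ := E.exists_mid i
  obtain ⟨w, hw, w0, wj⟩ := E.exists_mid k
  obtain ⟨a, b, e⟩ := Geodesic.pencil hi hk hux y0 (yj k hik.symm).ne'
  have e1 := e y
  have e2 := e w
  rw [y0, mul_zero, zero_add] at e1
  rw [w0, mul_zero, add_zero] at e2
  have u1 := hu y (E.mem_of_mid hy y0 yj)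
  have u2 := hu w (E.mem_of_mid hw w0 wj)
  exact ⟨a, b, nonneg_of_mul_nonneg_left (e2 ▸ u2) (wj i hik),
    nonneg_of_mul_nonneg_left (e1 ▸ u1) (yj k hik.symm), e⟩

theorem eq_of_aff_eq {a b : ClosedDisc} (H : ∀ α β, aff α β a = aff α β b) : a = b := by
  refine klein.injective (Subtype.ext (Complex.ext ?_ ?_))
  · simpa [aff] using H 0 1
  · simpa [aff] using H 0 Complex.I

theorem line_eq {u k : Geodesic} {c : ℝ} (hc : c ≠ 0) (e : ∀ z, u.ev z = c * k.ev z) :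
    u.line = k.line := by
  ext z; simp [Geodesic.mem_line, e, hc]

/-- Only finitely many walls pass through a point of the disc. -/
theorem finite_walls_through (E : EvenTiling Γ R h) {v : ClosedDisc} (hv : v ∈ disc) :
    {l | ∃ u, IsWall Γ R u ∧ u.ev v = 0 ∧ l = u.line}.Finite := by
  obtain ⟨ρ, hvρ, hρ⟩ := exists_between (BowenSeries.mem_disc_iff.1 hv)
  set G := {g : Equiv.Perm ClosedDisc | g ∈ Γ ∧ ((g '' R) ∩ smallDisc ρ).Nonempty} with hG
  have hGf : G.Finite := E.locallyFinite _ (isCompact_smallDisc ρ) (smallDisc_subset hρ)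
  have hV : smallDisc ρ ∈ 𝓝 v := by
    have hc : Continuous fun z => ‖(klein z : ℂ)‖ :=
      continuous_norm.comp (continuous_subtype_val.comp klein.continuous)
    filter_upwards [hc.continuousAt.eventually_lt continuousAt_const hvρ] with z hz using hz.le
  have him : ∀ g : G, ∀ i, ∃ k, IsImage g.1 (h i) k := fun g i => E.exists_image g.2.1 (h i)
  choose k hk using him
  have : Finite G := hGf
  refine (Set.finite_range fun x : G × ι => (k x.1 x.2).line).subset ?_
  rintro _ ⟨u, hu, huv, rfl⟩
  obtain ⟨b, hbV, -, -, hb, -, hne, hub, -⟩ := u.exists_near hv huv hV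
  have hz : ∀ t : Icc (0 : ℝ) 1, ∃ z, (∀ α β, aff α β z = (1 - t) * aff α β v + t * aff α β b) ∧
      z ∈ disc ∧ ∃ x : G × ι, (k x.1 x.2).ev z = 0 := by
    intro t
    obtain ⟨z, hz, -, hzd'⟩ := exists_mix v b t.2.1 t.2.2
    have hzd : z ∈ disc := by
      rcases t.2.1.eq_or_lt with h0 | h0
      · have : z = v := eq_of_aff_eq fun α β => by rw [hz, ← h0]; ring
        rw [this]; exact hv
      · exact hzd' h0 hb
    have huz : u.ev z = 0 := by
      have : u.ev z = (1 - t) * u.ev v + t * u.ev b := hz _ _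
      rw [this, huv, hub]; ring
    have hzK : z ∈ smallDisc ρ := by
      have e : (klein z : ℂ) = ((1 - t : ℝ) : ℂ) * (klein v : ℂ) + ((t : ℝ) : ℂ) * (klein b : ℂ) := by
        apply Complex.ext
        · simpa [aff] using hz 0 1
        · simpa [aff] using hz 0 Complex.I
      show ‖(klein z : ℂ)‖ ≤ ρ
      rw [e]
      refine (norm_add_le _ _).trans ?_
      rw [norm_mul, norm_mul, Complex.norm_of_nonneg (sub_nonneg.2 t.2.2),
        Complex.norm_of_nonneg t.2.1]
      have hbV : ‖(klein b : ℂ)‖ ≤ ρ := hbV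
      nlinarith [t.2.1, t.2.2, mul_le_mul_of_nonneg_left hbV t.2.1,
        mul_le_mul_of_nonneg_left hvρ.le (sub_nonneg.2 t.2.2)]
    obtain ⟨g, hg, w, hw, e⟩ := hu (Geodesic.mem_line.2 ⟨hzd, huz⟩)
    obtain ⟨hwR, i, hi⟩ := E.mem_boundary_iff.1 hw
    subst e
    exact ⟨g w, hz, hzd, ⟨⟨g, hg, g w, ⟨w, hwR, rfl⟩, hzK⟩, i⟩, (hk ⟨g, _⟩ i).zero_iff.2 hi⟩
  choose z hz hzd f hf using hz
  have : Infinite (Icc (0 : ℝ) 1) := (Icc_infinite zero_lt_one).to_subtype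
  -- Every point of a short segment of the wall lies on one of finitely many geodesics that carry
  -- sides of nearby tiles. Two of the points lie on the same one, which is then the wall itself.
  obtain ⟨s, t, hst, hfst⟩ := Finite.exists_ne_map_eq_of_infinite f
  have hzst : z s ≠ z t := by
    intro he
    apply hne
    apply eq_of_aff_eq
    intro α β
    have e1 := hz s α β
    rw [he, hz t α β] at e1
    have e2 : ((t : ℝ) - s) * (aff α β b - aff α β v) = 0 := by linarith
    have : (t : ℝ) - s ≠ 0 := sub_ne_zero.2 fun h0 => hst (Subtype.ext h0.symm)
    linarith [(mul_eq_zero.1 e2).resolve_left this]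
  have hu0 (t) : u.ev (z t) = 0 := by
    have : u.ev (z t) = (1 - t) * u.ev v + t * u.ev b := hz t _ _
    rw [this, huv, hub]; ring
  have h1 := hf s
  rw [hfst] at h1
  obtain ⟨c, hc, e⟩ := Geodesic.proportional hzst h1 (hf t) (hu0 s) (hu0 t)
  exact ⟨f t, (line_eq hc e).symm⟩

/-- The lines of the walls which meet `R`. -/
def wallLines (Γ : Subgroup (Equiv.Perm ClosedDisc)) (R : Set ClosedDisc) : Set (Set ClosedDisc) :=
  {l | ∃ u, IsWall Γ R u ∧ (∃ x ∈ R, u.ev x = 0) ∧ l = u.line}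

/-- Such a wall carries a side or passes through one of the finitely many vertices. -/
theorem finite_wallLines (E : EvenTiling Γ R h) : (wallLines Γ R).Finite := by
  have hfin : ∀ p : ι × ι, {l | Adj R h p.1 p.2 ∧ ∃ u, IsWall Γ R u ∧ (∃ x ∈ R, u.ev x = 0 ∧
      (h p.1).ev x = 0 ∧ (h p.2).ev x = 0) ∧ l = u.line}.Finite := by
    rintro ⟨i, j⟩
    by_cases hij : Adj R h i j
    · obtain ⟨hne, v, hv, vi, vj⟩ := hij
      refine (E.finite_walls_through (E.subset_disc hv)).subset ?_
      rintro l ⟨-, u, hu, ⟨x, hx, hux, xi, xj⟩, rfl⟩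
      refine ⟨u, hu, ?_, rfl⟩
      by_cases hxv : x = v
      · rw [← hxv]; exact hux
      · exact absurd (E.eq_of_two_points hxv xi vi xj vj) hne
    · refine Set.finite_empty.subset ?_
      rintro l ⟨hij', -⟩
      exact hij hij'
  refine ((Set.finite_range fun i => (h i).line).union (Set.finite_iUnion hfin)).subset ?_
  rintro l ⟨u, hu, ⟨x, hx, hux⟩, rfl⟩
  obtain ⟨i, hi⟩ := E.exists_side_of_wall hu hx hux
  rcases E.proportional_or_vertex hu hx hux hi with ⟨c, hc, e⟩ | ⟨k, hik, hk⟩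
  · exact Or.inl ⟨i, (line_eq hc e).symm⟩
  · exact Or.inr (mem_iUnion.2 ⟨(i, k), hik, u, hu, ⟨x, hx, hux, hi, hk⟩, rfl⟩)

theorem mem_partitionPoints (E : EvenTiling Γ R h) {ξ : ClosedDisc} :
    ξ ∈ partitionPoints Γ R ↔ ξ ∈ circleAtInfinity ∧
      ∃ u, IsWall Γ R u ∧ (∃ x ∈ R, u.ev x = 0) ∧ u.ev ξ = 0 := by
  constructor
  · rintro ⟨u, hu, ⟨x, hx, hx'⟩, hξ⟩
    rw [Geodesic.mem_endpoints] at hξ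
    exact ⟨hξ.1, u, hu, ⟨x, (E.mem_boundary_iff.1 hx').1, (Geodesic.mem_line.1 hx).2⟩, hξ.2⟩
  · rintro ⟨hξ, u, hu, ⟨x, hx, hux⟩, h0⟩
    exact ⟨u, hu, ⟨x, Geodesic.mem_line.2 ⟨E.subset_disc hx, hux⟩, E.mem_boundary_iff.2
      ⟨hx, E.exists_side_of_wall hu hx hux⟩⟩, Geodesic.mem_endpoints.2 ⟨hξ, h0⟩⟩

theorem proportional_of_line_eq {u k : Geodesic} {x : ClosedDisc} (hx : x ∈ disc) (hux : u.ev x = 0)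
    (e : u.line = k.line) : ∃ c : ℝ, c ≠ 0 ∧ ∀ z, k.ev z = c * u.ev z := by
  obtain ⟨b, -, -, -, hb, -, hne, hub, -⟩ := u.exists_near hx hux univ_mem
  have m1 : x ∈ k.line := e ▸ Geodesic.mem_line.2 ⟨hx, hux⟩
  have m2 : b ∈ k.line := e ▸ Geodesic.mem_line.2 ⟨hb, hub⟩
  exact Geodesic.proportional hne hub hux (Geodesic.mem_line.1 m2).2 (Geodesic.mem_line.1 m1).2

theorem finite_partitionPoints (E : EvenTiling Γ R h) : (partitionPoints Γ R).Finite := by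
  have hfin : ∀ l ∈ wallLines Γ R, {ξ | ξ ∈ circleAtInfinity ∧ ∃ u, IsWall Γ R u ∧
      (∃ x ∈ R, u.ev x = 0) ∧ l = u.line ∧ u.ev ξ = 0}.Finite := by
    rintro _ ⟨u, hu, ⟨x, hx, hux⟩, rfl⟩
    refine u.finite_endpoints.subset ?_
    rintro ξ ⟨hξ, k, -, ⟨y, hy, hky⟩, e, h0⟩
    obtain ⟨c, hc, e'⟩ := proportional_of_line_eq (E.subset_disc hx) hux e
    rw [e', mul_eq_zero, or_iff_right hc] at h0
    exact Geodesic.mem_endpoints.2 ⟨hξ, h0⟩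
  refine (E.finite_wallLines.biUnion hfin).subset fun ξ hξ => ?_
  obtain ⟨hξc, u, hu, hx, h0⟩ := E.mem_partitionPoints.1 hξ
  exact mem_biUnion (show u.line ∈ wallLines Γ R from ⟨u, hu, hx, rfl⟩) ⟨hξc, u, hu, hx, rfl, h0⟩

/-! ### Labels -/

/-- The side of `R` with index `i`. -/
def sideSet (R : Set ClosedDisc) (h : ι → Geodesic) (i : ι) : Set ClosedDisc := R ∩ (h i).line

theorem mem_sideSet (S : SideSystem R h) {i : ι} {z : ClosedDisc} :
    z ∈ sideSet R h i ↔ z ∈ R ∧ (h i).ev z = 0 := by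
  rw [sideSet, mem_inter_iff, Geodesic.mem_line]
  exact ⟨fun H => ⟨H.1, H.2.2⟩, fun H => ⟨H.1, S.subset_disc H.1, H.2⟩⟩

/-- Two tiles on the same side of a common segment of their boundaries are equal. -/
theorem eq_of_overlap (E : EvenTiling Γ R h) {g g' : Equiv.Perm ClosedDisc} (hg : g ∈ Γ)
    (hg' : g' ∈ Γ) {j j' : ι} {u : Geodesic} (H : IsImage g (h j) u) (H' : IsImage g' (h j') u)
    {x x' : ClosedDisc} (hne : x ≠ x') (hx : g⁻¹ x ∈ R) (hx' : g⁻¹ x' ∈ R) (hy : g'⁻¹ x ∈ R)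
    (hy' : g'⁻¹ x' ∈ R) (h0 : u.ev x = 0) (h0' : u.ev x' = 0) : g = g' := by
  have hxd : x ∈ disc := (E.mem_disc_iff (Γ.inv_mem hg)).1 (E.subset_disc hx)
  obtain ⟨m, hm, hmd, -⟩ := exists_mix x x' (t := 1 / 2) (by norm_num) (by norm_num)
  have hmd := hmd (by norm_num) hxd
  have em (k : Geodesic) : k.ev m = (1 - 1 / 2) * k.ev x + 1 / 2 * k.ev x' := hm _ _
  -- Close to the midpoint of the common segment, the positive side of `u` lies in the interior of
  -- either tile, so the two interiors intersect.
  have key : ∀ {f : Equiv.Perm ClosedDisc} {a : ι}, f ∈ Γ → IsImage f (h a) u → f⁻¹ x ∈ R →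
      f⁻¹ x' ∈ R → {z | 0 < u.ev z → f⁻¹ z ∈ interior R} ∈ 𝓝 m := by
    intro f a hf Hf fx fx'
    have hpos : ∀ l, l ≠ a → 0 < (h l).ev (f⁻¹ m) := by
      intro l hl
      obtain ⟨k, hk⟩ := E.exists_image hf (h l)
      have kx : 0 ≤ k.ev x := by
        have := hk.nonneg_iff.2 (E.ev_nonneg fx l)
        rwa [perm_apply_inv] at this
      have kx' : 0 ≤ k.ev x' := by
        have := hk.nonneg_iff.2 (E.ev_nonneg fx' l)
        rwa [perm_apply_inv] at this
      have hne' : f⁻¹ x ≠ f⁻¹ x' := fun e => hne (f⁻¹.injective e)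
      have hkm : 0 < k.ev m := by
        rw [em]
        by_contra! hcon
        have z1 : k.ev x = 0 := by linarith
        have z2 : k.ev x' = 0 := by linarith
        rw [← perm_apply_inv f x] at z1 h0
        rw [← perm_apply_inv f x'] at z2 h0'
        exact hl (E.eq_of_two_points hne' (hk.zero_iff.1 z1) (hk.zero_iff.1 z2)
          (Hf.zero_iff.1 h0) (Hf.zero_iff.1 h0'))
      rw [← perm_apply_inv f m] at hkm
      exact hk.pos_iff.1 hkm
    have hV := SideSystem.pos_mem_nhds (h := h) (p := fun l => l ≠ a)
      ((E.mem_disc_iff (Γ.inv_mem hf)).2 hmd) hpos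
    filter_upwards [(E.mobius _ (Γ.inv_mem hf)).continuous.continuousAt.preimage_mem_nhds hV]
      with z hz huz
    refine E.mem_interior hz.1 fun l => ?_
    by_cases hl : l = a
    · rw [hl]
      rw [← perm_apply_inv f z] at huz
      exact Hf.pos_iff.1 huz
    · exact hz.2 l hl
  obtain ⟨z, ⟨hz1, hz2⟩, -, hz⟩ := u.exists_pos_near hmd (by rw [em, h0, h0']; ring)
    (inter_mem (key hg H hx hx') (key hg' H' hy hy'))
  have h1 := E.eq_one (Γ.mul_mem (Γ.inv_mem hg') hg) (hz1 hz)
    (by rw [Equiv.Perm.mul_apply, perm_apply_inv]; exact hz2 hz)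
  rw [inv_mul_eq_one] at h1
  exact h1.symm

/-- `e` is the exterior label of the side `i`, which it pulls back to the side `j`. -/
structure IsLabel (Γ : Subgroup (Equiv.Perm ClosedDisc)) (R : Set ClosedDisc) (h : ι → Geodesic)
    (e : Equiv.Perm ClosedDisc) (i j : ι) : Prop where
  mem : e ∈ Γ
  mem_iff : ∀ z, (e z ∈ R ∧ (h i).ev (e z) = 0) ↔ z ∈ R ∧ (h j).ev z = 0
  inter : ∀ z ∈ R, e z ∈ R → (h j).ev z = 0
  image : IsImage e (h j) (h i).neg

theorem exists_two_points (S : SideSystem R h) (i : ι) :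
    ∃ x ∈ R, ∃ x' ∈ R, x ≠ x' ∧ (h i).ev x = 0 ∧ (h i).ev x' = 0 := by
  obtain ⟨y, hy, h0, hj⟩ := S.exists_mid i
  obtain ⟨b, hb, -, -, hne, hb0, -⟩ := S.exists_segment hy h0 hj
  exact ⟨b, hb, y, S.mem_of_mid hy h0 hj, hne, hb0, h0⟩

theorem exists_isLabel (E : EvenTiling Γ R h) {e : Equiv.Perm ClosedDisc} {i : ι}
    (H : IsExteriorLabel Γ R (sideSet R h i) e) : ∃ j, IsLabel Γ R h e i j := by
  obtain ⟨heΓ, hside, hint⟩ := H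
  have heΓ : e ∈ Γ := by simpa using heΓ
  obtain ⟨j, hj⟩ := E.isSide_iff.1 hside
  change _ = sideSet R h j at hj
  have hmem (z) : (e z ∈ R ∧ (h i).ev (e z) = 0) ↔ z ∈ R ∧ (h j).ev z = 0 := by
    rw [← mem_sideSet E.toSideSystem, ← mem_sideSet E.toSideSystem, ← hj]
    constructor
    · intro hz; exact ⟨_, hz, perm_inv_apply e z⟩
    · rintro ⟨w, hw, rfl⟩; rwa [perm_apply_inv]
  have hinter (z) (hz : z ∈ R) (hez : e z ∈ R) : (h j).ev z = 0 := by
    have : z ∈ sideSet R h j := by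
      rw [← hj, ← hint]
      exact ⟨hz, _, hez, perm_inv_apply e z⟩
    exact ((mem_sideSet E.toSideSystem).1 this).2
  refine ⟨j, heΓ, hmem, hinter, ?_⟩
  obtain ⟨k, hk⟩ := E.exists_image heΓ (h j)
  obtain ⟨x, hx, x', hx', hne, x0, x0'⟩ := exists_two_points E.toSideSystem j
  have ex := (hmem x).2 ⟨hx, x0⟩
  have ex' := (hmem x').2 ⟨hx', x0'⟩
  have hne' : e x ≠ e x' := fun he => hne (e.injective he)
  obtain ⟨c, hc, hce⟩ := Geodesic.proportional hne' (hk.zero_iff.2 x0) (hk.zero_iff.2 x0')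
    ex.2 ex'.2
  -- If the label preserved the orientation, the tile and R would lie on the same side of their
  -- common segment and coincide. Then R would be contained in its own side.
  rcases lt_or_gt_of_ne hc with hc | hc
  · intro z
    obtain ⟨d, hd, hde⟩ := hk z
    refine ⟨-c * d, mul_pos (neg_pos.2 hc) hd, ?_⟩
    rw [Geodesic.ev_neg, hce, hde]; ring
  · exfalso
    have him : IsImage e (h j) (h i) := by
      intro z
      obtain ⟨d, hd, hde⟩ := hk z
      exact ⟨c * d, mul_pos hc hd, by rw [hce, hde]; ring⟩
    have h1 : IsImage 1 (h i) (h i) := fun z => ⟨1, one_pos, by simp⟩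
    have := E.eq_of_overlap Γ.one_mem heΓ h1 him hne' (by simpa using ex.1) (by simpa using ex'.1)
      (by rw [perm_inv_apply]; exact hx) (by rw [perm_inv_apply]; exact hx') ex.2 ex'.2
    obtain ⟨o, ho, hpos⟩ := E.exists_interior
    have hoR := E.mem_of_pos ho hpos
    have := hinter o hoR (by rw [← this]; exact hoR)
    exact (hpos j).ne' this

/-- Both tiles lie across the same side of R, so `eq_of_overlap` applies. -/
theorem IsLabel.unique (E : EvenTiling Γ R h) {e e' : Equiv.Perm ClosedDisc} {i j j' : ι}
    (H : IsLabel Γ R h e i j) (H' : IsLabel Γ R h e' i j') : e = e' := by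
  obtain ⟨x, hx, x', hx', hne, x0, x0'⟩ := exists_two_points E.toSideSystem i
  have pull {f : Equiv.Perm ClosedDisc} {l : ι} (F : IsLabel Γ R h f i l) {y : ClosedDisc}
      (hy : y ∈ R) (y0 : (h i).ev y = 0) : f⁻¹ y ∈ R :=
    ((F.mem_iff (f⁻¹ y)).1 (by rw [perm_apply_inv]; exact ⟨hy, y0⟩)).1
  exact E.eq_of_overlap H.mem H'.mem H.image H'.image hne (pull H hx x0) (pull H hx' x0')
    (pull H' hx x0) (pull H' hx' x0') (by simp [x0]) (by simp [x0'])

theorem IsLabel.symm {e : Equiv.Perm ClosedDisc} {i j : ι}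
    (H : IsLabel Γ R h e i j) : IsLabel Γ R h e⁻¹ j i where
  mem := Γ.inv_mem H.mem
  mem_iff z := by
    rw [← H.mem_iff, perm_apply_inv]
  inter z hz hez := by
    have := H.inter _ hez (by rw [perm_apply_inv]; exact hz)
    have := (H.mem_iff (e⁻¹ z)).2 ⟨hez, this⟩
    rw [perm_apply_inv] at this
    exact this.2
  image := by
    have := H.image.symm.neg
    intro z
    obtain ⟨c, hc, e⟩ := this z
    exact ⟨c, hc, by simpa using e⟩

theorem IsLabel.eq_sides (E : EvenTiling Γ R h) {e : Equiv.Perm ClosedDisc} {i i' j j' : ι}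
    (H : IsLabel Γ R h e i j) (H' : IsLabel Γ R h e i' j') : i = i' ∧ j = j' := by
  have hj : j = j' := by
    obtain ⟨x, hx, x', hx', hne, x0, x0'⟩ := exists_two_points E.toSideSystem j
    exact E.eq_of_two_points hne x0 x0' (H'.inter x hx ((H.mem_iff x).2 ⟨hx, x0⟩).1)
      (H'.inter x' hx' ((H.mem_iff x').2 ⟨hx', x0'⟩).1)
  subst hj
  refine ⟨E.eq_of_zero_imp fun z _ hz => le_of_eq ?_, rfl⟩
  rw [← perm_apply_inv e z] at hz ⊢
  have h1 := H.image.zero_iff.1 (by rw [Geodesic.ev_neg, hz, neg_zero])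
  have h2 := H'.image.zero_iff.2 h1
  rwa [Geodesic.ev_neg, neg_eq_zero] at h2

theorem isExteriorLabel (E : EvenTiling Γ R h) {e : Equiv.Perm ClosedDisc} {i j : ι}
    (H : IsLabel Γ R h e i j) : IsExteriorLabel Γ R (sideSet R h i) e := by
  have him : ⇑(e⁻¹) '' sideSet R h i = sideSet R h j := by
    ext z
    rw [mem_sideSet E.toSideSystem, ← H.mem_iff]
    constructor
    · rintro ⟨w, hw, rfl⟩
      rw [perm_apply_inv]; exact (mem_sideSet E.toSideSystem).1 hw
    · intro hz
      exact ⟨e z, (mem_sideSet E.toSideSystem).2 hz, perm_inv_apply e z⟩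
  refine ⟨Γ.inv_mem H.mem, ?_, ?_⟩
  · rw [him]; exact E.isSide j
  · rw [him]
    ext z
    rw [mem_sideSet E.toSideSystem]
    constructor
    · rintro ⟨hz, w, hw, rfl⟩
      exact ⟨hz, H.inter _ hz (by rw [perm_apply_inv]; exact hw)⟩
    · rintro ⟨hz, h0⟩
      exact ⟨hz, e z, ((H.mem_iff z).2 ⟨hz, h0⟩).1, perm_inv_apply e z⟩

/-- The exterior labels of the sides, and the pairing of the sides. -/
structure Labelling (Γ : Subgroup (Equiv.Perm ClosedDisc)) (R : Set ClosedDisc) (h : ι → Geodesic)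
    (lab : ι → Equiv.Perm ClosedDisc) (star : ι → ι) : Prop where
  isLabel : ∀ i, IsLabel Γ R h (lab i) i (star i)
  star_star : ∀ i, star (star i) = i

theorem exists_labelling (E : EvenTiling Γ R h) : ∃ lab star, Labelling Γ R h lab star := by
  have : ∀ i, ∃ e j, IsLabel Γ R h e i j := by
    intro i
    obtain ⟨e, he⟩ := E.paired _ (E.isSide i)
    exact ⟨e⁻¹, E.exists_isLabel (by rw [IsExteriorLabel, inv_inv]; exact he)⟩
  choose lab star H using this
  refine ⟨lab, star, H, fun i => ?_⟩
  have h1 := (H i).symm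
  have h2 := H (star i)
  have e := h1.unique E h2
  rw [← e] at h2
  exact (h2.eq_sides E h1).2

end EvenTiling

/-! ### Nonnegative matrices -/

theorem IrreducibleMatrix.of_transGen {ι : Type*} [Fintype ι] {A : Matrix ι ι ℝ}
    (h0 : ∀ i j, 0 ≤ A i j) (h : ∀ i j, Relation.TransGen (fun i j => 0 < A i j) i j) :
    IrreducibleMatrix A := by
  classical
  refine ⟨h0, ?_⟩
  have hpow : ∀ k : ℕ, ∀ i j, 0 ≤ (A ^ k) i j := by
    intro k
    induction k with
    | zero => intro i j; rw [pow_zero, Matrix.one_apply]; split_ifs <;> norm_num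
    | succ k ih =>
      intro i j
      rw [pow_succ, Matrix.mul_apply]
      exact Finset.sum_nonneg fun l _ => mul_nonneg (ih i l) (h0 l j)
  have hex : ∀ i j, ∃ k : ℕ, 1 ≤ k ∧ 0 < (A ^ k) i j := by
    intro i j
    induction h i j with
    | single hij => exact ⟨1, le_rfl, by rwa [pow_one]⟩
    | @tail b c _ hbc ih =>
      obtain ⟨k, -, hk⟩ := ih
      refine ⟨k + 1, by omega, ?_⟩
      rw [pow_succ, Matrix.mul_apply]
      exact Finset.sum_pos' (fun l _ => mul_nonneg (hpow k i l) (h0 l c))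
        ⟨b, Finset.mem_univ b, mul_pos hk hbc⟩
  choose k hk1 hk using hex
  -- The sum of all path lengths bounds each of them, and as all powers have nonnegative entries,
  -- one positive term suffices.
  refine ⟨1 + ∑ i, ∑ j, k i j, by omega, fun i j => ?_⟩
  have hle : k i j ≤ 1 + ∑ i, ∑ j, k i j := by
    have h1 := Finset.single_le_sum (f := fun j => k i j) (fun _ _ => Nat.zero_le _)
      (Finset.mem_univ j)
    have h2 := Finset.single_le_sum (f := fun i => ∑ j, k i j) (fun _ _ => Nat.zero_le _)
      (Finset.mem_univ i)
    exact (h1.trans h2).trans (Nat.le_add_left _ _)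
  rw [Matrix.sum_apply]
  exact Finset.sum_pos' (fun l _ => hpow l i j) ⟨k i j, Finset.mem_Icc.2 ⟨hk1 i j, hle⟩, hk i j⟩

/-! ### Graphs of degree at most two without triangles -/

/-- The properties of the adjacency of the sides of a polygon with at least five sides. -/
structure IsPolygonGraph {ι : Type} (adj : ι → ι → Prop) : Prop where
  irrefl : ∀ i, ¬ adj i i
  symm : ∀ {i j}, adj i j → adj j i
  not_three : ∀ {i a b c}, adj i a → adj i b → adj i c → a ≠ b → b ≠ c → a ≠ c → False
  not_triangle : ∀ {i j k}, adj i j → adj j k → adj i k → False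
  five_le : 5 ≤ Nat.card ι

namespace IsPolygonGraph

variable {ι : Type} {adj : ι → ι → Prop} [Fintype ι]

/-- `j` is equal or adjacent to `i`. -/
def Near (adj : ι → ι → Prop) (i j : ι) : Prop := j = i ∨ adj i j

theorem near_symm (G : IsPolygonGraph adj) {i j : ι} (H : Near adj i j) : Near adj j i :=
  H.imp Eq.symm G.symm

open Classical in
theorem card_near (G : IsPolygonGraph adj) (i : ι) :
    (Finset.univ.filter (Near adj i)).card ≤ 3 := by
  have h2 : (Finset.univ.filter (adj i)).card ≤ 2 := by
    by_contra! hcon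
    obtain ⟨a, ha, b, hb, c, hc, hab, hac, hbc⟩ := Finset.two_lt_card.1 hcon
    simp only [Finset.mem_filter, Finset.mem_univ, true_and] at ha hb hc
    exact G.not_three ha hb hc hab hbc hac
  have hsub : Finset.univ.filter (Near adj i) ⊆ insert i (Finset.univ.filter (adj i)) := by
    intro j hj
    simpa [Near] using hj
  exact (Finset.card_le_card hsub).trans ((Finset.card_insert_le _ _).trans (by omega))

/-- If `q` and `q'` are adjacent, one of the three lies outside `{q, q'}` and closes a triangle;
otherwise all three are neighbours of `q`. -/
theorem near_three (G : IsPolygonGraph adj) {a b c q q' : ι} (hab : a ≠ b) (hbc : b ≠ c)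
    (hac : a ≠ c) (hq : q ≠ q') (h1 : Near adj q a) (h2 : Near adj q b) (h3 : Near adj q c)
    (h1' : Near adj q' a) (h2' : Near adj q' b) (h3' : Near adj q' c) : False := by
  by_cases hqq : adj q q'
  · have tri (x : ι) (x1 : x ≠ q) (x2 : x ≠ q') (n1 : Near adj q x) (n2 : Near adj q' x) : False :=
      G.not_triangle hqq (n2.resolve_left x2) (n1.resolve_left x1)
    by_cases ha : a ≠ q ∧ a ≠ q'
    · exact tri a ha.1 ha.2 h1 h1'
    by_cases hb : b ≠ q ∧ b ≠ q'
    · exact tri b hb.1 hb.2 h2 h2'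
    refine tri c ?_ ?_ h3 h3' <;> rintro rfl <;> grind
  · have adj_of (x : ι) (n1 : Near adj q x) (n2 : Near adj q' x) : adj q x := by
      refine n1.resolve_left ?_
      rintro rfl
      exact hqq (G.symm (n2.resolve_left hq))
    exact G.not_three (adj_of a h1 h1') (adj_of b h2 h2') (adj_of c h3 h3') hab hbc hac

/-- Each set has at most three elements, and as soon as one has three the other has at most one, by
`near_three`. The extreme cases are 2 + 2 and 1 + 3. -/
theorem card_add_card_le (G : IsPolygonGraph adj) {T Q : Finset ι} (hT : T.Nonempty)
    (hQ : Q.Nonempty) (H : ∀ t ∈ T, ∀ q ∈ Q, Near adj t q) : T.card + Q.card ≤ 4 := by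
  classical
  have le3 : ∀ {A B : Finset ι}, A.Nonempty → (∀ t ∈ A, ∀ q ∈ B, Near adj t q) → B.card ≤ 3 := by
    rintro A B ⟨t, ht⟩ H
    refine (Finset.card_le_card fun q hq => ?_).trans (G.card_near t)
    simpa using H t ht q hq
  have le1 : ∀ {A B : Finset ι}, (∀ t ∈ A, ∀ q ∈ B, Near adj t q) → 2 < B.card → A.card ≤ 1 := by
    intro A B H hB
    by_contra! hcon
    obtain ⟨q, hq, q', hq', hne⟩ := Finset.one_lt_card.1 hcon
    obtain ⟨a, ha, b, hb, c, hc, hab, hac, hbc⟩ := Finset.two_lt_card.1 hB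
    exact G.near_three hab hbc hac hne (H q hq a ha) (H q hq b hb) (H q hq c hc) (H q' hq' a ha)
      (H q' hq' b hb) (H q' hq' c hc)
  have H' : ∀ t ∈ Q, ∀ q ∈ T, Near adj t q := fun t ht q hq => G.near_symm (H q hq t ht)
  have a1 := le3 hT H
  have a2 := le3 hQ H'
  have b1 : 2 < Q.card → T.card ≤ 1 := le1 H
  have b2 : 2 < T.card → Q.card ≤ 1 := le1 H'
  omega

theorem five_le_card (G : IsPolygonGraph adj) : 5 ≤ Fintype.card ι := by
  rw [← Nat.card_eq_fintype_card]; exact G.five_le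

open Classical in
theorem two_le_card_not_near (G : IsPolygonGraph adj) (i : ι) :
    2 ≤ (Finset.univ.filter fun j => ¬ Near adj i j).card := by
  have h1 := Finset.card_filter_add_card_filter_not (s := Finset.univ) (Near adj i)
  have h2 := G.card_near i
  have h3 := G.five_le_card
  rw [Finset.card_univ] at h1
  omega

theorem exists_not_near (G : IsPolygonGraph adj) (i : ι) : ∃ j, ¬ Near adj i j := by
  classical
  have := G.two_le_card_not_near i
  obtain ⟨j, hj⟩ := Finset.card_pos.1 (by omega : 0 < (Finset.univ.filter fun j => ¬ Near adj i j).card)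
  exact ⟨j, by simpa using hj⟩

/-- Some side is adjacent to neither of two adjacent sides. -/
theorem exists_not_near_two (G : IsPolygonGraph adj) {a b : ι} (hab : Near adj a b) :
    ∃ l, ¬ Near adj a l ∧ ¬ Near adj b l := by
  classical
  rcases hab with rfl | hab
  · obtain ⟨l, hl⟩ := G.exists_not_near b
    exact ⟨l, hl, hl⟩
  · by_contra! hcon
    have hsub : (Finset.univ : Finset ι) ⊆ Finset.univ.filter (Near adj a) ∪
        (Finset.univ.filter (Near adj b)).erase a := by
      intro l _
      by_cases hl : Near adj a l
      -- The two closed neighbourhoods have at most three elements each and share `a` and `b`, so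
      -- their union has at most four and misses a vertex.
      · simp [hl]
      · have hla : l ≠ a := fun h => hl (Or.inl h)
        simp [hl, hcon l hl, hla]
    have hab' : Near adj b a := Or.inr (G.symm hab)
    have h1 := G.card_near a
    have h2 : ((Finset.univ.filter (Near adj b)).erase a).card ≤ 2 := by
      rw [Finset.card_erase_of_mem (by simpa using hab')]
      have := G.card_near b
      omega
    have h3 : b ∈ Finset.univ.filter (Near adj a) := by simp [Near, hab]
    have h4 : (Finset.univ.filter (Near adj a) ∪
        (Finset.univ.filter (Near adj b)).erase a).card ≤ 4 := by
      have hb : b ∈ (Finset.univ.filter (Near adj b)).erase a := by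
        have hne : b ≠ a := by rintro rfl; exact G.irrefl b hab
        simp [Near, hne]
      have h5 := Finset.card_union_add_card_inter (Finset.univ.filter (Near adj a))
        ((Finset.univ.filter (Near adj b)).erase a)
      have h6 : 0 < (Finset.univ.filter (Near adj a) ∩
        (Finset.univ.filter (Near adj b)).erase a).card := Finset.card_pos.2 ⟨b,
          Finset.mem_inter.2 ⟨h3, hb⟩⟩
      omega
    have h5 := Finset.card_le_card hsub
    rw [Finset.card_univ] at h5
    have := G.five_le_card
    omega

/-- Some side which is not adjacent to `i` has at most one common neighbour with `i`. -/
theorem exists_few_common (G : IsPolygonGraph adj) (i : ι) :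
    ∃ m, ¬ Near adj i m ∧ ∀ k k', adj i k → adj m k → adj i k' → adj m k' → k = k' := by
  classical
  by_contra! hcon
  obtain ⟨m, hm, m', hm', hne⟩ := Finset.one_lt_card.1 (G.two_le_card_not_near i)
  simp only [Finset.mem_filter, Finset.mem_univ, true_and] at hm hm'
  obtain ⟨k, k', h1, h2, h3, h4, hk⟩ := hcon m hm
  obtain ⟨l, l', g1, g2, g3, g4, hl⟩ := hcon m' hm'
  have him : i ≠ m := fun h => hm (Or.inl h.symm)
  have him' : i ≠ m' := fun h => hm' (Or.inl h.symm)
  -- The at most two neighbours of `i` would be common to `i`, `m` and `m'`, so `k` would have three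
  -- neighbours.
  have key : adj m' k := by
    by_cases e1 : k = l
    · rwa [e1]
    by_cases e2 : k = l'
    · rwa [e2]
    exact (G.not_three h1 g1 g3 e1 hl e2).elim
  exact G.not_three (G.symm h1) (G.symm h2) (G.symm key) him hne him'

/-- The graph on the sides which describes the transitions between the large intervals is
strongly connected. -/
theorem transGen_not_near (G : IsPolygonGraph adj) {star : ι → ι} (hs : ∀ i, star (star i) = i)
    (i k : ι) : Relation.TransGen (fun a b => ¬ Near adj (star a) b) i k := by
  classical
  by_contra hk
  set r := fun a b => ¬ Near adj (star a) b
  set S := Finset.univ.filter (Relation.TransGen r i)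
  have hmem {j} : j ∈ S ↔ Relation.TransGen r i j := by simp [S]
  obtain ⟨j, hj⟩ := G.exists_not_near (star i)
  have hS : (S.image star).Nonempty := ⟨star j, Finset.mem_image_of_mem _ (hmem.2 (.single hj))⟩
  have hQ : Sᶜ.Nonempty := ⟨k, by rw [Finset.mem_compl, hmem]; exact hk⟩
  -- No edge leaves the reachable set, so each partner of a reachable side is near each unreachable
  -- side, and the two sets would have at most four elements in all.
  have hle := G.card_add_card_le hS hQ (by
    intro t ht q hq
    obtain ⟨s, hs', rfl⟩ := Finset.mem_image.1 ht
    by_contra hc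
    exact Finset.mem_compl.1 hq (hmem.2 ((hmem.1 hs').tail hc)))
  rw [Finset.card_image_of_injective _ (Function.LeftInverse.injective hs),
    Finset.card_add_card_compl] at hle
  have := G.five_le_card
  omega

/-- At least two sides are not near `star a`. If none of them is a common successor of `a` with a
member of `Q`, then `Q` has at most two elements. Applied to a class and to its complement, this
allows only four sides. -/
theorem transGen_common (G : IsPolygonGraph adj) {star : ι → ι} (hs : ∀ i, star (star i) = i)
    (i k : ι) : Relation.TransGen
      (fun a b => ∃ c, ¬ Near adj (star a) c ∧ ¬ Near adj (star b) c) i k := by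
  classical
  by_contra hk
  set r := fun a b => ∃ c, ¬ Near adj (star a) c ∧ ¬ Near adj (star b) c
  set S := Finset.univ.filter (Relation.TransGen r i)
  have hmem {j} : j ∈ S ↔ Relation.TransGen r i j := by simp [S]
  have hinj : Function.Injective star := Function.LeftInverse.injective hs
  have hiS : i ∈ S := by
    obtain ⟨j, hj⟩ := G.exists_not_near (star i)
    exact hmem.2 (.single ⟨j, hj, hj⟩)
  have hkS : k ∈ Sᶜ := by rw [Finset.mem_compl, hmem]; exact hk
  have hr : ∀ a ∈ S, ∀ b ∈ Sᶜ, ¬ r a b := fun a ha b hb hab =>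
    Finset.mem_compl.1 hb (hmem.2 ((hmem.1 ha).tail hab))
  have aux : ∀ {Q : Finset ι} (a : ι), Q.Nonempty → (∀ b ∈ Q, ¬ r a b) → Q.card ≤ 2 := by
    intro Q a hQ H
    have h2 := G.two_le_card_not_near (star a)
    have := G.card_add_card_le (T := Finset.univ.filter fun j => ¬ Near adj (star a) j)
      (Finset.card_pos.1 (by omega)) (hQ.image star) (by
        intro t ht q hq
        obtain ⟨b, hb, rfl⟩ := Finset.mem_image.1 hq
        by_contra hc
        exact H b hb ⟨t, by simpa using ht, fun hn => hc (G.near_symm hn)⟩)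
    rw [Finset.card_image_of_injective _ hinj] at this
    omega
  have h1 := aux i ⟨k, hkS⟩ (hr i hiS)
  have h2 := aux k ⟨i, hiS⟩ fun b hb hkb => hr b hb k hkS (hkb.imp fun _ hc => hc.symm)
  have h3 := Finset.card_add_card_compl S
  have := G.five_le_card
  omega

end IsPolygonGraph

namespace EvenTiling

variable {Γ : Subgroup (Equiv.Perm ClosedDisc)} {R : Set ClosedDisc} {ι : Type} [Finite ι]
  {h : ι → Geodesic} {lab : ι → Equiv.Perm ClosedDisc} {star : ι → ι}

/-! ### Intervals -/

/-- The walls which meet `R`, if only in a vertex. -/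
def Meets (Γ : Subgroup (Equiv.Perm ClosedDisc)) (R : Set ClosedDisc) (u : Geodesic) : Prop :=
  IsWall Γ R u ∧ ∃ x ∈ R, u.ev x = 0

theorem Meets.neg {u : Geodesic} (hu : Meets Γ R u) : Meets Γ R u.neg :=
  ⟨isWall_neg hu.1, hu.2.imp fun _ hx => ⟨hx.1, by simp [hx.2]⟩⟩

theorem meets_side (E : EvenTiling Γ R h) (i : ι) : Meets Γ R (h i) := by
  obtain ⟨y, hy, h0, hj⟩ := E.exists_mid i
  exact ⟨E.isWall_side i, y, E.mem_of_mid hy h0 hj, h0⟩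

theorem interval_subset {I : Set ClosedDisc} (hI : I ∈ intervals Γ R) :
    I ⊆ circleAtInfinity \ partitionPoints Γ R := by
  obtain ⟨ξ, -, rfl⟩ := hI
  exact connectedComponentIn_subset _ _

theorem interval_nonempty {I : Set ClosedDisc} (hI : I ∈ intervals Γ R) : I.Nonempty := by
  obtain ⟨ξ, hξ, rfl⟩ := hI
  exact ⟨ξ, mem_connectedComponentIn hξ⟩

theorem interval_preconnected {I : Set ClosedDisc} (hI : I ∈ intervals Γ R) : IsPreconnected I := by
  obtain ⟨ξ, -, rfl⟩ := hI
  exact isPreconnected_connectedComponentIn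

theorem subset_interval {I C : Set ClosedDisc} (hI : I ∈ intervals Γ R) (hC : IsPreconnected C)
    (hCP : C ⊆ circleAtInfinity \ partitionPoints Γ R) {x : ClosedDisc} (hxC : x ∈ C)
    (hxI : x ∈ I) : C ⊆ I := by
  obtain ⟨ξ, -, rfl⟩ := hI
  rw [connectedComponentIn_eq hxI]
  exact hC.subset_connectedComponentIn hxC hCP

theorem interval_eq {I I' : Set ClosedDisc} (hI : I ∈ intervals Γ R) (hI' : I' ∈ intervals Γ R)
    {x : ClosedDisc} (hx : x ∈ I) (hx' : x ∈ I') : I = I' :=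
  (subset_interval hI' (interval_preconnected hI) (interval_subset hI) hx hx').antisymm
    (subset_interval hI (interval_preconnected hI') (interval_subset hI') hx' hx)

theorem exists_interval {ξ : ClosedDisc} (hξ : ξ ∈ circleAtInfinity \ partitionPoints Γ R) :
    ∃ I ∈ intervals Γ R, ξ ∈ I :=
  ⟨_, ⟨ξ, hξ, rfl⟩, mem_connectedComponentIn hξ⟩

theorem interval_ne_zero (E : EvenTiling Γ R h) {I : Set ClosedDisc} (hI : I ∈ intervals Γ R)
    {u : Geodesic} (hu : Meets Γ R u) {ξ : ClosedDisc} (hξ : ξ ∈ I) : u.ev ξ ≠ 0 := fun h0 =>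
  (interval_subset hI hξ).2 (E.mem_partitionPoints.2 ⟨(interval_subset hI hξ).1, u, hu.1, hu.2, h0⟩)

theorem interval_neg (E : EvenTiling Γ R h) {I : Set ClosedDisc} (hI : I ∈ intervals Γ R)
    {u : Geodesic} (hu : Meets Γ R u) {ξ η : ClosedDisc} (hξ : ξ ∈ I) (h0 : u.ev ξ < 0)
    (hη : η ∈ I) : u.ev η < 0 := by
  by_contra! hcon
  obtain ⟨ζ, hζ, hζ0⟩ := (interval_preconnected hI).intermediate_value hξ hη
    u.continuous_ev.continuousOn ⟨h0.le, hcon⟩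
  exact E.interval_ne_zero hI hu hζ hζ0

theorem interval_pos (E : EvenTiling Γ R h) {I : Set ClosedDisc} (hI : I ∈ intervals Γ R)
    {u : Geodesic} (hu : Meets Γ R u) {ξ η : ClosedDisc} (hξ : ξ ∈ I) (h0 : 0 < u.ev ξ)
    (hη : η ∈ I) : 0 < u.ev η := by
  have := E.interval_neg hI hu.neg hξ (by simpa using h0) hη
  simpa using this

/-! ### The action of the labels -/

namespace Labelling

theorem neg_iff (L : Labelling Γ R h lab star) {i : ι} {z : ClosedDisc} :
    (h i).ev (lab i z) < 0 ↔ 0 < (h (star i)).ev z := by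
  rw [← (L.isLabel i).image.pos_iff, Geodesic.ev_neg, neg_pos]

theorem mem_circle_iff (E : EvenTiling Γ R h) (L : Labelling Γ R h lab star) {i : ι}
    {z : ClosedDisc} : lab i z ∈ circleAtInfinity ↔ z ∈ circleAtInfinity :=
  (E.mobius _ (L.isLabel i).mem).mem_circle_iff

theorem continuous (E : EvenTiling Γ R h) (L : Labelling Γ R h lab star) (i : ι) :
    Continuous (lab i) := (E.mobius _ (L.isLabel i).mem).continuous

end Labelling

/-- On its way from `ξ` back to R the wall crosses the geodesic of `i`, and the crossing lies in R.
So only walls through the side `i` subdivide the arc behind it. -/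
theorem cross_side (E : EvenTiling Γ R h) (hN : 4 ≤ Nat.card ι) {u : Geodesic} (hu : Meets Γ R u)
    {ξ : ClosedDisc} (h0 : u.ev ξ = 0) {i : ι} (hi : (h i).ev ξ < 0) :
    ∃ y ∈ R, u.ev y = 0 ∧ (h i).ev y = 0 := by
  obtain ⟨x, hx, hux⟩ := hu.2
  obtain ⟨y, hyd, hy, s, -, -, hs⟩ := (h i).exists_cross hi (E.ev_nonneg hx i)
  have huy : u.ev y = 0 := by
    have : u.ev y = (1 - s) * u.ev ξ + s * u.ev x := hs _ _
    rw [this, h0, hux]; ring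
  obtain ⟨m, hm, m0, mj⟩ := E.exists_mid i
  exact ⟨y, E.mem_of_cross hN hu.1 (E.isWall_side i) hx hux (E.mem_of_mid hm m0 mj) m0
    (hyd (E.subset_disc hx)) huy hy ⟨ξ, h0, hi.ne⟩, huy, hy⟩

/-- A wall which meets the side `j` is moved by the label of the side `i` to a wall which meets
the side `i`. -/
theorem exists_push (E : EvenTiling Γ R h) {e : Equiv.Perm ClosedDisc} {i j : ι}
    (H : IsLabel Γ R h e i j) {t : Geodesic} (ht : IsWall Γ R t) {x : ClosedDisc} (hx : x ∈ R)
    (hjx : (h j).ev x = 0) (htx : t.ev x = 0) :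
    ∃ u, IsImage e t u ∧ Meets Γ R u ∧ e x ∈ R ∧ (h i).ev (e x) = 0 ∧ u.ev (e x) = 0 := by
  obtain ⟨u, hu⟩ := E.exists_image H.mem t
  have hex := (H.mem_iff x).2 ⟨hx, hjx⟩
  have hux := hu.zero_iff.2 htx
  exact ⟨u, hu, ⟨E.isWall_image H.mem hu ht, e x, hex.1, hux⟩, hex.1, hex.2, hux⟩

/-- A geodesic carries the side with index `i`. -/
def Carries (h : ι → Geodesic) (i : ι) (t : Geodesic) : Prop :=
  ∃ c : ℝ, c ≠ 0 ∧ ∀ z, t.ev z = c * (h i).ev z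

theorem Carries.pos (E : EvenTiling Γ R h) {i : ι} {t : Geodesic} (H : Carries h i t)
    (ht : ∀ z ∈ R, 0 ≤ t.ev z) : ∃ c : ℝ, 0 < c ∧ ∀ z, t.ev z = c * (h i).ev z := by
  obtain ⟨c, hc, e⟩ := H
  obtain ⟨o, ho, hpos⟩ := E.exists_interior
  have := ht o (E.mem_of_pos ho hpos)
  rw [e] at this
  exact ⟨c, lt_of_le_of_ne (nonneg_of_mul_nonneg_left this (hpos i)) hc.symm, e⟩

theorem exists_pos_on_side (E : EvenTiling Γ R h) {t : Geodesic} (ht : ∀ z ∈ R, 0 ≤ t.ev z) {j : ι}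
    (hne : ¬ Carries h j t) : ∃ z ∈ R, (h j).ev z = 0 ∧ 0 < t.ev z := by
  by_contra! hcon
  obtain ⟨x, hx, x', hx', hxx, x0, x0'⟩ := exists_two_points E.toSideSystem j
  exact hne (Geodesic.proportional hxx x0 x0' (le_antisymm (hcon x hx x0) (ht x hx))
    (le_antisymm (hcon x' hx' x0') (ht x' hx')))

/-- A label moves R off itself, but it maps the side `j` into R; a point of that side with `t`
positive fixes the orientation of the image. -/
theorem push_nonneg (E : EvenTiling Γ R h) {e : Equiv.Perm ClosedDisc} {i j : ι}
    (H : IsLabel Γ R h e i j) {t u : Geodesic} (hu : IsImage e t u) (huw : IsWall Γ R u)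
    (ht : ∀ z ∈ R, 0 ≤ t.ev z) (hne : ¬ Carries h j t) : ∀ z ∈ R, 0 ≤ u.ev z := by
  obtain ⟨z, hz, hz0, hpos⟩ := E.exists_pos_on_side ht hne
  exact fun w hw => E.wall_nonneg huw ((H.mem_iff z).2 ⟨hz, hz0⟩).1 (hu.pos_iff.2 hpos) hw

/-- This is the Markov property: a wall ending behind the side `i` passes through that side, so its
pullback meets R in the paired side and its endpoint pulls back to a partition point. -/
theorem lab_mem (E : EvenTiling Γ R h) (hN : 4 ≤ Nat.card ι) (L : Labelling Γ R h lab star) {i : ι}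
    {η : ClosedDisc} (hη : η ∈ circleAtInfinity \ partitionPoints Γ R)
    (hpos : 0 < (h (star i)).ev η) : lab i η ∈ circleAtInfinity \ partitionPoints Γ R := by
  refine ⟨(L.mem_circle_iff E).2 hη.1, fun hP => hη.2 ?_⟩
  obtain ⟨-, u, hu, hx, h0⟩ := E.mem_partitionPoints.1 hP
  obtain ⟨y, hy, huy, hiy⟩ := E.cross_side hN ⟨hu, hx⟩ h0 (L.neg_iff.2 hpos)
  obtain ⟨t, ht, htm, -⟩ := E.exists_push (L.isLabel i).symm hu hy hiy huy
  refine E.mem_partitionPoints.2 ⟨hη.1, t, htm.1, htm.2, ?_⟩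
  have := ht.zero_iff.2 h0
  rwa [perm_inv_apply] at this

/-- An interval outside the half plane of the side `star i` is moved by the label of `i` into
every interval which it meets. -/
theorem lab_image_subset (E : EvenTiling Γ R h) (hN : 4 ≤ Nat.card ι)
    (L : Labelling Γ R h lab star) {i : ι} {I J : Set ClosedDisc} (hI : I ∈ intervals Γ R)
    (hJ : J ∈ intervals Γ R) {η : ClosedDisc} (hηJ : η ∈ J) (hηI : lab i η ∈ I)
    (hpos : 0 < (h (star i)).ev η) : ∀ ζ ∈ J, lab i ζ ∈ I := by
  have hpre := (interval_preconnected hJ).image (lab i) (L.continuous E i).continuousOn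
  have := subset_interval hI hpre (by
    rintro _ ⟨ζ, hζ, rfl⟩
    exact E.lab_mem hN L (interval_subset hJ hζ) (E.interval_pos hJ (E.meets_side _) hηJ hpos hζ))
    ⟨η, hηJ, rfl⟩ hηI
  exact fun ζ hζ => this ⟨ζ, hζ, rfl⟩

/-! ### The large intervals -/

/-- The part of the circle at infinity outside the half planes of the side `j` and of the adjacent
sides. -/
def core (R : Set ClosedDisc) (h : ι → Geodesic) (j : ι) : Set ClosedDisc :=
  {ξ | ξ ∈ circleAtInfinity ∧ 0 < (h j).ev ξ ∧ ∀ k, Adj R h j k → 0 < (h k).ev ξ}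

/-- The wall carries the side `j` or passes through one of its vertices. In the latter case its
functional is a nonnegative combination of those of `j` and of the neighbour there, both positive on
the core. -/
theorem core_pos (E : EvenTiling Γ R h) {t : Geodesic} (ht : IsWall Γ R t)
    (htR : ∀ z ∈ R, 0 ≤ t.ev z) {x : ClosedDisc} (hx : x ∈ R) (htx : t.ev x = 0) {j : ι}
    (hjx : (h j).ev x = 0) {ξ : ClosedDisc} (hξ : ξ ∈ core R h j) : 0 < t.ev ξ := by
  rcases E.proportional_or_vertex ht hx htx hjx with hc | ⟨k, hjk, hkx⟩
  · obtain ⟨c, hc, e⟩ := Carries.pos E hc htR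
    rw [e]; exact mul_pos hc hξ.2.1
  · obtain ⟨a, b, ha, hb, e⟩ := E.exists_comb htR htx hjk.1 hjx hkx
    have p1 := hξ.2.1
    have p2 := hξ.2.2 k hjk
    rcases ha.eq_or_lt with rfl | ha
    · rcases hb.eq_or_lt with rfl | hb
      · obtain ⟨z, -, hz⟩ := t.exists_ev_ne_zero
        exact absurd (by rw [e]; ring) hz
      · rw [e, zero_mul, zero_add]; exact mul_pos hb p2
    · rw [e]
      exact add_pos_of_pos_of_nonneg (mul_pos ha p1) (mul_nonneg hb p2.le)

theorem isPreconnected_core (j : ι) : IsPreconnected (core R h j) := by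
  have := isPreconnected_cell (h j).neg (fun k : {k // Adj R h j k} => h k.1) (by
    rintro ⟨k, -, v, -, hj, hk⟩
    exact ⟨v, by simp [hj], hk⟩)
  convert this using 1
  ext ξ
  simp [core]

theorem isPolygonGraph (E : EvenTiling Γ R h) (hN : 5 ≤ Nat.card ι) : IsPolygonGraph (Adj R h) where
  irrefl _ H := H.1 rfl
  symm := Adj.symm
  not_three := not_three_adj E.toSideSystem
  not_triangle := E.not_triangle_adj (by omega)
  five_le := hN

theorem core_nonempty (E : EvenTiling Γ R h) (hN : 5 ≤ Nat.card ι) (j : ι) :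
    (core R h j).Nonempty := by
  cases nonempty_fintype ι
  obtain ⟨m, hm, hcommon⟩ := (E.isPolygonGraph hN).exists_few_common j
  have hmj : m ≠ j := fun e => hm (Or.inl e)
  have hadj : ¬ Adj R h j m := fun e => hm (Or.inr e)
  obtain ⟨y, hy, y0, yj⟩ := E.exists_mid m
  -- A side not strictly positive at a point behind `m` is `m` itself or adjacent to it. So the
  -- common neighbours of `j` and `m` are the only remaining obstruction.
  have finish (ξ : ClosedDisc) (hξ : ξ ∈ circleAtInfinity) (hmξ : (h m).ev ξ < 0)
      (hk : ∀ k, Adj R h j k → Adj R h m k → 0 < (h k).ev ξ) : (core R h j).Nonempty := by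
    refine ⟨ξ, hξ, ?_, fun k hjk => ?_⟩
    · by_contra! hcon
      exact hadj (E.adj_of_neg (by omega) hmj hmξ hcon).symm
    · by_contra! hcon
      have hmk : m ≠ k := by rintro rfl; exact hadj hjk
      exact absurd (hk k hjk (E.adj_of_neg (by omega) hmk hmξ hcon)) (not_lt.2 hcon)
  by_cases hex : ∃ k, Adj R h j k ∧ Adj R h m k
  · obtain ⟨k, hjk, hmk⟩ := hex
    obtain ⟨w, hw, w0, wj⟩ := E.exists_mid k
    have hmk' := hmk
    obtain ⟨hne, v, hv, vm, vk⟩ := hmk'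
    have hyw : y ≠ w := by
      rintro rfl
      exact (yj k hne.symm).ne' w0
    -- From the common vertex of `m` and `k`, the direction from the side `k` to the side `m` leads
    -- behind `m` while staying on the positive side of `k`.
    obtain ⟨t, ht, ξ, hξ, e⟩ := exists_exit (E.subset_disc hv) hyw
    have em : (h m).ev ξ = (h m).ev v + t * ((h m).ev y - (h m).ev w) := e _ _
    have ek : (h k).ev ξ = (h k).ev v + t * ((h k).ev y - (h k).ev w) := e _ _
    refine finish ξ hξ ?_ fun k' hjk' hmk' => ?_
    · rw [em, vm, y0, zero_add, zero_sub, mul_neg, neg_lt_zero]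
      exact mul_pos ht (wj m hne)
    · rw [hcommon k' k hjk' hmk' hjk hmk, ek, vk, w0, zero_add, sub_zero]
      exact mul_pos ht (yj k hne.symm)
  · obtain ⟨w, hw, w0, wj⟩ := E.exists_mid j
    have hyw : y ≠ w := by
      rintro rfl
      exact (yj j hmj.symm).ne' w0
    obtain ⟨t, ht, ξ, hξ, e⟩ := exists_exit hy hyw
    have em : (h m).ev ξ = (h m).ev y + t * ((h m).ev y - (h m).ev w) := e _ _
    refine finish ξ hξ ?_ fun k' hjk' hmk' => absurd ⟨k', hjk', hmk'⟩ hex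
    rw [em, y0, zero_add, zero_sub, mul_neg, neg_lt_zero]
    exact mul_pos ht (wj m hmj)

/-- A wall which meets the side `i` and which has the polygon on its left has the image of the
core on its left. -/
theorem lab_core_pos (E : EvenTiling Γ R h) (L : Labelling Γ R h lab star) {i : ι} {t : Geodesic}
    (ht : IsWall Γ R t) (htR : ∀ z ∈ R, 0 ≤ t.ev z) {x : ClosedDisc} (hx : x ∈ R)
    (htx : t.ev x = 0) (hix : (h i).ev x = 0) (hne : ¬ Carries h i t) {ξ : ClosedDisc}
    (hξ : ξ ∈ core R h (star i)) : 0 < t.ev (lab i ξ) := by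
  obtain ⟨u, hu, hum, hxR, hx1, hx2⟩ := E.exists_push (L.isLabel i).symm ht hx hix htx
  have := E.core_pos hum.1 (E.push_nonneg (L.isLabel i).symm hu hum.1 htR hne) hxR hx2 hx1 hξ
  rw [← perm_inv_apply (lab i) ξ] at this
  exact hu.pos_iff.1 this

/-- The interval `I` is the large interval of the side `i`. -/
structure IsLarge (Γ : Subgroup (Equiv.Perm ClosedDisc)) (R : Set ClosedDisc) (h : ι → Geodesic)
    (lab : ι → Equiv.Perm ClosedDisc) (star : ι → ι) (i : ι) (I : Set ClosedDisc) : Prop where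
  mem : I ∈ intervals Γ R
  core_mem : ∀ ξ ∈ core R h (star i), lab i ξ ∈ I
  neg : ∀ ξ ∈ I, (h i).ev ξ < 0
  pos : ∀ t, Meets Γ R t → (∀ z ∈ R, 0 ≤ t.ev z) → ¬ Carries h i t → ∀ ξ ∈ I, 0 < t.ev ξ

theorem not_carries (E : EvenTiling Γ R h) {i j : ι} (hij : i ≠ j) : ¬ Carries h i (h j) := by
  rintro ⟨c, hc, e⟩
  exact hij (E.eq_of_zero_imp fun z _ hz => by rw [e, hz, mul_zero])

theorem IsLarge.side_pos (E : EvenTiling Γ R h) {i : ι} {I : Set ClosedDisc}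
    (H : IsLarge Γ R h lab star i I) {j : ι} (hij : i ≠ j) {ξ : ClosedDisc} (hξ : ξ ∈ I) :
    0 < (h j).ev ξ :=
  H.pos _ (E.meets_side j) (fun _ hz => E.ev_nonneg hz j) (E.not_carries hij) ξ hξ

/-- A geodesic segment leaves the half planes of two geodesics one after the other. -/
theorem exists_cross_two {t w : Geodesic} {ξ v x : ClosedDisc} (htξ : t.ev ξ < 0)
    (hwξ : w.ev ξ < 0) (htv : 0 < t.ev v) (hwv : w.ev v = 0) (hx : x ∈ disc) (htx : t.ev x = 0)
    (hwx : 0 ≤ w.ev x) : ∃ y ∈ disc, t.ev y = 0 ∧ w.ev y = 0 := by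
  obtain ⟨z, -, hz, s, hs0, hs1, hs⟩ := t.exists_cross htξ htv.le
  have et : t.ev z = (1 - s) * t.ev ξ + s * t.ev v := hs _ _
  have ew : w.ev z = (1 - s) * w.ev ξ + s * w.ev v := hs _ _
  have hs1' : s < 1 := by
    refine lt_of_le_of_ne hs1 ?_
    rintro rfl
    rw [hz] at et
    linarith
  have hwz : w.ev z < 0 := by
    rw [ew, hwv, mul_zero, add_zero]
    exact mul_neg_of_pos_of_neg (by linarith) hwξ
  obtain ⟨y, hyd, hy, s', -, -, hs'⟩ := w.exists_cross hwz hwx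
  have et' : t.ev y = (1 - s') * t.ev z + s' * t.ev x := hs' _ _
  exact ⟨y, hyd hx, by rw [et', hz, htx]; ring, hy⟩

theorem exists_isLarge (E : EvenTiling Γ R h) (hN : 5 ≤ Nat.card ι)
    (L : Labelling Γ R h lab star) (i : ι) : ∃ I, IsLarge Γ R h lab star i I := by
  have hN4 : 4 ≤ Nat.card ι := by omega
  obtain ⟨ξ, hξ⟩ := E.core_nonempty hN (star i)
  have hsub : lab i '' core R h (star i) ⊆ circleAtInfinity \ partitionPoints Γ R := by
    rintro _ ⟨η, hη, rfl⟩
    refine ⟨(L.mem_circle_iff E).2 hη.1, fun hP => ?_⟩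
    obtain ⟨-, u, hu, hx, h0⟩ := E.mem_partitionPoints.1 hP
    have hneg := L.neg_iff.2 hη.2.1
    obtain ⟨y, hy, huy, hiy⟩ := E.cross_side hN4 ⟨hu, hx⟩ h0 hneg
    have hnc : ¬ Carries h i u := by
      rintro ⟨c, hc, e⟩
      rw [e, mul_eq_zero, or_iff_right hc] at h0
      exact hneg.ne h0
    rcases E.wall_sign hu with hR | hR
    · exact (E.lab_core_pos L hu hR hy huy hiy hnc hη).ne' h0
    · refine (E.lab_core_pos L (isWall_neg hu) (fun z hz => by simpa using hR z hz) hy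
        (by simpa using huy) hiy ?_ hη).ne' (by simpa using h0)
      rintro ⟨c, hc, e⟩
      refine hnc ⟨-c, neg_ne_zero.2 hc, fun z => ?_⟩
      have := e z
      rw [Geodesic.ev_neg] at this
      linarith
  -- The image of the core is connected and free of partition points, so it lies in a single
  -- interval.
  obtain ⟨I, hI, hξI⟩ := exists_interval (hsub ⟨ξ, hξ, rfl⟩)
  have hcore := subset_interval hI ((isPreconnected_core (R := R) (h := h) (star i)).image (lab i)
    (L.continuous E i).continuousOn) hsub ⟨ξ, hξ, rfl⟩ hξI
  have hnegξ : (h i).ev (lab i ξ) < 0 := L.neg_iff.2 hξ.2.1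
  refine ⟨I, hI, fun η hη => hcore ⟨η, hη, rfl⟩, fun η hη =>
    E.interval_neg hI (E.meets_side i) hξI hnegξ hη, fun t ht htR hnc η hη => ?_⟩
  refine E.interval_pos hI ht hξI ?_ hη
  by_contra! hcon
  have hlt : t.ev (lab i ξ) < 0 := lt_of_le_of_ne hcon (E.interval_ne_zero hI ht hξI)
  obtain ⟨m, hm, m0, mj⟩ := E.exists_mid i
  have hmR := E.mem_of_mid hm m0 mj
  have htm : 0 < t.ev m := by
    refine lt_of_le_of_ne (htR m hmR) fun h0 => ?_
    rcases E.proportional_or_vertex ht.1 hmR h0.symm m0 with hc | ⟨k, hik, hk⟩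
    · exact hnc hc
    · exact (mj k hik.1.symm).ne' hk
  obtain ⟨x, hx, htx⟩ := ht.2
  -- A point behind both `t` and the side `i` forces the two geodesics to cross, and they do so in
  -- R. Then `t` meets the side `i` and has the image of the core on its positive side, a
  -- contradiction.
  obtain ⟨y, hy, ty, iy⟩ := exists_cross_two hlt hnegξ htm m0 (E.subset_disc hx) htx
    (E.ev_nonneg hx i)
  have hyR := E.mem_of_cross hN4 ht.1 (E.isWall_side i) hx htx hmR m0 hy ty iy (by
    by_contra! hall
    obtain ⟨b, -, -, -, -, -, hbne, htb, -⟩ := t.exists_near hy ty univ_mem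
    exact hnc (Geodesic.proportional hbne (hall b htb) iy htb ty))
  exact absurd (E.lab_core_pos L ht.1 htR hyR ty iy hnc hξ) (not_lt.2 hcon)

end EvenTiling

theorem IsImage.image_line {g : Equiv.Perm ClosedDisc} {u k : Geodesic} (H : IsImage g u k)
    (hg : IsDiscMobius g) : g '' u.line = k.line := by
  ext z
  rw [Equiv.image_eq_preimage_symm, mem_preimage, Geodesic.mem_line, Geodesic.mem_line]
  change g⁻¹ z ∈ disc ∧ u.ev (g⁻¹ z) = 0 ↔ _
  rw [← H.zero_iff, perm_apply_inv, ← hg.mem_disc_iff, perm_apply_inv]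

namespace EvenTiling

variable {Γ : Subgroup (Equiv.Perm ClosedDisc)} {R : Set ClosedDisc} {ι : Type} [Finite ι]
  {h : ι → Geodesic} {lab : ι → Equiv.Perm ClosedDisc} {star : ι → ι}

/-! ### Reaching a large interval -/

theorem interval_infinite (E : EvenTiling Γ R h) {I : Set ClosedDisc} (hI : I ∈ intervals Γ R) :
    I.Infinite := by
  obtain ⟨ξ, hξ, rfl⟩ := hI
  exact infinite_component E.finite_partitionPoints hξ

/-- The walls which meet `R` and separate `R` from `I`. -/
def separating (Γ : Subgroup (Equiv.Perm ClosedDisc)) (R I : Set ClosedDisc) :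
    Set (Set ClosedDisc) :=
  {l | ∃ u, Meets Γ R u ∧ (∀ z ∈ R, 0 ≤ u.ev z) ∧ (∀ ξ ∈ I, u.ev ξ < 0) ∧ l = u.line}

theorem finite_separating (E : EvenTiling Γ R h) (I : Set ClosedDisc) :
    (separating Γ R I).Finite := by
  refine E.finite_wallLines.subset ?_
  rintro l ⟨u, hu, -, -, e⟩
  exact ⟨u, hu.1, hu.2, e⟩

theorem not_carries_of_neg (E : EvenTiling Γ R h) {t : Geodesic} (ht : ∀ z ∈ R, 0 ≤ t.ev z) {j : ι}
    {η : ClosedDisc} (hη : t.ev η < 0) (hj : 0 < (h j).ev η) : ¬ Carries h j t := fun H => by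
  obtain ⟨c, hc, e⟩ := H.pos E ht
  rw [e] at hη
  exact absurd (mul_pos hc hj) (not_lt.2 hη.le)

/-- The sign of a wall which meets the side `star i` is constant on the preimage of an interval
under the label of `i`. -/
theorem preimage_neg (E : EvenTiling Γ R h) (L : Labelling Γ R h lab star) {i : ι}
    {I : Set ClosedDisc} (hI : I ∈ intervals Γ R) {t : Geodesic} (ht : IsWall Γ R t)
    {x : ClosedDisc} (hx : x ∈ R) (hjx : (h (star i)).ev x = 0) (htx : t.ev x = 0)
    {ζ η : ClosedDisc} (hζ : lab i ζ ∈ I) (h0 : t.ev ζ < 0) (hη : lab i η ∈ I) : t.ev η < 0 := by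
  obtain ⟨u, hu, hum, -⟩ := E.exists_push (L.isLabel i) ht hx hjx htx
  exact hu.neg_iff.1 (E.interval_neg hI hum hζ (hu.neg_iff.2 h0) hη)

theorem preimage_ne_zero (E : EvenTiling Γ R h) (L : Labelling Γ R h lab star) {i : ι}
    {I : Set ClosedDisc} (hI : I ∈ intervals Γ R) {t : Geodesic} (ht : IsWall Γ R t)
    {x : ClosedDisc} (hx : x ∈ R) (hjx : (h (star i)).ev x = 0) (htx : t.ev x = 0)
    {ζ : ClosedDisc} (hζ : lab i ζ ∈ I) : t.ev ζ ≠ 0 := fun h0 => by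
  obtain ⟨u, hu, hum, -⟩ := E.exists_push (L.isLabel i) ht hx hjx htx
  exact E.interval_ne_zero hI hum hζ (hu.zero_iff.2 h0)

/-- A wall beyond two walls through a vertex `v` contains `v`. -/
theorem zero_of_two_neg (E : EvenTiling Γ R h) (hN : 4 ≤ Nat.card ι) {t u : Geodesic}
    (ht : Meets Γ R t) (htR : ∀ z ∈ R, 0 ≤ t.ev z) (hu : IsWall Γ R u) (huR : ∀ z ∈ R, 0 ≤ u.ev z)
    {k : ι} {v : ClosedDisc} (hv : v ∈ R) (huv : u.ev v = 0) (hkv : (h k).ev v = 0)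
    (hne : ¬ Carries h k u) {η : ClosedDisc} (tη : t.ev η < 0) (uη : u.ev η < 0)
    (kη : (h k).ev η < 0) : t.ev v = 0 := by
  by_contra h0
  have htv : 0 < t.ev v := lt_of_le_of_ne (htR v hv) (Ne.symm h0)
  obtain ⟨x, hx, htx⟩ := ht.2
  have hxd := E.subset_disc hx
  obtain ⟨y, hy, ty, uy⟩ := exists_cross_two tη uη htv huv hxd htx (huR x hx)
  obtain ⟨z, hz, tz, kz⟩ := exists_cross_two tη kη htv hkv hxd htx (E.ev_nonneg hx k)
  have hyv : y ≠ v := by rintro rfl; exact h0 ty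
  have hzv : z ≠ v := by rintro rfl; exact h0 tz
  exact E.no_triangle hN ht.1 hu (E.isWall_side k) (E.subset_disc hv) hz hy h0 huv hkv tz
    (fun uz => hne (Geodesic.proportional hzv kz hkv uz huv)) kz ty uy
    fun ky => hne (Geodesic.proportional hyv ky hkv uy huv)

/-- All walls separating `J` from R pass through the vertex `v` of the side `star i`, so the label
moves them injectively to walls separating `I`. The side `i` also separates `I` but is not among the
images. -/
theorem ncard_separating_lt (E : EvenTiling Γ R h) (L : Labelling Γ R h lab star) {i : ι}
    {I J : Set ClosedDisc} (hI : I ∈ intervals Γ R) (hneg : ∀ ξ ∈ I, (h i).ev ξ < 0)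
    {v : ClosedDisc} (hv : v ∈ R) (hjv : (h (star i)).ev v = 0) {η : ClosedDisc} (hηJ : η ∈ J)
    (hηI : lab i η ∈ I) (H : ∀ t, Meets Γ R t → (∀ z ∈ R, 0 ≤ t.ev z) → t.ev η < 0 → t.ev v = 0) :
    (separating Γ R J).ncard < (separating Γ R I).ncard := by
  have hjη : 0 < (h (star i)).ev η := L.neg_iff.1 (hneg _ hηI)
  rw [← ncard_image_of_injective (separating Γ R J) (Set.image_injective.2 (lab i).injective)]
  refine ncard_lt_ncard ?_ (E.finite_separating I)
  have key : ∀ l ∈ separating Γ R J, lab i '' l ∈ separating Γ R I ∧ lab i '' l ≠ (h i).line := by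
    rintro l ⟨t, ht, htR, htJ, rfl⟩
    have tη := htJ η hηJ
    obtain ⟨u, hu, hum, -⟩ := E.exists_push (L.isLabel i) ht.1 hv hjv (H t ht htR tη)
    have hnc := E.not_carries_of_neg htR tη hjη
    rw [hu.image_line (E.mobius _ (L.isLabel i).mem)]
    refine ⟨⟨u, hum, E.push_nonneg (L.isLabel i) hu hum.1 htR hnc, fun ξ hξ =>
      E.interval_neg hI hum hηI (hu.neg_iff.2 tη) hξ, rfl⟩, fun e => ?_⟩
    obtain ⟨z, hz, hz0, hpos⟩ := E.exists_pos_on_side htR hnc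
    have hm := ((L.isLabel i).mem_iff z).2 ⟨hz, hz0⟩
    have : lab i z ∈ u.line := e ▸ Geodesic.mem_line.2 ⟨E.subset_disc hm.1, hm.2⟩
    exact (hu.pos_iff.2 hpos).ne' (Geodesic.mem_line.1 this).2
  refine ssubset_iff_subset_ne.2 ⟨fun _ ⟨l, hl, e⟩ => e ▸ (key l hl).1, fun e => ?_⟩
  have : (h i).line ∈ separating Γ R I :=
    ⟨h i, E.meets_side i, fun z hz => E.ev_nonneg hz i, hneg, rfl⟩
  rw [← e] at this
  obtain ⟨l, hl, e'⟩ := this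
  exact (key l hl).2 e'

/-- If only the side `k` separates the preimage of `I` from `R`, then that preimage contains the
large interval of the side `k`. -/
theorem lab_large_subset (E : EvenTiling Γ R h) (hN : 4 ≤ Nat.card ι)
    (L : Labelling Γ R h lab star) {i k : ι} {I M : Set ClosedDisc} (hI : I ∈ intervals Γ R)
    (hneg : ∀ ξ ∈ I, (h i).ev ξ < 0) (hM : IsLarge Γ R h lab star k M) (hjk : star i ≠ k)
    {v : ClosedDisc} (hv : v ∈ R) (hjv : (h (star i)).ev v = 0) (hkv : (h k).ev v = 0)
    {ζ : ClosedDisc} (hζ : lab i ζ ∈ I) (hkζ : (h k).ev ζ < 0)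
    (H : ∀ u, IsWall Γ R u → (∀ z ∈ R, 0 ≤ u.ev z) → u.ev v = 0 → u.ev ζ < 0 → Carries h k u) :
    ∀ η ∈ M, lab i η ∈ I := by
  -- This cell is cut out of the arc behind `i` by all walls that meet the side `i`, each oriented
  -- towards `lab i ζ`. It contains no partition point, so being connected it lies in `I`.
  have hX := isPreconnected_cell (h i)
    (fun u : {u : Geodesic // (IsWall Γ R u ∧ 0 < u.ev (lab i ζ)) ∧
      ∃ y ∈ R, (h i).ev y = 0 ∧ u.ev y = 0} => u.1)
    (fun u => u.2.2.imp fun _ hy => hy.2)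
  refine fun η hη => subset_interval hI hX ?_ (x := lab i ζ)
    ⟨(interval_subset hI hζ).1, hneg _ hζ, fun u => u.2.1.2⟩ hζ
    ⟨(L.mem_circle_iff E).2 (interval_subset hM.mem hη).1,
      L.neg_iff.2 (hM.side_pos E hjk.symm hη), ?_⟩
  · rintro ξ ⟨hξ, hiξ, hpos⟩
    refine ⟨hξ, fun hP => ?_⟩
    obtain ⟨-, u, hu, hx, h0⟩ := E.mem_partitionPoints.1 hP
    obtain ⟨y, hy, uy, iy⟩ := E.cross_side hN ⟨hu, hx⟩ h0 hiξ
    rcases lt_or_gt_of_ne (E.interval_ne_zero hI ⟨hu, hx⟩ hζ) with hs | hs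
    · have := hpos ⟨u.neg, ⟨isWall_neg hu, by simpa using hs⟩, y, hy, iy, by simpa using uy⟩
      simp [h0] at this
    · exact (hpos ⟨u, ⟨hu, hs⟩, y, hy, iy, uy⟩).ne' h0
  · rintro ⟨u, ⟨hu, huζ⟩, y, hy, iy, uy⟩
    obtain ⟨t, ht, htm, hyR, jy, ty⟩ := E.exists_push (L.isLabel i).symm hu hy iy uy
    have htζ : 0 < t.ev ζ := by rwa [← ht.pos_iff, perm_inv_apply] at huζ
    rw [← ht.pos_iff, perm_inv_apply]
    rcases E.wall_sign htm.1 with htR | htR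
    · refine hM.pos t htm htR (fun hc => ?_) η hη
      obtain ⟨c, hc, e⟩ := hc.pos E htR
      rw [e] at htζ
      exact absurd (mul_neg_of_pos_of_neg hc hkζ) (not_lt.2 htζ.le)
    · have htR' : ∀ z ∈ R, 0 ≤ t.neg.ev z := fun z hz => by simpa using htR z hz
      have htζ' : t.neg.ev ζ < 0 := by simpa using htζ
      have ty' : t.neg.ev ((lab i)⁻¹ y) = 0 := by simpa using ty
      by_cases h0 : t.neg.ev v = 0
      · obtain ⟨c, hc, e⟩ := (H t.neg (isWall_neg htm.1) htR' h0 htζ').pos E htR'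
        have := mul_neg_of_pos_of_neg hc (hM.neg η hη)
        rw [← e] at this
        simpa using this
      · exfalso
        -- A separating wall through the side `star i` but not through `v` would cross `k` and form
        -- a triangle with `k` and `star i`.
        obtain ⟨x, hx, tx, kx⟩ := exists_cross_two htζ' hkζ
          (lt_of_le_of_ne (htR' v hv) (Ne.symm h0)) hkv (E.subset_disc hyR) ty'
          (E.ev_nonneg hyR k)
        have hxv : x ≠ v := by rintro rfl; exact h0 tx
        have hyv : (lab i)⁻¹ y ≠ v := fun e => h0 (e ▸ ty')
        exact E.no_triangle hN (isWall_neg htm.1) (E.isWall_side k) (E.isWall_side (star i))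
          (E.subset_disc hv) (E.subset_disc hyR) hx h0 hkv hjv ty'
          (fun ky => hjk (E.eq_of_two_points hyv jy hjv ky hkv)) jy tx kx
          fun jx => hjk (E.eq_of_two_points hxv jx hjv kx hkv)

/-- An interval is large, or it covers a large interval, or it covers an interval which fewer
walls separate from `R`. -/
theorem large_or_exists_lt (E : EvenTiling Γ R h) (hN : 4 ≤ Nat.card ι)
    (L : Labelling Γ R h lab star) {M : ι → Set ClosedDisc}
    (hM : ∀ k, IsLarge Γ R h lab star k (M k)) {i : ι} {I : Set ClosedDisc}
    (hI : I ∈ intervals Γ R) (hneg : ∀ ξ ∈ I, (h i).ev ξ < 0) :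
    I = M i ∨ (∃ k, ∀ η ∈ M k, lab i η ∈ I) ∨ ∃ J ∈ intervals Γ R,
      (∃ k, ∀ η ∈ J, (h k).ev η < 0) ∧ (∀ η ∈ J, lab i η ∈ I) ∧
        (separating Γ R J).ncard < (separating Γ R I).ncard := by
  obtain ⟨ξ, hξ⟩ := interval_nonempty hI
  obtain ⟨ζ, rfl⟩ : ∃ ζ, lab i ζ = ξ := ⟨_, perm_apply_inv _ ξ⟩
  by_cases hk : ∃ k, Adj R h (star i) k ∧ (h k).ev ζ < 0
  · obtain ⟨k, ⟨hjk, v, hv, hjv, hkv⟩, hkζ⟩ := hk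
    right
    by_cases hu : ∃ u, IsWall Γ R u ∧ (∀ z ∈ R, 0 ≤ u.ev z) ∧ u.ev v = 0 ∧ u.ev ζ < 0 ∧
        ¬ Carries h k u
    · obtain ⟨u, hu, huR, huv, huζ, hnc⟩ := hu
      right
      -- The point `ζ` may itself be a partition point. The preimage of `I` is infinite and
      -- therefore has a point off the finite set of partition points; the relevant walls have the
      -- same signs there.
      obtain ⟨η, hηI, hηP⟩ := (((E.interval_infinite hI).preimage (f := lab i)
        (fun x _ => ⟨_, perm_apply_inv _ x⟩)).sdiff E.finite_partitionPoints).nonempty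
      have hηI : lab i η ∈ I := hηI
      have hηc : η ∈ circleAtInfinity \ partitionPoints Γ R :=
        ⟨(L.mem_circle_iff E).1 (interval_subset hI hηI).1, hηP⟩
      obtain ⟨J, hJ, hηJ⟩ := exists_interval hηc
      have hkη := E.preimage_neg L hI (E.isWall_side k) hv hjv hkv hξ hkζ hηI
      have huη := E.preimage_neg L hI hu hv hjv huv hξ huζ hηI
      exact ⟨J, hJ, ⟨k, fun _ => E.interval_neg hJ (E.meets_side k) hηJ hkη⟩,
        E.lab_image_subset hN L hI hJ hηJ hηI (L.neg_iff.1 (hneg _ hηI)),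
        E.ncard_separating_lt L hI hneg hv hjv hηJ hηI fun t ht htR tη =>
          E.zero_of_two_neg hN ht htR hu huR hv huv hkv hnc tη huη hkη⟩
    · push Not at hu
      exact Or.inl ⟨k, E.lab_large_subset hN L hI hneg (hM k) hjk hv hjv hkv hξ hkζ hu⟩
  · push Not at hk
    -- No neighbour of `star i` has `ζ` behind it, and none vanishes at `ζ`, as its image is a wall
    -- meeting R. Hence `ζ` lies in the core.
    refine Or.inl (interval_eq hI (hM i).mem hξ ((hM i).core_mem ζ
      ⟨(L.mem_circle_iff E).1 (interval_subset hI hξ).1, L.neg_iff.1 (hneg _ hξ), fun k hjk => ?_⟩))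
    refine lt_of_le_of_ne (hk k hjk) (Ne.symm ?_)
    obtain ⟨-, v, hv, hjv, hkv⟩ := hjk
    exact E.preimage_ne_zero L hI (E.isWall_side k) hv hjv hkv hξ

/-- An interval lies in the core of some side. -/
theorem exists_subset_core (E : EvenTiling Γ R h) (hN : 5 ≤ Nat.card ι) {J : Set ClosedDisc}
    (hJ : J ∈ intervals Γ R) : ∃ l, ∀ η ∈ J, η ∈ core R h l := by
  cases nonempty_fintype ι
  have G := E.isPolygonGraph hN
  obtain ⟨ζ, hζ⟩ := interval_nonempty hJ
  -- Sides with `ζ` behind them are pairwise adjacent, so there are at most two, and some side is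
  -- near neither of them.
  have key : ∃ l, ∀ a, (h a).ev ζ < 0 → ¬ IsPolygonGraph.Near (Adj R h) a l := by
    have adj {a b : ι} (hab : a ≠ b) (ha : (h a).ev ζ < 0) (hb : (h b).ev ζ < 0) : Adj R h a b :=
      E.adj_of_neg (by omega) hab ha hb.le
    by_cases h1 : ∃ a, (h a).ev ζ < 0
    · obtain ⟨a, ha⟩ := h1
      by_cases h2 : ∃ b, a ≠ b ∧ (h b).ev ζ < 0
      · obtain ⟨b, hab, hb⟩ := h2
        obtain ⟨l, hal, hbl⟩ := G.exists_not_near_two (Or.inr (adj hab ha hb))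
        refine ⟨l, fun c hc => ?_⟩
        by_cases hac : a = c
        · exact hac ▸ hal
        by_cases hbc : b = c
        · exact hbc ▸ hbl
        exact (G.not_triangle (adj hab ha hb) (adj hbc hb hc) (adj hac ha hc)).elim
      · push Not at h2
        obtain ⟨l, hl⟩ := G.exists_not_near a
        refine ⟨l, fun c hc => ?_⟩
        by_cases hac : a = c
        · exact hac ▸ hl
        exact absurd hc (not_lt.2 (h2 c hac))
    · push Not at h1
      have : Nonempty ι := (Nat.card_pos_iff.1 (by omega)).1
      exact ⟨Classical.arbitrary ι, fun a ha => absurd ha (not_lt.2 (h1 a))⟩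
  obtain ⟨l, hl⟩ := key
  have pos (a : ι) (ha : IsPolygonGraph.Near (Adj R h) a l) : ∀ η ∈ J, 0 < (h a).ev η := by
    intro η hη
    refine E.interval_pos hJ (E.meets_side a) hζ ?_ hη
    refine lt_of_le_of_ne ?_ (E.interval_ne_zero hJ (E.meets_side a) hζ).symm
    by_contra! hcon
    exact hl a hcon ha
  exact ⟨l, fun η hη => ⟨(interval_subset hJ hη).1, pos l (Or.inl rfl) η hη,
    fun k hk => pos k (Or.inr hk.symm) η hη⟩⟩

end EvenTiling

/-! ### From the graph of sides to the matrix -/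

/-- A transition matrix is strictly irreducible if every state reaches one of a family of states
which cover all states and which follow each other as the pairs of sides which are not adjacent. -/
theorem StrictlyIrreducibleMatrix.of_polygonGraph {A : Type*} [Fintype A] {ι : Type}
    {adj : ι → ι → Prop} (G : IsPolygonGraph adj) [Fintype ι] {star : ι → ι}
    (hs : ∀ i, star (star i) = i) {P : Matrix A A ℝ} (h0 : ∀ I J, 0 ≤ P I J) {m : ι → A}
    (hm : ∀ i k, ¬ IsPolygonGraph.Near adj (star i) k → 0 < P (m i) (m k))
    (pred : ∀ J, ∃ i, 0 < P (m i) J)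
    (reach : ∀ I, ∃ k, Relation.ReflTransGen (fun I J => 0 < P I J) I (m k)) :
    StrictlyIrreducibleMatrix P := by
  constructor
  · refine IrreducibleMatrix.of_transGen h0 fun I J => ?_
    obtain ⟨k, hk⟩ := reach I
    obtain ⟨l, hl⟩ := pred J
    exact .tail (.trans_right hk ((G.transGen_not_near hs k l).lift m hm)) hl
  · have hnn : ∀ I J K, 0 ≤ P I K * P.transpose K J := fun I J K => mul_nonneg (h0 I K) (h0 J K)
    have common {I J K : A} (hI : 0 < P I K) (hJ : 0 < P J K) : 0 < (P * P.transpose) I J := by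
      rw [Matrix.mul_apply]
      exact Finset.sum_pos' (fun K _ => hnn I J K) ⟨K, Finset.mem_univ K, mul_pos hI hJ⟩
    -- A positive entry of the product with the transpose is a common successor. Every state has a
    -- successor, which some `m l` precedes too, so every state is linked to the family.
    have near (I : A) : ∃ l K, 0 < P I K ∧ 0 < P (m l) K := by
      have : ∃ K, 0 < P I K := by
        obtain ⟨k, hk⟩ := reach I
        rcases hk.cases_head with rfl | ⟨K, hK, -⟩
        · obtain ⟨l, hl⟩ := G.exists_not_near (star k)
          exact ⟨m l, hm k l hl⟩
        · exact ⟨K, hK⟩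
      obtain ⟨K, hK⟩ := this
      obtain ⟨l, hl⟩ := pred K
      exact ⟨l, K, hK, hl⟩
    refine IrreducibleMatrix.of_transGen (fun I J => ?_) fun I J => ?_
    · rw [Matrix.mul_apply]
      exact Finset.sum_nonneg fun K _ => hnn I J K
    obtain ⟨k, K, hIK, hkK⟩ := near I
    obtain ⟨l, K', hJK, hlK⟩ := near J
    exact .tail (.head (common hIK hkK) ((G.transGen_common hs k l).lift m
      fun a b ⟨c, hac, hbc⟩ => common (hm a c hac) (hm b c hbc))) (common hlK hJK)

namespace EvenTiling

variable {Γ : Subgroup (Equiv.Perm ClosedDisc)} {R : Set ClosedDisc} {ι : Type} [Finite ι]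
  {h : ι → Geodesic} {lab : ι → Equiv.Perm ClosedDisc} {star : ι → ι}

/-! ### The transition matrix -/

theorem mem_generators (E : EvenTiling Γ R h) (L : Labelling Γ R h lab star)
    {e : Equiv.Perm ClosedDisc} : e ∈ generators Γ R ↔ ∃ i, e = lab i := by
  constructor
  · rintro ⟨s, hs, he⟩
    obtain ⟨i, rfl⟩ := E.isSide_iff.1 hs
    obtain ⟨j, hj⟩ := E.exists_isLabel he
    exact ⟨i, hj.unique E (L.isLabel i)⟩
  · rintro ⟨i, rfl⟩
    exact ⟨_, E.isSide i, E.isExteriorLabel (L.isLabel i)⟩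

/-- The image of R under the label lies behind the side `i`, which fixes the orientation of any
geodesic through that side used to define the arc. -/
theorem mem_arc (E : EvenTiling Γ R h) (L : Labelling Γ R h lab star) {i : ι} {ξ : ClosedDisc} :
    ξ ∈ arc Γ R (lab i) ↔ ξ ∈ circleAtInfinity ∧ (h i).ev ξ < 0 := by
  refine and_congr_right fun hξ => ⟨?_, fun hneg => ?_⟩
  · rintro ⟨s, hs, he, t, hst, ht, hpos⟩
    obtain ⟨i', rfl⟩ := E.isSide_iff.1 hs
    obtain ⟨j, hj⟩ := E.exists_isLabel he
    obtain ⟨rfl, -⟩ := hj.eq_sides E (L.isLabel i)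
    obtain ⟨x, hx, x', hx', hne, x0, x0'⟩ := exists_two_points E.toSideSystem i'
    have zero {y : ClosedDisc} (hy : y ∈ R) (y0 : (h i').ev y = 0) : t.ev y = 0 :=
      (Geodesic.mem_line.1 (hst ((mem_sideSet E.toSideSystem).2 ⟨hy, y0⟩))).2
    obtain ⟨c, -, e⟩ := Geodesic.proportional hne x0 x0' (zero hx x0) (zero hx' x0')
    obtain ⟨o, ho, opos⟩ := E.exists_interior
    have h1 := Geodesic.side_nonneg_iff.1 (ht _ ⟨o, E.mem_of_pos ho opos, rfl⟩)
    have h2 : (h i').ev (lab i' o) < 0 := L.neg_iff.2 (opos _)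
    rw [Geodesic.side_pos_iff, e] at hpos
    rw [e] at h1
    by_contra! hcon
    have hc : c ≤ 0 := by
      by_contra! hc
      exact absurd h1 (not_le.2 (mul_neg_of_pos_of_neg hc h2))
    exact absurd hpos (not_lt.2 (mul_nonpos_of_nonpos_of_nonneg hc hcon))
  · refine ⟨_, E.isSide i, E.isExteriorLabel (L.isLabel i), (h i).neg, ?_, ?_, ?_⟩
    · rw [Geodesic.line_neg]; exact inter_subset_right
    · rintro _ ⟨z, hz, rfl⟩
      exact Geodesic.side_nonneg_iff.2 ((L.isLabel i).image.nonneg_iff.2 (E.ev_nonneg hz _))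
    · rw [Geodesic.side_pos_iff]; simpa using hneg

theorem mem_alphabet (E : EvenTiling Γ R h) (L : Labelling Γ R h lab star) {I : Set ClosedDisc}
    (hI : I ∈ intervals Γ R) {i : ι} (hneg : ∀ ξ ∈ I, (h i).ev ξ < 0) :
    I ∈ intervals Γ R ∧ ∃ e ∈ generators Γ R, I ⊆ arc Γ R e :=
  ⟨hI, lab i, (E.mem_generators L).2 ⟨i, rfl⟩, fun ξ hξ =>
    (E.mem_arc L).2 ⟨(interval_subset hI hξ).1, hneg ξ hξ⟩⟩

theorem finite_alphabet (E : EvenTiling Γ R h) : Finite (Alphabet Γ R) := by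
  have : (intervals Γ R).Finite := finite_components E.finite_partitionPoints fun _ hξ =>
    (E.mem_partitionPoints.1 hξ).1
  exact (this.subset fun I (hI : I ∈ intervals Γ R ∧ _) => hI.1).to_subtype

theorem markovMap_of_mem (c : Alphabet Γ R → Equiv.Perm ClosedDisc) {I : Alphabet Γ R}
    {x : ClosedDisc} (hx : x ∈ I.1) : markovMap Γ R c x = (c I)⁻¹ x := by
  have hex : ∃ I : Alphabet Γ R, x ∈ I.1 := ⟨I, hx⟩
  have : hex.choose = I := Subtype.ext (interval_eq hex.choose.2.1 I.2.1 hex.choose_spec hx)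
  rw [markovMap, dif_pos hex, this]

theorem transitionMatrix_nonneg (c : Alphabet Γ R → Equiv.Perm ClosedDisc) (I J : Alphabet Γ R) :
    0 ≤ transitionMatrix Γ R c I J := by
  rw [transitionMatrix, Matrix.of_apply]
  split_ifs <;> norm_num

theorem transitionMatrix_pos (c : Alphabet Γ R → Equiv.Perm ClosedDisc) {I J : Alphabet Γ R}
    (H : ∀ η ∈ J.1, c I η ∈ I.1) : 0 < transitionMatrix Γ R c I J := by
  rw [transitionMatrix, Matrix.of_apply, if_pos]
  · exact one_pos
  · exact fun η hη => ⟨c I η, H η hη, by rw [markovMap_of_mem c (H η hη), perm_inv_apply]⟩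

theorem strictlyIrreducible (E : EvenTiling Γ R h) (hN : 5 ≤ Nat.card ι)
    [Fintype (Alphabet Γ R)] {c : Alphabet Γ R → Equiv.Perm ClosedDisc} (hc : IsChoice Γ R c) :
    StrictlyIrreducibleMatrix (transitionMatrix Γ R c) := by
  cases nonempty_fintype ι
  have hN4 : 4 ≤ Nat.card ι := by omega
  obtain ⟨lab, star, L⟩ := E.exists_labelling
  have hs : ∀ I, ∃ i, c I = lab i ∧ ∀ ξ ∈ I.1, (h i).ev ξ < 0 := by
    intro I
    obtain ⟨hg, hsub⟩ := hc I
    obtain ⟨i, hi⟩ := (E.mem_generators L).1 hg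
    exact ⟨i, hi, fun ξ hξ => ((E.mem_arc L).1 (hi ▸ hsub hξ)).2⟩
  choose M hM using E.exists_isLarge hN L
  let m : ι → Alphabet Γ R := fun k => ⟨M k, E.mem_alphabet L (hM k).mem (hM k).neg⟩
  -- A large interval lies behind one side only, so there the choice of generator is forced.
  have hcm (k : ι) : c (m k) = lab k := by
    obtain ⟨i, hi, hneg⟩ := hs (m k)
    obtain ⟨ξ, hξ⟩ := interval_nonempty (hM k).mem
    by_cases hki : k = i
    · rw [hi, hki]
    · exact absurd (hneg ξ hξ) (not_lt.2 ((hM k).side_pos E hki hξ).le)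
  have of_core {i : ι} {J : Alphabet Γ R} (hJ : ∀ η ∈ J.1, η ∈ core R h (star i)) :
      0 < transitionMatrix Γ R c (m i) J :=
    transitionMatrix_pos c fun η hη => by
      rw [hcm]; exact (hM i).core_mem η (hJ η hη)
  refine .of_polygonGraph (E.isPolygonGraph hN) L.star_star (transitionMatrix_nonneg c) (m := m)
    (fun i k hik => of_core fun η hη => ⟨(interval_subset (hM k).mem hη).1,
      (hM k).side_pos E (fun e => hik (Or.inl e)) hη, fun l hl =>
        (hM k).side_pos E (fun e => hik (Or.inr (e ▸ hl))) hη⟩) (fun J => ?_) fun I => ?_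
  · obtain ⟨l, hl⟩ := E.exists_subset_core hN J.2.1
    exact ⟨star l, of_core (by rwa [L.star_star])⟩
  -- The side `i` is the one selected by the choice on `I`. The number of walls separating an
  -- interval from R does not depend on the choice, so it can serve as the induction measure.
  · induction hn : (separating Γ R I.1).ncard using Nat.strong_induction_on generalizing I with
    | _ n ih =>
    obtain ⟨i, hi, hneg⟩ := hs I
    rcases E.large_or_exists_lt hN4 L hM I.2.1 hneg with e | ⟨k, hk⟩ | ⟨J, hJ, ⟨k, hk⟩, hJI, hlt⟩
    · have : I = m i := Subtype.ext e
      exact ⟨i, this ▸ .refl⟩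
    · exact ⟨k, .single (transitionMatrix_pos c (by rw [hi]; exact hk))⟩
    · obtain ⟨l, hl⟩ := ih _ (hn ▸ hlt) ⟨J, E.mem_alphabet L hJ hk⟩ rfl
      exact ⟨l, .head (transitionMatrix_pos c (by rw [hi]; exact hJI)) hl⟩

end EvenTiling

end BowenSeries

theorem mainTheorem4 (Γ : Subgroup (Equiv.Perm BowenSeries.ClosedDisc))
    (hΓ : BowenSeries.IsFuchsian Γ) (hfg : Γ.FG) (hne : BowenSeries.IsNonElementary Γ)
    (R : Set BowenSeries.ClosedDisc) (hR : BowenSeries.IsFundamentalPolygon Γ R)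
    (heven : BowenSeries.HasEvenCorners Γ R) (hsides : 5 ≤ (BowenSeries.sides R).ncard) :
    Finite (BowenSeries.Alphabet Γ R) ∧
      ∀ [Fintype (BowenSeries.Alphabet Γ R)]
        (c : BowenSeries.Alphabet Γ R → Equiv.Perm BowenSeries.ClosedDisc),
        BowenSeries.IsChoice Γ R c →
          BowenSeries.StrictlyIrreducibleMatrix (BowenSeries.transitionMatrix Γ R c) := by
  obtain ⟨F, E⟩ := BowenSeries.exists_evenTiling hΓ hR heven
  rw [E.ncard_sides] at hsides
  exact ⟨E.finite_alphabet, fun c hc => E.strictlyIrreducible hsides hc⟩
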